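/- Let $K$ be any field with algebraic closure $\bar K$, let $\Gamma=\mathrm{Aut}(\bar K/K)$ be its absolute Galois group, let $F$ be a smooth finite $K$-group, and let $F_\Gamma=F(\bar K)\rtimes\Gamma$ be the profinite semi-direct product for the natural action of $\Gamma$ on $F(\bar K)$. An $F$-torus is a $K$-torus $T$ equipped with a $K$-action of $F$ by group automorphisms; its module $\hat T$ of geometric characters is then an $F_\Gamma$-module. An $F_\Gamma$-module is called induced if it is isomorphic to a finite direct sum $\bigoplus_i\mathbb{Z}[F_\Gamma/H_i]$ with $H_i$ open subgroups of $F_\Gamma$, and an $F$-torus is called $F$-quasi-split if $\hat T$ is an induced $F_\Gamma$-module. An $F$-isogeny is a surjective $F$-equivariant $K$-homomorphism of $F$-tori with finite kernel. An extension $K'/K$ splits $T$ (resp. $F$) if $T_{K'}\cong\mathbb{G}_m^n$ for some $n\ge 0$ (resp. if $F_{K'}$ is a constant group). (1) Let $T$ be an $F$-torus and $K'/K$ a Galois extension splitting $T$ and $F$. Then there exist an integer $r\geq 1$, an $F$-quasi-split torus $T_0$ split by $K'/K$, an $F$-quasi-split torus $Q$, and an $F$-isogeny $T^r\times T_0\to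 Q$ (where $F$ acts diagonally on the product). (2) Let $M$ be a $\mathbb{Z}$-free $F_\Gamma$-module of finite type over $\mathbb{Z}$, on which $F_\Gamma$ acts continuously ($M$ being discrete). Then there exist an integer $r\geq 1$ and induced $F_\Gamma$-modules $M_0,M_1$ such that $M_1$ is isomorphic to a sub-$F_\Gamma$-module of finite index of $M^r\times M_0$. -/

import Mathlib

open scoped TensorProduct

universe u v w

noncomputable section

namespace FTori

/-! Affine group schemes over a field `K` are represented by their (commutative) Hopf algebras of
functions, morphisms by bialgebra homomorphisms in the opposite direction.  In what follows `A` is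
the Hopf algebra of a group scheme `F = Spec A` over `K`. -/

section Actions

variable {K : Type u} [Field K] {A : Type v} [CommRing A] [HopfAlgebra K A]

/-- The diagonal of two coactions `ρ : B → A ⊗ B`, `ρ' : C → A ⊗ C`, i.e. the map
`B ⊗ C → A ⊗ (B ⊗ C)` dual to `(f, (x, y)) ↦ (f · x, f · y)`. -/
def diagCoaction {B : Type*} {C : Type*} [CommRing B] [Algebra K B] [CommRing C] [Algebra K C]
    (ρ : B →ₐ[K] A ⊗[K] B) (ρ' : C →ₐ[K] A ⊗[K] C) : B ⊗[K] C →ₐ[K] A ⊗[K] (B ⊗[K] C) :=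
  Algebra.TensorProduct.lift
    ((Algebra.TensorProduct.map (AlgHom.id K A) Algebra.TensorProduct.includeLeft).comp ρ)
    ((Algebra.TensorProduct.map (AlgHom.id K A) Algebra.TensorProduct.includeRight).comp ρ')
    (fun _ _ => Commute.all _ _)

end Actions

/-- An affine `K`-group `T = Spec B`, given by its Hopf algebra of functions `B`, together with a left `K`-action `F × T → T` of `F = Spec A` by group automorphisms; the action is given by
`coaction b = ((f, t) ↦ b (f · t))`. -/
structure FGroup (K : Type u) [Field K] (A : Type u) [CommRing A] [HopfAlgebra K A] where
  /-- the ring of functions `B` of `T` -/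
  Fun : Type u
  [commRing : CommRing Fun]
  [hopf : HopfAlgebra K Fun]
  /-- the comorphism of the action `F × T → T` -/
  coaction : Fun →ₐ[K] A ⊗[K] Fun
  /-- `1 · t = t` -/
  one_act : (Algebra.TensorProduct.lid K Fun).toAlgHom.comp
      ((Algebra.TensorProduct.map (Bialgebra.counitAlgHom K A) (AlgHom.id K Fun)).comp coaction) =
    AlgHom.id K Fun
  /-- `(f * g) · t = f · (g · t)` -/
  mul_act : (Algebra.TensorProduct.assoc K K K A A Fun).toAlgHom.comp
      ((Algebra.TensorProduct.map (Bialgebra.comulAlgHom K A) (AlgHom.id K Fun)).comp coaction) =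
    (Algebra.TensorProduct.map (AlgHom.id K A) coaction).comp coaction
  /-- `f · (s * t) = (f · s) * (f · t)` -/
  act_mul : (Algebra.TensorProduct.map (AlgHom.id K A) (Bialgebra.comulAlgHom K Fun)).comp coaction =
    (diagCoaction coaction coaction).comp (Bialgebra.comulAlgHom K Fun)

attribute [instance] FGroup.commRing FGroup.hopf

section Group

variable (K : Type u) [Field K] (A : Type u) [CommRing A] [HopfAlgebra K A]

/-- The group `F(K̄)`, with its multiplication (convolution) coming from the comultiplication
of `A`. -/
abbrev Points : Type u := WithConv (A →ₐ[K] AlgebraicClosure K)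

instance : Group (Points K A) where
  inv f := WithConv.toConv (f.ofConv.comp (HopfAlgebra.antipodeAlgHom K A))
  inv_mul_cancel f := by
    apply WithConv.ofConv_injective
    have h := AlgHom.comp_convMul_distrib f.ofConv
      (WithConv.toConv (HopfAlgebra.antipodeAlgHom K A)) (WithConv.toConv (AlgHom.id K A))
    rw [AlgHom.antipode_id_cancel] at h
    refine Eq.trans h.symm ?_
    ext a
    simp [AlgHom.convOne_def, Algebra.ofId_apply]

/-- The absolute Galois group `Γ` of `K`. -/
abbrev AbsGal : Type u := AlgebraicClosure K ≃ₐ[K] AlgebraicClosure K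

/-- The natural action of `Γ` on `F(K̄)`. -/
def galPoints : AbsGal K →* MulAut (Points K A) where
  toFun σ :=
    { toFun := fun f => WithConv.toConv ((σ : AlgebraicClosure K →ₐ[K] AlgebraicClosure K).comp f.ofConv)
      invFun := fun f =>
        WithConv.toConv ((σ.symm : AlgebraicClosure K →ₐ[K] AlgebraicClosure K).comp f.ofConv)
      left_inv := fun f => by
        apply WithConv.ofConv_injective
        ext a
        simp
      right_inv := fun f => by
        apply WithConv.ofConv_injective
        ext a
        simp
      map_mul' := fun f g => by
        apply WithConv.ofConv_injective
        exact AlgHom.comp_convMul_distrib _ f g }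
  map_one' := by
    ext f
    rfl
  map_mul' σ τ := by
    ext f
    rfl

/-- The group `F_Γ = F(K̄) ⋊ Γ`. -/
abbrev FGal : Type u := Points K A ⋊[galPoints K A] AbsGal K

/-- The topology of `F_Γ`: the product of the discrete topology on `F(K̄)` and of the
Krull topology on `Γ`. -/
instance : TopologicalSpace (FGal K A) :=
  TopologicalSpace.induced (fun g : FGal K A => g.left) ⊥ ⊓
    TopologicalSpace.induced (fun g : FGal K A => g.right) inferInstance

end Group

/-- A `G`-module `M` is *induced* if it is isomorphic to a finite direct sum
`ℤ[G/H₁] ⊕ ⋯ ⊕ ℤ[G/H_k]` with the `H_i` open subgroups of `G`: here `e` is a `G`-equivariant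
isomorphism of `M` onto the free abelian group on the disjoint union of the `G`-sets `G/H_i`. -/
def IsInduced (G : Type u) [Group G] [TopologicalSpace G] (M : Type v) [AddCommGroup M]
    [DistribMulAction G M] : Prop :=
  ∃ (k : ℕ) (H : Fin k → Subgroup G) (_ : ∀ i, IsOpen (H i : Set G))
    (e : M ≃+ ((Σ i : Fin k, G ⧸ H i) →₀ ℤ)),
    ∀ (g : G) (m : M) (i : Fin k) (x : G ⧸ H i), e (g • m) ⟨i, g • x⟩ = e m ⟨i, x⟩

namespace FGroup

variable {K : Type u} [Field K] {A : Type u} [CommRing A] [HopfAlgebra K A]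

section Characters

variable (X : FGroup K A)

/-- For `f ∈ F(K̄)`, the comorphism `K̄ ⊗ B → K̄ ⊗ B` of the automorphism `t ↦ f · t` of `T_K̄`. -/
def pull (f : Points K A) :
    AlgebraicClosure K ⊗[K] X.Fun →ₐ[AlgebraicClosure K] AlgebraicClosure K ⊗[K] X.Fun :=
  Algebra.TensorProduct.lift (Algebra.ofId _ _)
    ((Algebra.TensorProduct.map f.ofConv (AlgHom.id K X.Fun)).comp X.coaction)
    (fun _ _ => Commute.all _ _)

/-- The semilinear action of `Γ` on `K̄ ⊗ B` through the first factor. -/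
def gal (σ : AbsGal K) : AlgebraicClosure K ⊗[K] X.Fun →ₐ[K] AlgebraicClosure K ⊗[K] X.Fun :=
  Algebra.TensorProduct.map (σ : AlgebraicClosure K →ₐ[K] AlgebraicClosure K) (AlgHom.id K X.Fun)

lemma gal_one : X.gal 1 = AlgHom.id K _ := by
  ext <;> simp [gal]

lemma gal_mul (σ τ : AbsGal K) : X.gal (σ * τ) = (X.gal σ).comp (X.gal τ) := by
  ext <;> simp [gal]

lemma pull_includeRight (f : Points K A) :
    ((X.pull f).restrictScalars K).comp Algebra.TensorProduct.includeRight =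
      (Algebra.TensorProduct.map f.ofConv (AlgHom.id K X.Fun)).comp X.coaction := by
  ext b
  simp [pull]

lemma pull_one_tmul (f : Points K A) (b : X.Fun) :
    X.pull f (1 ⊗ₜ b) = Algebra.TensorProduct.map f.ofConv (AlgHom.id K X.Fun) (X.coaction b) := by
  simp [pull, ← Algebra.TensorProduct.one_def]

lemma pull_one : X.pull 1 = AlgHom.id _ _ := by
  ext b
  have h : (Algebra.TensorProduct.map (1 : Points K A).ofConv (AlgHom.id K X.Fun)) =
      (Algebra.TensorProduct.includeRight :
        X.Fun →ₐ[K] AlgebraicClosure K ⊗[K] X.Fun).comp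
      ((Algebra.TensorProduct.lid K X.Fun).toAlgHom.comp
        (Algebra.TensorProduct.map (Bialgebra.counitAlgHom K A) (AlgHom.id K X.Fun))) := by
    ext a
    · simp [AlgHom.convOne_def, Algebra.ofId_apply, Algebra.algebraMap_eq_smul_one]
    · simp
  have h1 := congr($(X.one_act) b)
  simp only [AlgHom.coe_comp, Function.comp_apply, AlgHom.restrictScalars_apply,
    Algebra.TensorProduct.includeRight_apply, pull_one_tmul, h]
  simp only [AlgHom.coe_comp, Function.comp_apply] at h1
  rw [h1]
  simp

lemma pull_mul (f g : Points K A) : X.pull (f * g) = (X.pull g).comp (X.pull f) := by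
  ext b
  have h1 := congr($(X.mul_act) b)
  let Φ : A ⊗[K] (A ⊗[K] X.Fun) →ₐ[K] AlgebraicClosure K ⊗[K] X.Fun :=
    Algebra.TensorProduct.lift ((Algebra.ofId (AlgebraicClosure K) _).restrictScalars K |>.comp f.ofConv)
      (Algebra.TensorProduct.map g.ofConv (AlgHom.id K X.Fun)) (fun _ _ => Commute.all _ _)
  have hl : (Algebra.TensorProduct.map (f * g).ofConv (AlgHom.id K X.Fun)) =
      (Φ.comp (Algebra.TensorProduct.assoc K K K A A X.Fun).toAlgHom).comp
        (Algebra.TensorProduct.map (Bialgebra.comulAlgHom K A) (AlgHom.id K X.Fun)) := by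
    have key : (Algebra.TensorProduct.includeLeft :
          AlgebraicClosure K →ₐ[K] AlgebraicClosure K ⊗[K] X.Fun).comp
        ((Algebra.TensorProduct.lmul' K).comp (Algebra.TensorProduct.map f.ofConv g.ofConv)) =
        (Φ.comp (Algebra.TensorProduct.assoc K K K A A X.Fun).toAlgHom).comp
          Algebra.TensorProduct.includeLeft := by
      ext a <;> simp [Φ, Algebra.ofId_apply]
    ext a
    · simpa [AlgHom.convMul_def] using congr($key (Bialgebra.comulAlgHom K A a))
    · simp [Φ, Algebra.TensorProduct.one_def]
  have hr : ((X.pull g).restrictScalars K).comp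
        (Algebra.TensorProduct.map f.ofConv (AlgHom.id K X.Fun)) =
      Φ.comp (Algebra.TensorProduct.map (AlgHom.id K A) X.coaction) := by
    ext a
    · simp [Φ, pull, Algebra.ofId_apply]
    · simp [Φ, pull]
  simp only [AlgHom.coe_comp, Function.comp_apply, AlgHom.restrictScalars_apply,
    Algebra.TensorProduct.includeRight_apply, pull_one_tmul, hl] at h1 ⊢
  rw [h1]
  exact congr($hr (X.coaction b)).symm

lemma gal_pull (σ : AbsGal K) (f : Points K A) (x : AlgebraicClosure K ⊗[K] X.Fun) :
    X.gal σ (X.pull f x) = X.pull (galPoints K A σ f) (X.gal σ x) := by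
  have h : (X.gal σ).comp (Algebra.TensorProduct.map f.ofConv (AlgHom.id K X.Fun)) =
      Algebra.TensorProduct.map (galPoints K A σ f).ofConv (AlgHom.id K X.Fun) := by
    ext a <;> simp [gal, galPoints]
  have key : (X.gal σ).comp ((X.pull f).restrictScalars K) =
      ((X.pull (galPoints K A σ f)).restrictScalars K).comp (X.gal σ) := by
    ext b
    · simp [pull, gal, Algebra.ofId_apply]
    · simpa [pull, gal, ← Algebra.TensorProduct.one_def] using congr($h (X.coaction b))
  exact congr($key x)

lemma isGroupLikeElem_of_comul {x : AlgebraicClosure K ⊗[K] X.Fun} (h0 : x ≠ 0)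
    (hx : Coalgebra.comul (R := AlgebraicClosure K) x = x ⊗ₜ x) :
    IsGroupLikeElem (AlgebraicClosure K) x := by
  refine ⟨?_, hx⟩
  have h := Coalgebra.rTensor_counit_comul (R := AlgebraicClosure K) x
  rw [hx, LinearMap.rTensor_tmul] at h
  have h2 := congr(TensorProduct.lid (AlgebraicClosure K) _ $h)
  simp only [TensorProduct.lid_tmul] at h2
  exact smul_left_injective _ h0 h2

/-- The natural map `B ⊗ B → (K̄ ⊗ B) ⊗_K̄ (K̄ ⊗ B)`. -/
def baseMul : X.Fun ⊗[K] X.Fun →ₐ[K]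
    (AlgebraicClosure K ⊗[K] X.Fun) ⊗[AlgebraicClosure K] (AlgebraicClosure K ⊗[K] X.Fun) :=
  Algebra.TensorProduct.lift
    ((Algebra.TensorProduct.includeLeft : _ →ₐ[K] _).comp Algebra.TensorProduct.includeRight)
    (((Algebra.TensorProduct.includeRight :
      _ →ₐ[AlgebraicClosure K] _).restrictScalars K).comp Algebra.TensorProduct.includeRight)
    (fun _ _ => Commute.all _ _)

lemma baseMul_tmul (b c : X.Fun) : X.baseMul (b ⊗ₜ c) = (1 ⊗ₜ b) ⊗ₜ (1 ⊗ₜ c) := by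
  simp [baseMul]

lemma comul_one_tmul (b : X.Fun) :
    Coalgebra.comul (R := AlgebraicClosure K) ((1 : AlgebraicClosure K) ⊗ₜ[K] b) =
      X.baseMul (Coalgebra.comul (R := K) b) := by
  rw [TensorProduct.comul_tmul]
  generalize Coalgebra.comul (R := K) b = z
  induction z with
  | zero => simp
  | tmul b c => simp [baseMul_tmul]
  | add y z hy hz => simp only [TensorProduct.tmul_add, map_add, hy, hz]

lemma comul_tmul (c : AlgebraicClosure K) (b : X.Fun) :
    Coalgebra.comul (R := AlgebraicClosure K) (c ⊗ₜ[K] b) =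
      c • X.baseMul (Coalgebra.comul (R := K) b) := by
  rw [← comul_one_tmul, ← map_smul, TensorProduct.smul_tmul', smul_eq_mul, mul_one]

lemma isGroupLikeElem_gal (σ : AbsGal K) {x : AlgebraicClosure K ⊗[K] X.Fun}
    (hx : IsGroupLikeElem (AlgebraicClosure K) x) :
    IsGroupLikeElem (AlgebraicClosure K) (X.gal σ x) := by
  refine X.isGroupLikeElem_of_comul ?_ ?_
  · intro h
    have h1 : X.gal σ⁻¹ (X.gal σ x) = x := by
      rw [← AlgHom.comp_apply, ← gal_mul, inv_mul_cancel, gal_one, AlgHom.id_apply]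
    rw [h, map_zero] at h1
    exact hx.ne_zero h1.symm
  · let s : AlgebraicClosure K ⊗[K] X.Fun →+* AlgebraicClosure K ⊗[K] X.Fun := (X.gal σ).toRingHom
    let τ : AlgebraicClosure K →+* AlgebraicClosure K :=
      (σ : AlgebraicClosure K →ₐ[K] AlgebraicClosure K).toRingHom
    have hs : s.comp (algebraMap (AlgebraicClosure K) (AlgebraicClosure K ⊗[K] X.Fun)) =
        (algebraMap (AlgebraicClosure K) (AlgebraicClosure K ⊗[K] X.Fun)).comp τ := by
      ext a
      simp [s, τ, gal]
    let m := Algebra.TensorProduct.mapRingHom τ s s hs hs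
    have hm (c : AlgebraicClosure K) (z) : m (c • z) = σ c • m z := by
      rw [Algebra.smul_def, map_mul, Algebra.smul_def]
      congr 1
      rw [Algebra.TensorProduct.algebraMap_apply, Algebra.TensorProduct.algebraMap_apply]
      simp [m, s, gal]
    have hb (z : X.Fun ⊗[K] X.Fun) : m (X.baseMul z) = X.baseMul z := by
      induction z with
      | zero => simp
      | tmul b c => simp [baseMul_tmul, m, s, gal]
      | add y z hy hz => simp only [map_add, hy, hz]
    have key (x : AlgebraicClosure K ⊗[K] X.Fun) :
        Coalgebra.comul (R := AlgebraicClosure K) (X.gal σ x) =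
          m (Coalgebra.comul (R := AlgebraicClosure K) x) := by
      induction x with
      | zero => simp
      | tmul c b => rw [comul_tmul, hm, hb, ← comul_tmul]; simp [gal]
      | add y z hy hz => simp only [map_add, hy, hz]
    rw [key, hx.comul_eq_tmul_self, Algebra.TensorProduct.mapRingHom_tmul]
    rfl

lemma isGroupLikeElem_pull (f : Points K A) {x : AlgebraicClosure K ⊗[K] X.Fun}
    (hx : IsGroupLikeElem (AlgebraicClosure K) x) :
    IsGroupLikeElem (AlgebraicClosure K) (X.pull f x) := by
  refine X.isGroupLikeElem_of_comul ?_ ?_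
  · intro h
    have h1 : X.pull f⁻¹ (X.pull f x) = x := by
      rw [← AlgHom.comp_apply, ← pull_mul, mul_inv_cancel, pull_one, AlgHom.id_apply]
    rw [h, map_zero] at h1
    exact hx.ne_zero h1.symm
  · let κ : A ⊗[K] (X.Fun ⊗[K] X.Fun) →ₐ[K]
        (AlgebraicClosure K ⊗[K] X.Fun) ⊗[AlgebraicClosure K] (AlgebraicClosure K ⊗[K] X.Fun) :=
      Algebra.TensorProduct.lift
        (((Algebra.ofId (AlgebraicClosure K) _).restrictScalars K).comp f.ofConv)
        X.baseMul (fun _ _ => Commute.all _ _)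
    let D : AlgebraicClosure K ⊗[K] X.Fun →ₐ[K]
        (AlgebraicClosure K ⊗[K] X.Fun) ⊗[AlgebraicClosure K] (AlgebraicClosure K ⊗[K] X.Fun) :=
      (Bialgebra.comulAlgHom (AlgebraicClosure K)
        (AlgebraicClosure K ⊗[K] X.Fun)).restrictScalars K
    have h1 : D.comp (Algebra.TensorProduct.map f.ofConv (AlgHom.id K X.Fun)) =
        κ.comp (Algebra.TensorProduct.map (AlgHom.id K A) (Bialgebra.comulAlgHom K X.Fun)) := by
      ext a
      · simp [D, κ, comul_tmul, Algebra.ofId_apply, Algebra.algebraMap_eq_smul_one,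
          -TensorProduct.comul_tmul]
      · simp [D, κ, comul_one_tmul, -TensorProduct.comul_tmul, ← Algebra.TensorProduct.one_def]
    have h2 : κ.comp (diagCoaction X.coaction X.coaction) =
        ((Algebra.TensorProduct.map (X.pull f) (X.pull f)).restrictScalars K).comp X.baseMul := by
      have hl : κ.comp (Algebra.TensorProduct.map (AlgHom.id K A)
            Algebra.TensorProduct.includeLeft) =
          (Algebra.TensorProduct.includeLeft : _ →ₐ[K] _).comp
            (Algebra.TensorProduct.map f.ofConv (AlgHom.id K X.Fun)) := by
        ext a
        · simp [κ, Algebra.ofId_apply, ← Algebra.TensorProduct.one_def]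
        · simp [κ, baseMul_tmul, Algebra.TensorProduct.one_def]
      have hr : κ.comp (Algebra.TensorProduct.map (AlgHom.id K A)
            Algebra.TensorProduct.includeRight) =
          ((Algebra.TensorProduct.includeRight : _ →ₐ[AlgebraicClosure K] _).restrictScalars K).comp
            (Algebra.TensorProduct.map f.ofConv (AlgHom.id K X.Fun)) := by
        ext a
        · simp only [κ, Algebra.ofId_apply, AlgHom.comp_apply,
            AlgHom.restrictScalars_apply, Algebra.TensorProduct.includeLeft_apply,
            Algebra.TensorProduct.map_tmul, Algebra.TensorProduct.lift_tmul, map_one, mul_one,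
            Algebra.TensorProduct.includeRight_apply, Algebra.TensorProduct.algebraMap_apply]
          have h := TensorProduct.smul_tmul (R := AlgebraicClosure K) (f.ofConv a)
            (1 : AlgebraicClosure K ⊗[K] X.Fun) (1 : AlgebraicClosure K ⊗[K] X.Fun)
          rw [Algebra.TensorProduct.one_def, TensorProduct.smul_tmul', smul_eq_mul, mul_one] at h
          exact h
        · simp [κ, baseMul_tmul, Algebra.TensorProduct.one_def]
      ext b
      · simpa [diagCoaction, baseMul_tmul, pull_one_tmul, ← Algebra.TensorProduct.one_def]
          using congr($hl (X.coaction b))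
      · simpa [diagCoaction, baseMul_tmul, pull_one_tmul, ← Algebra.TensorProduct.one_def]
          using congr($hr (X.coaction b))
    have key : (Bialgebra.comulAlgHom (AlgebraicClosure K) (AlgebraicClosure K ⊗[K] X.Fun)).comp
        (X.pull f) = (Algebra.TensorProduct.map (X.pull f) (X.pull f)).comp
          (Bialgebra.comulAlgHom (AlgebraicClosure K) (AlgebraicClosure K ⊗[K] X.Fun)) := by
      ext b
      have e1 := congr($h1 (X.coaction b))
      have e2 := congr(κ ($(X.act_mul) b))
      have e3 := congr($h2 (Coalgebra.comul (R := K) b))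
      simp only [AlgHom.coe_comp, Function.comp_apply, AlgHom.restrictScalars_apply,
        Algebra.TensorProduct.includeRight_apply, pull_one_tmul, Bialgebra.comulAlgHom_apply,
        comul_one_tmul, D] at e1 e2 e3 ⊢
      rw [e1, e2, e3]
    have h := congr($key x)
    simpa [hx.comul_eq_tmul_self] using h

/-- The group `T̂` of geometric characters `T_K̄ → 𝔾ₘ`, i.e. of group-like elements of the
Hopf algebra `K̄ ⊗ B` of `T_K̄`, written additively. -/
def Char : Type u := Additive (GroupLike (AlgebraicClosure K) (AlgebraicClosure K ⊗[K] X.Fun))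

instance : AddCommGroup X.Char :=
  inferInstanceAs (AddCommGroup
    (Additive (GroupLike (AlgebraicClosure K) (AlgebraicClosure K ⊗[K] X.Fun))))

/-- The function on `T_K̄` underlying a character. -/
def Char.val {X : FGroup K A} (χ : X.Char) : AlgebraicClosure K ⊗[K] X.Fun :=
  GroupLike.val (Additive.toMul χ)

lemma Char.val_injective : Function.Injective (Char.val (X := X)) :=
  GroupLike.val_injective

lemma Char.val_add (χ ψ : X.Char) : (χ + ψ).val = χ.val * ψ.val := rfl

lemma Char.val_zero : (0 : X.Char).val = 1 := rfl

/-- The action of `F_Γ` on `T̂` deduced by duality from its action on `T(K̄)`: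
`((f, σ) · χ)(t) = (σχ)(f⁻¹ · t)`. -/
instance : DistribMulAction (FGal K A) X.Char where
  smul g χ := Additive.ofMul
    ⟨X.pull g.left⁻¹ (X.gal g.right χ.val),
      X.isGroupLikeElem_pull _ (X.isGroupLikeElem_gal _ (Additive.toMul χ).2)⟩
  one_smul χ := by
    apply Char.val_injective
    change X.pull (1 : FGal K A).left⁻¹ (X.gal (1 : FGal K A).right χ.val) = χ.val
    simp [gal_one, pull_one]
  mul_smul g h χ := by
    apply Char.val_injective
    change X.pull (g * h).left⁻¹ (X.gal (g * h).right χ.val) =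
      X.pull g.left⁻¹ (X.gal g.right (X.pull h.left⁻¹ (X.gal h.right χ.val)))
    simp [gal_pull, gal_mul, pull_mul]
  smul_zero g := by
    apply Char.val_injective
    change X.pull g.left⁻¹ (X.gal g.right (0 : X.Char).val) = (0 : X.Char).val
    simp [Char.val_zero]
  smul_add g χ ψ := by
    apply Char.val_injective
    change X.pull g.left⁻¹ (X.gal g.right (χ + ψ).val) =
      X.pull g.left⁻¹ (X.gal g.right χ.val) * X.pull g.left⁻¹ (X.gal g.right ψ.val)
    simp [Char.val_add]

lemma Char.val_smul (g : FGal K A) (χ : X.Char) :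
    (g • χ).val = X.pull g.left⁻¹ (X.gal g.right χ.val) := rfl

end Characters

section Product

/-- The trivial `K`-group, with the trivial action of `F`. -/
def trivial : FGroup K A where
  Fun := K
  coaction := Algebra.ofId K _
  one_act := by ext
  mul_act := by ext
  act_mul := by ext

lemma diagCoaction_comp_left {B C : Type*} [CommRing B] [Algebra K B] [CommRing C] [Algebra K C]
    (ρ : B →ₐ[K] A ⊗[K] B) (ρ' : C →ₐ[K] A ⊗[K] C) :
    (diagCoaction ρ ρ').comp Algebra.TensorProduct.includeLeft =
      (Algebra.TensorProduct.map (AlgHom.id K A) Algebra.TensorProduct.includeLeft).comp ρ := by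
  ext b
  simp [diagCoaction]

lemma diagCoaction_comp_right {B C : Type*} [CommRing B] [Algebra K B] [CommRing C] [Algebra K C]
    (ρ : B →ₐ[K] A ⊗[K] B) (ρ' : C →ₐ[K] A ⊗[K] C) :
    (diagCoaction ρ ρ').comp Algebra.TensorProduct.includeRight =
      (Algebra.TensorProduct.map (AlgHom.id K A) Algebra.TensorProduct.includeRight).comp ρ' := by
  ext b
  simp [diagCoaction]

lemma one_act_aux (X : FGroup K A) {C : Type*} [CommRing C] [Algebra K C] (ρ : C →ₐ[K] A ⊗[K] C)
    (g : X.Fun →ₐ[K] C)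
    (hg : ρ.comp g = (Algebra.TensorProduct.map (AlgHom.id K A) g).comp X.coaction) :
    ((Algebra.TensorProduct.lid K C).toAlgHom.comp
      ((Algebra.TensorProduct.map (Bialgebra.counitAlgHom K A) (AlgHom.id K C)).comp ρ)).comp g
      = g := by
  have h : ((Algebra.TensorProduct.lid K C).toAlgHom.comp
      (Algebra.TensorProduct.map (Bialgebra.counitAlgHom K A) (AlgHom.id K C))).comp
        (Algebra.TensorProduct.map (AlgHom.id K A) g) =
      g.comp ((Algebra.TensorProduct.lid K X.Fun).toAlgHom.comp
        (Algebra.TensorProduct.map (Bialgebra.counitAlgHom K A) (AlgHom.id K X.Fun))) := by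
    ext <;> simp
  rw [AlgHom.comp_assoc, AlgHom.comp_assoc, hg, ← AlgHom.comp_assoc, ← AlgHom.comp_assoc, h,
    AlgHom.comp_assoc, AlgHom.comp_assoc, X.one_act, AlgHom.comp_id]

lemma mul_act_aux (X : FGroup K A) {C : Type*} [CommRing C] [Algebra K C] (ρ : C →ₐ[K] A ⊗[K] C)
    (g : X.Fun →ₐ[K] C)
    (hg : ρ.comp g = (Algebra.TensorProduct.map (AlgHom.id K A) g).comp X.coaction) :
    ((Algebra.TensorProduct.assoc K K K A A C).toAlgHom.comp
      ((Algebra.TensorProduct.map (Bialgebra.comulAlgHom K A) (AlgHom.id K C)).comp ρ)).comp g =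
    ((Algebra.TensorProduct.map (AlgHom.id K A) ρ).comp ρ).comp g := by
  have h : ((Algebra.TensorProduct.assoc K K K A A C).toAlgHom.comp
      (Algebra.TensorProduct.map (Bialgebra.comulAlgHom K A) (AlgHom.id K C))).comp
        (Algebra.TensorProduct.map (AlgHom.id K A) g) =
      (Algebra.TensorProduct.map (AlgHom.id K A)
        (Algebra.TensorProduct.map (AlgHom.id K A) g)).comp
      ((Algebra.TensorProduct.assoc K K K A A X.Fun).toAlgHom.comp
        (Algebra.TensorProduct.map (Bialgebra.comulAlgHom K A) (AlgHom.id K X.Fun))) := by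
    have h0 : (Algebra.TensorProduct.assoc K K K A A C).toAlgHom.comp
        Algebra.TensorProduct.includeLeft =
      ((Algebra.TensorProduct.map (AlgHom.id K A)
        (Algebra.TensorProduct.map (AlgHom.id K A) g)).comp
        (Algebra.TensorProduct.assoc K K K A A X.Fun).toAlgHom).comp
        Algebra.TensorProduct.includeLeft := by
      ext <;> simp
    ext a
    · simpa using congr($h0 (Coalgebra.comul a))
    · simp [Algebra.TensorProduct.one_def]
  have h' : (Algebra.TensorProduct.map (AlgHom.id K A) ρ).comp
      (Algebra.TensorProduct.map (AlgHom.id K A) g) =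
      (Algebra.TensorProduct.map (AlgHom.id K A)
        (Algebra.TensorProduct.map (AlgHom.id K A) g)).comp
      (Algebra.TensorProduct.map (AlgHom.id K A) X.coaction) := by
    ext a
    · simp
    · simpa using congr((1 : A) ⊗ₜ[K] $hg a)
  rw [AlgHom.comp_assoc, AlgHom.comp_assoc, hg, ← AlgHom.comp_assoc, ← AlgHom.comp_assoc, h,
    AlgHom.comp_assoc, AlgHom.comp_assoc, X.mul_act, AlgHom.comp_assoc, hg,
    ← AlgHom.comp_assoc, ← AlgHom.comp_assoc, h']

lemma act_mul_aux (X : FGroup K A) {C : Type*} [CommRing C] [Bialgebra K C] (ρ : C →ₐ[K] A ⊗[K] C)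
    (g : X.Fun →ₐ[K] C)
    (hg : ρ.comp g = (Algebra.TensorProduct.map (AlgHom.id K A) g).comp X.coaction)
    (hc : (Bialgebra.comulAlgHom K C).comp g =
      (Algebra.TensorProduct.map g g).comp (Bialgebra.comulAlgHom K X.Fun)) :
    ((Algebra.TensorProduct.map (AlgHom.id K A) (Bialgebra.comulAlgHom K C)).comp ρ).comp g =
      ((diagCoaction ρ ρ).comp (Bialgebra.comulAlgHom K C)).comp g := by
  have h1 : (Algebra.TensorProduct.map (AlgHom.id K A) (Bialgebra.comulAlgHom K C)).comp
      (Algebra.TensorProduct.map (AlgHom.id K A) g) =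
      (Algebra.TensorProduct.map (AlgHom.id K A) (Algebra.TensorProduct.map g g)).comp
      (Algebra.TensorProduct.map (AlgHom.id K A) (Bialgebra.comulAlgHom K X.Fun)) := by
    ext a
    · simp
    · simpa using congr((1 : A) ⊗ₜ[K] $hc a)
  have h2 : (diagCoaction ρ ρ).comp (Algebra.TensorProduct.map g g) =
      (Algebra.TensorProduct.map (AlgHom.id K A) (Algebra.TensorProduct.map g g)).comp
        (diagCoaction X.coaction X.coaction) := by
    have hl : (Algebra.TensorProduct.map (AlgHom.id K A)
          (Algebra.TensorProduct.includeLeft : C →ₐ[K] C ⊗[K] C)).comp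
          (Algebra.TensorProduct.map (AlgHom.id K A) g) =
        (Algebra.TensorProduct.map (AlgHom.id K A) (Algebra.TensorProduct.map g g)).comp
          (Algebra.TensorProduct.map (AlgHom.id K A) Algebra.TensorProduct.includeLeft) := by
      ext <;> simp
    have hr : (Algebra.TensorProduct.map (AlgHom.id K A)
          (Algebra.TensorProduct.includeRight : C →ₐ[K] C ⊗[K] C)).comp
          (Algebra.TensorProduct.map (AlgHom.id K A) g) =
        (Algebra.TensorProduct.map (AlgHom.id K A) (Algebra.TensorProduct.map g g)).comp
          (Algebra.TensorProduct.map (AlgHom.id K A) Algebra.TensorProduct.includeRight) := by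
      ext <;> simp
    apply Algebra.TensorProduct.ext'
    intro b c
    have e1 := congr($hl (X.coaction b))
    have e2 := congr($hr (X.coaction c))
    have e3 := congr($hg b)
    have e4 := congr($hg c)
    simp only [AlgHom.comp_apply] at e1 e2 e3 e4
    simp [diagCoaction, e1, e2, e3, e4]
  rw [AlgHom.comp_assoc, hg, ← AlgHom.comp_assoc, h1, AlgHom.comp_assoc, X.act_mul,
    AlgHom.comp_assoc, hc, ← AlgHom.comp_assoc, ← AlgHom.comp_assoc, h2]

/-- The product `X × Y` with the diagonal action of `F`. -/
def prod (X Y : FGroup K A) : FGroup K A where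
  Fun := X.Fun ⊗[K] Y.Fun
  coaction := diagCoaction X.coaction Y.coaction
  one_act := Algebra.TensorProduct.ext
    (one_act_aux X _ _ (diagCoaction_comp_left X.coaction Y.coaction))
    (one_act_aux Y _ _ (diagCoaction_comp_right X.coaction Y.coaction))
  mul_act := Algebra.TensorProduct.ext
    (mul_act_aux X _ _ (diagCoaction_comp_left X.coaction Y.coaction))
    (mul_act_aux Y _ _ (diagCoaction_comp_right X.coaction Y.coaction))
  act_mul := Algebra.TensorProduct.ext
    (act_mul_aux X _ _ (diagCoaction_comp_left X.coaction Y.coaction) (by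
      ext b
      simp only [AlgHom.comp_apply, Bialgebra.comulAlgHom_apply,
        Algebra.TensorProduct.includeLeft_apply, TensorProduct.comul_tmul, Bialgebra.comul_one]
      generalize Coalgebra.comul (R := K) b = z
      induction z with
      | zero => simp
      | tmul b c => simp [Algebra.TensorProduct.one_def]
      | add y z hy hz => simp only [TensorProduct.add_tmul, map_add, hy, hz]))
    (act_mul_aux Y _ _ (diagCoaction_comp_right X.coaction Y.coaction) (by
      ext b
      simp only [AlgHom.comp_apply, Bialgebra.comulAlgHom_apply,
        Algebra.TensorProduct.includeRight_apply, TensorProduct.comul_tmul, Bialgebra.comul_one]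
      generalize Coalgebra.comul (R := K) b = z
      induction z with
      | zero => simp
      | tmul b c => simp [Algebra.TensorProduct.one_def]
      | add y z hy hz => simp only [TensorProduct.tmul_add, map_add, hy, hz]))

/-- The `r`-fold product `X^r` with the diagonal action of `F`. -/
def pow (X : FGroup K A) : ℕ → FGroup K A
  | 0 => trivial
  | r + 1 => (X.pow r).prod X

end Product

/-- The extension `L/K` splits `T`: over `L`, the group `T` becomes isomorphic to some `𝔾ₘⁿ`
(whose Hopf algebra is `L[ℤⁿ]`). -/
def IsSplitBy (X : FGroup K A) (L : Type v) [Field L] [Algebra K L] : Prop :=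
  ∃ n : ℕ, Nonempty (L ⊗[K] X.Fun ≃ₐc[L] AddMonoidAlgebra L (Fin n → ℤ))

/-- `X` is an `F`-torus, i.e. the underlying `K`-group is a torus. -/
def IsTorus (X : FGroup K A) : Prop := X.IsSplitBy (AlgebraicClosure K)

/-- `X` is an `F`-quasi-split torus: an `F`-torus whose module of geometric characters is an
induced `F_Γ`-module. -/
def IsQuasiSplitTorus (X : FGroup K A) : Prop :=
  X.IsTorus ∧ IsInduced (FGal K A) X.Char

/-- There is an `F`-isogeny `X → Y`: an `F`-equivariant homomorphism of `K`-groups which is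
surjective (on underlying spaces of the schemes) and has a finite kernel, the latter being the
spectrum of `𝒪(X) / I_Y 𝒪(X)` with `I_Y` the augmentation ideal of `𝒪(Y)`. -/
def IsIsogenousTo (X Y : FGroup K A) : Prop :=
  ∃ φ : Y.Fun →ₐc[K] X.Fun,
    (Algebra.TensorProduct.map (AlgHom.id K A) (φ : Y.Fun →ₐ[K] X.Fun)).comp Y.coaction =
      X.coaction.comp (φ : Y.Fun →ₐ[K] X.Fun) ∧
    Function.Surjective (PrimeSpectrum.comap ((φ : Y.Fun →ₐ[K] X.Fun) : Y.Fun →+* X.Fun)) ∧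
    Module.Finite K (X.Fun ⧸ (RingHom.ker (Bialgebra.counitAlgHom K Y.Fun)).map
      ((φ : Y.Fun →ₐ[K] X.Fun) : Y.Fun →+* X.Fun))

end FGroup

/-- `L/K` splits `F = Spec A`: the `L`-group `F_L` is the constant group attached to some finite
group `G`, whose Hopf algebra is the algebra of functions `G → L` with comultiplication dual to
the multiplication of `G`. -/
def IsConstantOver (K : Type u) [Field K] (A : Type u) [CommRing A] [HopfAlgebra K A]
    (L : Type v) [Field L] [Algebra K L] : Prop :=
  ∃ (G : Type) (_ : Group G) (_ : Finite G) (e : L ⊗[K] A ≃ₐ[L] (G → L)),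
    ∀ (x : L ⊗[K] A) (g h : G),
      e x (g * h) = Algebra.TensorProduct.lift
        ((Pi.evalAlgHom L (fun _ : G => L) g).comp (e : L ⊗[K] A →ₐ[L] (G → L)))
        ((Pi.evalAlgHom L (fun _ : G => L) h).comp (e : L ⊗[K] A →ₐ[L] (G → L)))
        (fun _ _ => Commute.all _ _) (Coalgebra.comul (R := L) x)

end FTori
end

/-!
Two lattices over a finite group with the same rational character are isogenous. By Artin's
induction theorem, the multiple by `|G|` of the character of a lattice `M`, which is a class
function depending only on cyclic subgroups, is an integral combination of the characters of the
permutation modules `ℤ[G/H]`; moving the negative terms to the other side gives permutation modules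
`M₀` and `M₁` and an injection of finite index `M₁ → M ^ |G| × M₀` (`exists_permModule_isogeny`).
As `F_Γ` acts on a discrete lattice through a finite quotient, this is the statement on modules;
moreover, if the subgroup `1 ⋊ Gal(K̄/E)` of `F_Γ` acts trivially on `M`, then it acts trivially on
`M₀` and `M₁`.

The statement on tori follows by duality. Over a field which splits `F` and `T`, the points of `F`
and the characters of `T` are defined by finitely many elements, hence over a finite Galois
extension `E` of `K` in `K̄` which embeds into it (`exists_finite_splitting`). For such an `E`, a
`K`-group `Spec B` with an action of `F` is called a *model* of an `F_Γ`-module `M` if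
`E ⊗ B ≃ E[M]`, compatibly with the Hopf algebra structures, with the actions of `F(K̄)`, and with
the semilinear actions of `Γ`, for which `B` is the algebra of invariants (`IsModel`). Four facts
make this a dictionary between tori and modules.

* Every `F_Γ`-module on which `Gal(K̄/E)` acts trivially has a model (`exists_isModel`). By
  Speiser's lemma the invariants `B = E[M] ^ Γ` satisfy `E ⊗ B ≃ E[M]`, and they inherit a Hopf
  algebra structure. Since `F` is constant over `E`, the space `E ⊗ A ⊗ B` consists of the functions
  on `F(K̄)` with values in `E ⊗ B`, and the coaction sends `b` to the equivariant function
  `f ↦ f · b`.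
* A torus whose characters are defined over `E` is a model of its character module
  (`exists_isModel_char`), and the character module of a model of `M` is `M`
  (`IsModel.exists_charEquiv`).
* Models are compatible with products and powers (`IsModel.prod`, `IsModel.pow`).
* An injective homomorphism with finite cokernel `N → M` gives an isogeny from a model of `M` to a
  model of `N` (`IsModel.isIsogenousTo`): `E[M]` is integral over `E[N]`, which yields the
  surjectivity, and the functions on the kernel become `E[M / N]` over `E`.

Applied to `T̂`, with `T₀` and `Q` models of `M₀` and `M₁`, this gives the isogeny `T ^ r × T₀ → Q`.
-/

open scoped Topology

noncomputable section

namespace FTori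

/-! ### Artin's induction theorem for lattices -/

/-- The number of points of a `G`-set fixed by an element: the character of a permutation
module. -/
def fixedCount {G : Type*} [Group G] (X : Type*) [MulAction G X] (g : G) : ℤ :=
  Nat.card {x : X // g • x = x}

section Artin

variable {G : Type*} [Group G]

lemma card_conj_mem (H : Subgroup G) (g : G) :
    (Nat.card {y : G // y⁻¹ * g * y ∈ H} : ℤ) = Nat.card H * fixedCount (G ⧸ H) g := by
  have e := QuotientGroup.preimageMkEquivSubgroupProdSet H {x : G ⧸ H | g • x = x}
  have h := Nat.card_congr e
  rw [Nat.card_prod] at h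
  have h2 : Nat.card {y : G // y⁻¹ * g * y ∈ H} =
      Nat.card ↥(QuotientGroup.mk ⁻¹' {x : G ⧸ H | g • x = x} : Set G) := by
    refine Nat.card_congr (Equiv.subtypeEquivRight fun y => ?_)
    simp only [Set.mem_preimage, Set.mem_ofPred_eq, MulAction.Quotient.smul_coe, smul_eq_mul]
    rw [eq_comm, QuotientGroup.eq, mul_assoc]
  rw [h2, h]
  push_cast
  rfl

/-- The number of `y` such that `y⁻¹ g y` generates `C`. -/
def conjGenCount (C : Subgroup G) (g : G) : ℤ :=
  Nat.card {y : G // Subgroup.zpowers (y⁻¹ * g * y) = C}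

open scoped Classical in
lemma conjGenCount_eq_sum (C : Subgroup G) (g : G) [Fintype G] :
    conjGenCount C g = ∑ y : G, if Subgroup.zpowers (y⁻¹ * g * y) = C then 1 else 0 := by
  rw [conjGenCount, Nat.card_eq_fintype_card, Fintype.card_subtype]
  simp

variable [Finite G]

open scoped Classical in
lemma card_mul_fixedCount_eq_sum [Fintype (Subgroup G)] (H : Subgroup G) (g : G) :
    Nat.card H * fixedCount (G ⧸ H) g = ∑ D ∈ Finset.univ.filter (· ≤ H), conjGenCount D g := by
  have := Fintype.ofFinite G
  simp only [← card_conj_mem, conjGenCount_eq_sum]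
  rw [Finset.sum_comm, Nat.card_eq_fintype_card, Fintype.card_subtype]
  simp [Finset.sum_ite_eq, Subgroup.zpowers_le]

/-- The functions `conjGenCount C` are integral combinations of permutation characters, by
induction on `C`: `|C|` times the character of `ℤ[G/C]` is the sum of those attached to the
subgroups of `C`. -/
lemma conjGenCount_mem_span (C : Subgroup G) :
    conjGenCount C ∈ Submodule.span ℤ (Set.range fun H : Subgroup G =>
      (fixedCount (G ⧸ H) : G → ℤ)) := by
  classical
  have := Fintype.ofFinite (Subgroup G)
  induction C using WellFoundedLT.induction with
  | ind C ih =>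
    have h : conjGenCount C = (Nat.card C : ℤ) • (fixedCount (G ⧸ C) : G → ℤ) -
        ∑ D ∈ Finset.univ.filter (· < C), conjGenCount D := by
      ext g
      have h1 := card_mul_fixedCount_eq_sum C g
      have h2 : (Finset.univ.filter (· ≤ C) : Finset (Subgroup G)) =
          insert C (Finset.univ.filter (· < C)) := by
        ext D
        simp [le_iff_eq_or_lt]
      rw [h2, Finset.sum_insert (by simp)] at h1
      simp [h1]
    rw [h]
    refine Submodule.sub_mem _ (Submodule.smul_mem _ _ (Submodule.subset_span ⟨C, rfl⟩))
      (Submodule.sum_mem _ fun D hD => ih D ?_)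
    simpa using hD

/-- **Artin's induction theorem** for integral characters: a class function whose value at `g`
only depends on the cyclic group generated by `g` is, up to the factor `|G|`, an integral
combination of permutation characters. -/
theorem exists_card_mul_eq_sum_fixedCount [Fintype (Subgroup G)] (χ : G → ℤ)
    (hconj : ∀ g y, χ (y⁻¹ * g * y) = χ g)
    (hgen : ∀ g g', Subgroup.zpowers g = Subgroup.zpowers g' → χ g = χ g') :
    ∃ n : Subgroup G → ℤ, ∀ g, Nat.card G * χ g = ∑ H, n H * fixedCount (G ⧸ H) g := by
  classical
  have := Fintype.ofFinite G
  let c : Subgroup G → ℤ := fun C => if h : ∃ g, Subgroup.zpowers g = C then χ h.choose else 0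
  have hc (g : G) : c (Subgroup.zpowers g) = χ g := by
    have h : ∃ g', Subgroup.zpowers g' = Subgroup.zpowers g := ⟨g, rfl⟩
    simp only [c, dif_pos h]
    exact hgen _ _ h.choose_spec
  have key : (fun g => Nat.card G * χ g) = ∑ C, c C • conjGenCount C := by
    ext g
    simp only [Finset.sum_apply, Pi.smul_apply, conjGenCount_eq_sum, smul_eq_mul, Finset.mul_sum]
    rw [Finset.sum_comm]
    simp [hc, hconj, Nat.card_eq_fintype_card]
  have hmem : (fun g => Nat.card G * χ g) ∈ Submodule.span ℤ (Set.range fun H : Subgroup G =>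
      (fixedCount (G ⧸ H) : G → ℤ)) := by
    rw [key]
    exact Submodule.sum_mem _ fun C _ => Submodule.smul_mem _ _ (conjGenCount_mem_span C)
  obtain ⟨n, hn⟩ := Submodule.mem_span_range_iff_exists_fun ℤ |>.1 hmem
  refine ⟨n, fun g => ?_⟩
  have := congr_fun hn g
  simpa using this.symm

end Artin

section Trace

variable {M : Type*} [AddCommGroup M] [Module.Free ℤ M] [Module.Finite ℤ M]

/-- Modulo `p`, the trace of the `p`-th power of an integral matrix is the trace of the matrix, by
Frobenius. -/
lemma trace_pow_prime_modEq (f : Module.End ℤ M) (p : ℕ) [Fact p.Prime] :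
    ((LinearMap.trace ℤ M (f ^ p) : ℤ) : ZMod p) = LinearMap.trace ℤ M f := by
  classical
  let b := Module.Free.chooseBasis ℤ M
  rw [LinearMap.trace_eq_matrix_trace ℤ b, LinearMap.trace_eq_matrix_trace ℤ b,
    ← LinearMap.toMatrix_pow]
  set A := LinearMap.toMatrix b b f
  have h (B : Matrix (Module.Free.ChooseBasisIndex ℤ M) (Module.Free.ChooseBasisIndex ℤ M) ℤ) :
      ((B.trace : ℤ) : ZMod p) = (B.map (Int.castRingHom (ZMod p))).trace := by
    simp [Matrix.trace]
  rw [h, h]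
  have h2 : (A ^ p).map (Int.castRingHom (ZMod p)) = (A.map (Int.castRingHom (ZMod p))) ^ p :=
    map_pow (Int.castRingHom (ZMod p)).mapMatrix A p
  rw [h2, ZMod.trace_pow_card, ZMod.pow_card]

/-- The trace of an integral matrix `f` of finite order only depends on the cyclic group which
it generates: by Dirichlet's theorem there are arbitrarily large primes `p ≡ k`, and
`tr f ^ p ≡ tr f` modulo `p`. -/
lemma trace_pow_eq_of_coprime (f : Module.End ℤ M) {n k : ℕ} (hn : n ≠ 0) (hf : f ^ n = 1)
    (hk : k.Coprime n) : LinearMap.trace ℤ M (f ^ k) = LinearMap.trace ℤ M f := by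
  set d := LinearMap.trace ℤ M (f ^ k) - LinearMap.trace ℤ M f with hd
  obtain ⟨p, hp, hpp, hpk⟩ := Nat.forall_exists_prime_gt_and_modEq d.natAbs hn hk
  have := Fact.mk hpp
  have hfp : f ^ p = f ^ k := by
    rw [← pow_mod_orderOf, ← pow_mod_orderOf f k]
    congr 1
    exact hpk.of_dvd (orderOf_dvd_of_pow_eq_one hf)
  have h := trace_pow_prime_modEq f p
  rw [hfp, ← sub_eq_zero, ← Int.cast_sub, ZMod.intCast_zmod_eq_zero_iff_dvd, ← hd] at h
  have h0 : d = 0 := Int.eq_zero_of_abs_lt_dvd h (by rw [Int.abs_eq_natAbs]; exact_mod_cast hp)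
  exact sub_eq_zero.1 h0

end Trace

section IntegralCharacter

/-- The `ℤ`-linear endomorphism of a `G`-module given by an element of `G`. -/
abbrev smulEnd (G M : Type*) [Group G] [AddCommGroup M] [DistribMulAction G M] :
    G →* Module.End ℤ M where
  toFun g := (DistribSMul.toAddMonoidHom M g).toIntLinearMap
  map_one' := by ext; simp
  map_mul' g h := by ext; simp [mul_smul]

/-- The character of a `G`-module which is a lattice. -/
def latticeChar {G : Type*} (M : Type*) [Group G] [AddCommGroup M] [DistribMulAction G M] (g : G) :
    ℤ := LinearMap.trace ℤ M (smulEnd G M g)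

variable {G M : Type*} [Group G] [AddCommGroup M] [DistribMulAction G M]

lemma latticeChar_conj (g y : G) : latticeChar M (y⁻¹ * g * y) = latticeChar M g := by
  rw [latticeChar, map_mul, LinearMap.trace_mul_comm, ← map_mul, mul_inv_cancel_left,
    latticeChar]

lemma latticeChar_eq_of_zpowers_eq [Module.Free ℤ M] [Module.Finite ℤ M] [Finite G] (g g' : G)
    (h : Subgroup.zpowers g = Subgroup.zpowers g') : latticeChar M g = latticeChar M g' := by
  have hmem : g' ∈ Submonoid.powers g := by
    rw [mem_powers_iff_mem_zpowers, h]
    exact Subgroup.mem_zpowers g'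
  obtain ⟨k, rfl⟩ := hmem
  have hk : k.Coprime (orderOf g) := by
    have h1 := congr(Nat.card $h)
    rw [Nat.card_zpowers, Nat.card_zpowers, orderOf_pow] at h1
    have h0 := orderOf_pos g
    rw [Nat.coprime_comm]
    by_contra hne
    have h2 : 1 < (orderOf g).gcd k :=
      lt_of_le_of_ne (Nat.gcd_pos_of_pos_left _ h0) (Ne.symm hne)
    exact (Nat.div_lt_self h0 h2).ne' h1
  rw [latticeChar, latticeChar, map_pow]
  refine (trace_pow_eq_of_coprime _ (orderOf_pos g).ne' ?_ hk).symm
  rw [← map_pow, pow_orderOf_eq_one, map_one]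

end IntegralCharacter

/-! ### Representations with the same character -/

section CharacterDetermines

open Representation

variable {k G V W : Type*} [Field k] [Group G] [AddCommGroup V] [Module k V] [AddCommGroup W]
  [Module k W]

lemma isCompl_toSubmodule {ρ : Representation k G V} {p q : Subrepresentation ρ} (h : IsCompl p q) :
    IsCompl p.toSubmodule q.toSubmodule := by
  constructor
  · rw [disjoint_iff, ← Subrepresentation.toSubmodule_inf, h.inf_eq_bot]
    rfl
  · rw [codisjoint_iff, ← Subrepresentation.toSubmodule_sup, h.sup_eq_top]
    rfl

/-- A representation is the direct sum of two complementary subrepresentations. -/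
def prodEquivOfIsCompl {ρ : Representation k G V} (p q : Subrepresentation ρ) (h : IsCompl p q) :
    (p.toRepresentation.prod q.toRepresentation).Equiv ρ :=
  .mk (Submodule.prodEquivOfIsCompl p.toSubmodule q.toSubmodule (isCompl_toSubmodule h)) (by
    intro g
    ext x
    · simp [Subrepresentation.toRepresentation]
    · simp [Subrepresentation.toRepresentation])

lemma character_prod [FiniteDimensional k V] [FiniteDimensional k W] (ρ : Representation k G V)
    (σ : Representation k G W) (g : G) :
    (ρ.prod σ).character g = ρ.character g + σ.character g :=
  LinearMap.trace_prodMap' _ _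

variable [Finite G] [CharZero k]

/-- In characteristic zero, finite-dimensional representations of a finite group with the same
character are isomorphic: by the formula for `dim Hom_G` in terms of characters there is a nonzero
morphism, and one may split off its image on both sides. -/
theorem nonempty_equiv_of_character_eq [FiniteDimensional k V] [FiniteDimensional k W]
    (ρ : Representation k G V) (σ : Representation k G W)
    (h : ∀ g, ρ.character g = σ.character g) : Nonempty (ρ.Equiv σ) := by
  have := Fintype.ofFinite G
  have hG : (Nat.card G : k) ≠ 0 := Nat.cast_ne_zero.2 Nat.card_pos.ne'
  have := invertibleOfNonzero hG
  induction hn : Module.finrank k V using Nat.strong_induction_on generalizing V W with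
  | _ n ih =>
  have hdim : Module.finrank k V = Module.finrank k W := by
    have := h 1
    rw [char_one, char_one] at this
    exact_mod_cast this
  rcases subsingleton_or_nontrivial V with hV | hV
  · have hW : Subsingleton W := by
      rw [← Module.finrank_zero_iff (R := k), ← hdim, Module.finrank_zero_iff]
      exact hV
    exact ⟨.mk 0 (fun g => Subsingleton.elim _ _)⟩
  have hhom : Module.finrank k (IntertwiningMap ρ σ) = Module.finrank k (IntertwiningMap ρ ρ) := by
    have h1 := card_inv_mul_sum_char_mul_char_eq_finrank ρ σ
    have h2 := card_inv_mul_sum_char_mul_char_eq_finrank ρ ρ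
    simp only [h] at h1 h2
    rw [h1] at h2
    exact_mod_cast h2
  have hfin : Module.Finite k (IntertwiningMap ρ ρ) :=
    Module.Finite.of_injective (IntertwiningMap.toLinearMapl ρ ρ)
      (fun f g hfg => IntertwiningMap.ext (by simpa using hfg))
  have hpos : 0 < Module.finrank k (IntertwiningMap ρ σ) := by
    rw [hhom]
    have : Nontrivial (IntertwiningMap ρ ρ) := by
      obtain ⟨x, hx⟩ := exists_ne (0 : V)
      exact ⟨IntertwiningMap.id ρ, 0, fun h0 => hx (by simpa using congr($h0 x))⟩
    exact Module.finrank_pos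
  obtain ⟨f, hf⟩ : ∃ f : IntertwiningMap ρ σ, f ≠ 0 := by
    by_contra! hall
    have : Subsingleton (IntertwiningMap ρ σ) := ⟨fun a b => (hall a).trans (hall b).symm⟩
    rw [Module.finrank_zero_of_subsingleton] at hpos
    exact lt_irrefl _ hpos
  obtain ⟨C, hC⟩ := exists_isCompl (IntertwiningMap.ker ρ σ f)
  obtain ⟨D, hD⟩ := exists_isCompl (IntertwiningMap.range ρ σ f)
  let eV := prodEquivOfIsCompl _ _ hC
  let eW := prodEquivOfIsCompl _ _ hD.symm
  have hC' : IsCompl C.toSubmodule (LinearMap.ker f.toLinearMap) :=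
    (isCompl_toSubmodule hC).symm
  let eC : C.toRepresentation.Equiv (IntertwiningMap.range ρ σ f).toRepresentation :=
    .mk (f.toLinearMap.kerComplementEquivRange hC') (by
      intro g
      ext x
      exact IntertwiningMap.isIntertwining ρ σ f g x)
  obtain ⟨eK⟩ : Nonempty ((IntertwiningMap.ker ρ σ f).toRepresentation.Equiv
      D.toRepresentation) := by
    refine ih (Module.finrank k (IntertwiningMap.ker ρ σ f).toSubmodule) ?_ _ _ (fun g => ?_) rfl
    · rw [← hn]
      refine Submodule.finrank_lt (fun htop => hf ?_)
      ext x
      have : x ∈ (IntertwiningMap.ker ρ σ f).toSubmodule := htop ▸ Submodule.mem_top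
      exact this
    · have h1 := h g
      rw [← char_iso eV, ← char_iso eW, character_prod, character_prod, char_iso eC] at h1
      exact add_right_cancel h1
  exact ⟨eV.symm.trans (Representation.Equiv.trans (.mk
    (eK.toLinearEquiv.prodCongr eC.toLinearEquiv) (by
    intro g
    refine LinearMap.ext fun x => Prod.ext ?_ ?_
    · exact IntertwiningMap.isIntertwining _ _ eK.toIntertwiningMap g x.1
    · exact IntertwiningMap.isIntertwining _ _ eC.toIntertwiningMap g x.2)) eW)⟩

end CharacterDetermines

/-! ### Permutation modules and isogenies of lattices -/

/-- The permutation module `ℤ[X]` on a `G`-set `X`. -/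
def PermModule (X : Type*) : Type _ := X →₀ ℤ

namespace PermModule

variable (X : Type*)

instance : AddCommGroup (PermModule X) := inferInstanceAs (AddCommGroup (X →₀ ℤ))

instance : Module.Free ℤ (PermModule X) := inferInstanceAs (Module.Free ℤ (X →₀ ℤ))

instance [Finite X] : Module.Finite ℤ (PermModule X) :=
  inferInstanceAs (Module.Finite ℤ (X →₀ ℤ))

instance {G : Type*} [Group G] [MulAction G X] : DistribMulAction G (PermModule X) where
  smul g f := Finsupp.mapDomain (g • ·) f
  one_smul f := by
    change Finsupp.mapDomain ((1 : G) • ·) f = f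
    simp only [one_smul]
    exact Finsupp.mapDomain_id
  mul_smul g h f := by
    have h1 : ((g * h) • · : X → X) = (g • ·) ∘ (h • ·) := funext fun x => mul_smul g h x
    exact (congrArg (fun t => Finsupp.mapDomain t (f : X →₀ ℤ)) h1).trans Finsupp.mapDomain_comp
  smul_zero _ := Finsupp.mapDomain_zero
  smul_add _ _ _ := Finsupp.mapDomain_add

variable {X} {G : Type*} [Group G] [MulAction G X]

lemma smul_def (g : G) (f : PermModule X) : g • f = Finsupp.mapDomain (g • ·) f := rfl

lemma smul_apply_smul (g : G) (f : PermModule X) (x : X) :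
    (show X →₀ ℤ from g • f) (g • x) = (show X →₀ ℤ from f) x :=
  Finsupp.mapDomain_apply (MulAction.injective g) f x

lemma smul_eq_self_of_forall (g : G) (h : ∀ x : X, g • x = x) (f : PermModule X) : g • f = f := by
  rw [smul_def, show (fun x : X => g • x) = id from funext h]
  exact Finsupp.mapDomain_id

lemma latticeChar_eq [Finite X] (g : G) : latticeChar (PermModule X) g = fixedCount X g := by
  classical
  have := Fintype.ofFinite X
  let b : Module.Basis X ℤ (PermModule X) := Finsupp.basisSingleOne
  rw [latticeChar, LinearMap.trace_eq_matrix_trace ℤ b, fixedCount, Nat.card_eq_fintype_card,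
    Fintype.card_subtype, Matrix.trace, Finset.card_filter]
  push_cast
  refine Finset.sum_congr rfl fun x _ => ?_
  rw [Matrix.diag_apply, LinearMap.toMatrix_apply]
  change (Finsupp.mapDomain (g • ·) (Finsupp.single x 1) : X →₀ ℤ) x = _
  rw [Finsupp.mapDomain_single, Finsupp.single_apply]

end PermModule

lemma fixedCount_sigma {G ι : Type*} [Group G] [Fintype ι] (X : ι → Type*) [∀ i, MulAction G (X i)]
    [∀ i, Finite (X i)] (g : G) : fixedCount (Σ i, X i) g = ∑ i, fixedCount (X i) g := by
  have e : {x : Σ i, X i // g • x = x} ≃ Σ i, {x : X i // g • x = x} :=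
    { toFun := fun x => ⟨x.1.1, x.1.2, eq_of_heq (Sigma.ext_iff.1 x.2).2⟩
      invFun := fun x => ⟨⟨x.1, x.2.1⟩, Sigma.ext rfl (heq_of_eq x.2.2)⟩
      left_inv := fun x => rfl
      right_inv := fun x => rfl }
  rw [fixedCount, Nat.card_congr e, Nat.card_sigma]
  simp [fixedCount]

section LatticeChar

variable {G M N : Type*} [Group G] [AddCommGroup M] [DistribMulAction G M]
  [Module.Free ℤ M] [Module.Finite ℤ M] [AddCommGroup N] [DistribMulAction G N]
  [Module.Free ℤ N] [Module.Finite ℤ N]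

lemma latticeChar_prod (g : G) : latticeChar (M × N) g = latticeChar M g + latticeChar N g :=
  LinearMap.trace_prodMap' (smulEnd G M g) (smulEnd G N g)

lemma latticeChar_pi (r : ℕ) (g : G) : latticeChar (Fin r → M) g = r * latticeChar M g := by
  classical
  let b := Module.Free.chooseBasis ℤ M
  rw [latticeChar, latticeChar, LinearMap.trace_eq_matrix_trace ℤ b,
    LinearMap.trace_eq_matrix_trace ℤ (Pi.basis fun _ : Fin r => b), Matrix.trace, Matrix.trace,
    Fintype.sum_sigma]
  simp only [Matrix.diag_apply, LinearMap.toMatrix_apply]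
  rw [Finset.sum_congr rfl fun i _ => Finset.sum_congr rfl fun j _ => show _ =
    (b.repr (smulEnd G M g (b j))) j from ?_]
  · simp
  · simp [Pi.basis_repr, Pi.basis_apply]

end LatticeChar

section Commensurable

/-- The rational representation attached to a lattice. -/
def rationalRep (G M : Type*) [Group G] [AddCommGroup M] [DistribMulAction G M] :
    Representation ℚ G (ℚ ⊗[ℤ] M) :=
  (Module.End.baseChangeHom ℤ ℚ M : Module.End ℤ M →* Module.End ℚ (ℚ ⊗[ℤ] M)).comp (smulEnd G M)

lemma exists_nsmul_eq_one_tmul {N : Type*} [AddCommGroup N] (x : ℚ ⊗[ℤ] N) :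
    ∃ d : ℕ, d ≠ 0 ∧ ∃ n : N, d • x = 1 ⊗ₜ n := by
  induction x with
  | zero => exact ⟨1, one_ne_zero, 0, by simp⟩
  | tmul q n =>
    refine ⟨q.den, q.den_ne_zero, q.num • n, ?_⟩
    rw [← TensorProduct.smul_tmul, TensorProduct.smul_tmul']
    congr 1
    simp
  | add x y hx hy =>
    obtain ⟨d, hd, n, hn⟩ := hx
    obtain ⟨e, he, m, hm⟩ := hy
    refine ⟨d * e, mul_ne_zero hd he, e • n + d • m, ?_⟩
    rw [smul_add, mul_comm, mul_smul, hn, mul_comm, mul_smul, hm, TensorProduct.tmul_add,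
      TensorProduct.tmul_smul, TensorProduct.tmul_smul]

variable {G M N : Type*} [Group G] [Finite G] [AddCommGroup M] [DistribMulAction G M]
  [Module.Free ℤ M] [Module.Finite ℤ M] [AddCommGroup N] [DistribMulAction G N]
  [Module.Free ℤ N] [Module.Finite ℤ N]

/-- Two lattices with the same character are isogenous: they are isomorphic over `ℚ`, and one may
clear the denominators of an isomorphism. -/
theorem exists_injective_finiteIndex_of_latticeChar_eq
    (h : ∀ g : G, latticeChar M g = latticeChar N g) :
    ∃ j : M →+[G] N, Function.Injective j ∧ (j : M →+ N).range.FiniteIndex := by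
  obtain ⟨ψ⟩ := nonempty_equiv_of_character_eq (rationalRep G M) (rationalRep G N) (fun g => by
    have hM := LinearMap.trace_baseChange (smulEnd G M g) ℚ
    have hN := LinearMap.trace_baseChange (smulEnd G N g) ℚ
    refine hM.trans (Eq.trans ?_ hN.symm)
    exact congr_arg _ (h g))
  let ι : N →ₗ[ℤ] ℚ ⊗[ℤ] N := TensorProduct.mk ℤ ℚ N 1
  have hι : Function.Injective ι := Module.Flat.tensorProduct_mk_injective ℤ N ℚ
  let ιM : M →ₗ[ℤ] ℚ ⊗[ℤ] M := TensorProduct.mk ℤ ℚ M 1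
  have hιM : Function.Injective ιM := Module.Flat.tensorProduct_mk_injective ℤ M ℚ
  let ψ' : M →ₗ[ℤ] ℚ ⊗[ℤ] N := (ψ.toLinearEquiv.toLinearMap.restrictScalars ℤ).comp ιM
  let b := Module.Free.chooseBasis ℤ M
  choose d hd n hn using fun i => exists_nsmul_eq_one_tmul (ψ' (b i))
  let D := ∏ i, d i
  have hD : D ≠ 0 := Finset.prod_ne_zero_iff.2 fun i _ => hd i
  have hrange : ∀ m, (D • ψ') m ∈ LinearMap.range ι := by
    intro m
    have : (D • ψ') m = ∑ i, (b.repr m) i • D • ψ' (b i) := by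
      conv_lhs => rw [← b.sum_repr m, map_sum]
      exact Finset.sum_congr rfl fun i _ => map_smul (D • ψ') _ _
    rw [this]
    refine Submodule.sum_mem _ fun i _ => Submodule.smul_mem _ _ ?_
    obtain ⟨e, he⟩ := Finset.dvd_prod_of_mem d (Finset.mem_univ i)
    refine ⟨e • n i, ?_⟩
    rw [map_nsmul]
    change e • (1 ⊗ₜ[ℤ] n i : ℚ ⊗[ℤ] N) = _
    rw [← hn, ← mul_smul, mul_comm, ← he]
  let j₀ : M →ₗ[ℤ] N := (LinearEquiv.ofInjective ι hι).symm.toLinearMap.comp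
    ((D • ψ').codRestrict _ hrange)
  have hj₀ (m : M) : ι (j₀ m) = D • ψ' m := by
    have := LinearEquiv.apply_symm_apply (LinearEquiv.ofInjective ι hι)
      ((D • ψ').codRestrict _ hrange m)
    exact congr_arg Subtype.val this
  have hψ (g : G) (m : M) : ψ' (g • m) = rationalRep G N g (ψ' m) := by
    have h1 := Representation.IntertwiningMap.isIntertwining _ _ ψ.toIntertwiningMap g (ιM m)
    refine Eq.trans ?_ h1
    change ψ _ = ψ _
    congr 1
  have hιg (g : G) (x : N) : ι (g • x) = rationalRep G N g (ι x) := rfl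
  have hinj : Function.Injective j₀ := by
    intro x y hxy
    have h1 : D • ψ' x = D • ψ' y := by rw [← hj₀, ← hj₀, hxy]
    rw [← Nat.cast_smul_eq_nsmul ℚ, ← Nat.cast_smul_eq_nsmul ℚ] at h1
    have h2 := smul_right_injective _ (Nat.cast_ne_zero.2 hD) h1
    exact hιM (ψ.toLinearEquiv.injective h2)
  let j : M →+[G] N :=
    { j₀.toAddMonoidHom with
      map_smul' := fun g m => hι (by
        change ι (j₀ (g • m)) = ι (g • j₀ m)
        rw [hj₀, hψ, hιg, hj₀, map_nsmul]) }
  refine ⟨j, hinj, ?_⟩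
  have hfr : Module.finrank ℤ (LinearMap.range j₀) = Module.finrank ℤ N := by
    rw [LinearMap.finrank_range_of_inj hinj]
    have h1 := ψ.toLinearEquiv.finrank_eq
    rwa [Module.finrank_baseChange, Module.finrank_baseChange] at h1
  have hfin : Finite (N ⧸ LinearMap.range j₀) := Submodule.finiteQuotientOfFreeOfRankEq _ hfr
  have : Finite (N ⧸ (j : M →+ N).range) := hfin
  exact AddSubgroup.finiteIndex_of_finite_quotient

/-- Every lattice over a finite group is stably isogenous, up to a multiple, to a permutation
module. -/
theorem exists_permModule_isogeny.{a, b} {G : Type a} [Group G] [Finite G] {M : Type b}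
    [AddCommGroup M] [DistribMulAction G M] [Module.Free ℤ M] [Module.Finite ℤ M] :
    ∃ r : ℕ, 1 ≤ r ∧ ∃ (X₀ X₁ : Type a) (_ : MulAction G X₀) (_ : MulAction G X₁)
      (_ : Finite X₀) (_ : Finite X₁) (j : PermModule X₁ →+[G] (Fin r → M) × PermModule X₀),
      Function.Injective j ∧
        (j : PermModule X₁ →+ (Fin r → M) × PermModule X₀).range.FiniteIndex := by
  have := Fintype.ofFinite (Subgroup G)
  obtain ⟨n, hn⟩ := exists_card_mul_eq_sum_fixedCount (latticeChar M : G → ℤ) latticeChar_conj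
    latticeChar_eq_of_zpowers_eq
  -- the disjoint union of `s H` copies of `G/H` for all `H`
  let X (s : Subgroup G → ℕ) : Type a := Σ p : (Σ H : Subgroup G, Fin (s H)), G ⧸ p.1
  have hX (s : Subgroup G → ℕ) (g : G) :
      fixedCount (X s) g = ∑ H, s H * fixedCount (G ⧸ H) g := by
    rw [fixedCount_sigma, Fintype.sum_sigma]
    refine Finset.sum_congr rfl fun H _ => ?_
    change ∑ _ : Fin (s H), fixedCount (G ⧸ H) g = _
    rw [Finset.sum_const, Finset.card_univ, Fintype.card_fin, nsmul_eq_mul]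
  refine ⟨Nat.card G, Nat.card_pos, X (fun H => (-n H).toNat), X (fun H => (n H).toNat),
    inferInstance, inferInstance, inferInstance, inferInstance,
    exists_injective_finiteIndex_of_latticeChar_eq fun g => ?_⟩
  rw [latticeChar_prod, latticeChar_pi, PermModule.latticeChar_eq, PermModule.latticeChar_eq, hX,
    hX, hn, ← Finset.sum_add_distrib]
  refine Finset.sum_congr rfl fun H _ => ?_
  rw [← add_mul]
  congr 1
  omega

end Commensurable

/-! ### The topology of the semidirect product -/

/-- The permutation module on a finite `G`-set with open stabilizers is induced: decompose the
set into orbits. -/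
lemma isInduced_permModule {G : Type u} [Group G] [TopologicalSpace G] (X : Type v) [Finite X]
    [MulAction G X] (hX : ∀ x : X, IsOpen (MulAction.stabilizer G x : Set G)) :
    IsInduced G (PermModule X) := by
  have := Fintype.ofFinite (Quotient (MulAction.orbitRel G X))
  let ω := (Fintype.equivFin (Quotient (MulAction.orbitRel G X))).symm
  let x (i : Fin (Fintype.card (Quotient (MulAction.orbitRel G X)))) : X := (ω i).out
  let Φ : (Σ i, G ⧸ MulAction.stabilizer G (x i)) → X :=
    fun p => MulAction.ofQuotientStabilizer G (x p.1) p.2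
  have hΦ : Function.Bijective Φ := by
    constructor
    · rintro ⟨i, p⟩ ⟨j, q⟩ h
      induction p using QuotientGroup.induction_on with | _ g =>
      induction q using QuotientGroup.induction_on with | _ g' =>
      have h' : g • x i = g' • x j := h
      have hij : i = j := by
        apply ω.injective
        rw [← Quotient.out_eq (ω i), ← Quotient.out_eq (ω j)]
        refine Quotient.sound ⟨g⁻¹ * g', ?_⟩
        change (g⁻¹ * g') • x j = x i
        rw [mul_smul, ← h', inv_smul_smul]
      subst hij
      congr 1
      exact MulAction.injective_ofQuotientStabilizer G (x i) h
    · intro y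
      let i := ω.symm (Quotient.mk _ y)
      have hy : Quotient.mk (MulAction.orbitRel G X) y = Quotient.mk _ (x i) := by
        simp only [x, i, Equiv.apply_symm_apply, Quotient.out_eq]
      obtain ⟨g, hg⟩ := Quotient.exact hy
      exact ⟨⟨i, g⟩, hg⟩
  let e := Equiv.ofBijective Φ hΦ
  refine ⟨_, fun i => MulAction.stabilizer G (x i), fun i => hX _,
    (Finsupp.domCongr e.symm : (X →₀ ℤ) ≃+ _), fun g m i q => ?_⟩
  have hq : Φ ⟨i, g • q⟩ = g • Φ ⟨i, q⟩ := by
    induction q using QuotientGroup.induction_on with | _ g' =>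
    exact mul_smul g g' (x i)
  change (show X →₀ ℤ from g • m) (Φ ⟨i, g • q⟩) = (show X →₀ ℤ from m) (Φ ⟨i, q⟩)
  rw [hq]
  exact PermModule.smul_apply_smul g m _

lemma IsInduced.of_equiv {G : Type u} [Group G] [TopologicalSpace G] {M : Type v} {N : Type w}
    [AddCommGroup M] [DistribMulAction G M] [AddCommGroup N] [DistribMulAction G N]
    (h : IsInduced G M) (f : N ≃+ M) (hf : ∀ (g : G) (n : N), f (g • n) = g • f n) :
    IsInduced G N := by
  obtain ⟨k, H, hH, e, he⟩ := h
  exact ⟨k, H, hH, f.trans e, fun g n i x => by simp [hf, he]⟩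

/-- A lattice on which `G` acts through a finite quotient is stably isogenous, up to a multiple,
to a permutation module; the permutation modules factor through the same quotient of `G`. -/
theorem exists_permModule_isogeny_of_finiteIndex {G : Type u} [Group G] {M : Type v}
    [AddCommGroup M] [DistribMulAction G M] [Module.Free ℤ M] [Module.Finite ℤ M]
    (hM : (smulEnd G M).ker.FiniteIndex) :
    ∃ r : ℕ, 1 ≤ r ∧ ∃ (X₀ X₁ : Type u) (_ : MulAction G X₀) (_ : MulAction G X₁)
      (_ : Finite X₀) (_ : Finite X₁) (j : PermModule X₁ →+[G] (Fin r → M) × PermModule X₀),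
      (∀ g : G, (∀ m : M, g • m = m) → (∀ x : X₀, g • x = x) ∧ ∀ x : X₁, g • x = x) ∧
      Function.Injective j ∧
        (j : PermModule X₁ →+ (Fin r → M) × PermModule X₀).range.FiniteIndex := by
  let N := (smulEnd G M).ker
  let π : G →* G ⧸ N := QuotientGroup.mk' N
  let _ : DistribMulAction (G ⧸ N) M :=
    DistribMulAction.compHom M (QuotientGroup.lift N (smulEnd G M) fun _ h => h)
  have hπM (g : G) (m : M) : π g • m = g • m := rfl
  obtain ⟨r, hr, X₀, X₁, _, _, _, _, j, hj, hj'⟩ := exists_permModule_isogeny (G := G ⧸ N) (M := M)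
  let _ : MulAction G X₀ := MulAction.compHom X₀ π
  let _ : MulAction G X₁ := MulAction.compHom X₁ π
  refine ⟨r, hr, X₀, X₁, inferInstance, inferInstance, inferInstance, inferInstance,
    { (j : PermModule X₁ →+ (Fin r → M) × PermModule X₀) with
      map_smul' := fun g m => map_smul j (π g) m }, fun g hg => ?_, hj, hj'⟩
  have : π g = 1 := by
    rw [QuotientGroup.mk'_apply, QuotientGroup.eq_one_iff]
    exact LinearMap.ext hg
  refine ⟨fun x => ?_, fun x => ?_⟩
  · change π g • x = x
    rw [this, one_smul]
  · change π g • x = x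
    rw [this, one_smul]

section Topology

variable (K : Type u) [Field K] (A : Type u) [CommRing A] [HopfAlgebra K A]

/-- The subgroup `1 ⋊ Gal(K̄/E)` of `F_Γ`. -/
def fixingFGal (E : IntermediateField K (AlgebraicClosure K)) : Subgroup (FGal K A) :=
  E.fixingSubgroup.map SemidirectProduct.inr

variable {K A} {E : IntermediateField K (AlgebraicClosure K)}

lemma mem_fixingFGal {g : FGal K A} :
    g ∈ fixingFGal K A E ↔ g.left = 1 ∧ g.right ∈ E.fixingSubgroup := by
  constructor
  · rintro ⟨σ, hσ, rfl⟩
    exact ⟨rfl, hσ⟩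
  · rintro ⟨h1, h2⟩
    exact ⟨g.right, h2, by ext <;> simp [h1]⟩

lemma isOpen_of_fixingFGal_le [FiniteDimensional K E] {H : Subgroup (FGal K A)}
    (h : fixingFGal K A E ≤ H) : IsOpen (H : Set (FGal K A)) := by
  rw [isOpen_iff_mem_nhds]
  intro x hx
  have h1 : IsOpen[TopologicalSpace.induced (fun g : FGal K A => g.left) ⊥]
      {g : FGal K A | g.left = x.left} := ⟨{x.left}, trivial, rfl⟩
  have h2 : IsOpen[TopologicalSpace.induced (fun g : FGal K A => g.right) inferInstance]
      {g : FGal K A | x.right⁻¹ * g.right ∈ E.fixingSubgroup} :=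
    ⟨{σ | x.right⁻¹ * σ ∈ E.fixingSubgroup},
      (IntermediateField.fixingSubgroup_isOpen E).preimage (continuous_const_mul _), rfl⟩
  have h3 : IsOpen ({g : FGal K A | g.left = x.left} ∩
      {g : FGal K A | x.right⁻¹ * g.right ∈ E.fixingSubgroup}) :=
    IsOpen.inter (h1.mono inf_le_left) (h2.mono inf_le_right)
  refine Filter.mem_of_superset (h3.mem_nhds ⟨rfl, by simp⟩) fun g hg => ?_
  have hmem : x⁻¹ * g ∈ fixingFGal K A E := by
    rw [mem_fixingFGal]
    refine ⟨?_, hg.2⟩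
    have : g.left = x.left := hg.1
    simp [this]
  have := H.mul_mem hx (h hmem)
  rwa [mul_inv_cancel_left] at this

lemma exists_fixingFGal_le_of_isOpen {H : Subgroup (FGal K A)} (h : IsOpen (H : Set (FGal K A))) :
    ∃ E : IntermediateField K (AlgebraicClosure K), FiniteDimensional K E ∧
      fixingFGal K A E ≤ H := by
  have hn := h.mem_nhds H.one_mem
  have hle : 𝓝 (1 : AbsGal K) ≤ Filter.comap (SemidirectProduct.inr : AbsGal K →* FGal K A)
      (𝓝 1) := by
    rw [← Filter.map_le_iff_le_comap]
    have hc : Continuous (SemidirectProduct.inr : AbsGal K →* FGal K A) := by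
      let _ : TopologicalSpace (Points K A) := ⊥
      refine continuous_inf_rng.2 ⟨continuous_induced_rng.2 ?_, continuous_induced_rng.2 ?_⟩
      · exact continuous_const
      · exact continuous_id
    exact hc.tendsto' _ _ (map_one _)
  obtain ⟨E, hE, hE'⟩ := (krullTopology_mem_nhds_one_iff K _ _).1
    (hle (Filter.preimage_mem_comap hn))
  refine ⟨E, hE, ?_⟩
  rintro _ ⟨σ, hσ, rfl⟩
  exact hE' hσ

instance finite_points [Module.Finite K A] : Finite (Points K A) :=
  Finite.of_injective (WithConv.ofConv : Points K A → _) WithConv.ofConv_injective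

lemma finiteIndex_fixingFGal [Module.Finite K A] [FiniteDimensional K E] :
    (fixingFGal K A E).FiniteIndex := by
  let f : FGal K A → Points K A × (E →ₐ[K] AlgebraicClosure K) :=
    fun g => (g.left, (g.right : AlgebraicClosure K →ₐ[K] _).comp E.val)
  have hf (g h : FGal K A) (hgh : f g = f h) : (g : FGal K A ⧸ fixingFGal K A E) = h := by
    rw [QuotientGroup.eq, mem_fixingFGal]
    have h1 : g.left = h.left := congr_arg Prod.fst hgh
    refine ⟨by simp [h1], fun x => ?_⟩
    have h2 : g.right x = h.right x := congr(($(congr_arg Prod.snd hgh)) x)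
    change g.right.symm (h.right x) = x
    rw [← h2, AlgEquiv.symm_apply_apply]
  have : Finite (FGal K A ⧸ fixingFGal K A E) := by
    refine Finite.of_injective (fun q : FGal K A ⧸ fixingFGal K A E => f q.out) fun p q h => ?_
    have := hf _ _ h
    rwa [QuotientGroup.out_eq', QuotientGroup.out_eq'] at this
  exact Subgroup.finiteIndex_of_finite_quotient

/-- For an action of `F_Γ` with open stabilizers on a finitely generated module, some subgroup
`1 ⋊ Gal(K̄/E)` with `E/K` finite acts trivially. -/
lemma exists_fixingFGal_smul_eq {M : Type w} [AddCommGroup M] [Module.Finite ℤ M]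
    [DistribMulAction (FGal K A) M]
    (hM : ∀ m : M, IsOpen (MulAction.stabilizer (FGal K A) m : Set (FGal K A))) :
    ∃ E : IntermediateField K (AlgebraicClosure K), FiniteDimensional K E ∧
      ∀ g ∈ fixingFGal K A E, ∀ m : M, g • m = m := by
  obtain ⟨s, hs⟩ := Module.Finite.fg_top (R := ℤ) (M := M)
  have hopen : IsOpen ((⨅ m : s, MulAction.stabilizer (FGal K A) (m : M) : Subgroup (FGal K A)) :
      Set (FGal K A)) := by
    rw [Subgroup.coe_iInf]
    exact isOpen_iInter_of_finite fun m => hM _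
  obtain ⟨E, hE, hle⟩ := exists_fixingFGal_le_of_isOpen hopen
  refine ⟨E, hE, fun g hg m => ?_⟩
  have hg' := hle hg
  simp only [Subgroup.mem_iInf] at hg'
  have hm : m ∈ Submodule.span ℤ (s : Set M) := hs ▸ Submodule.mem_top
  induction hm using Submodule.span_induction with
  | mem x hx => exact hg' ⟨x, hx⟩
  | zero => exact smul_zero g
  | add x y _ _ hx hy => rw [smul_add, hx, hy]
  | smul n x _ hx => rw [smul_comm, hx]

/-- A lattice on which `1 ⋊ Gal(K̄/E)` acts trivially is stably isogenous, up to a multiple, to a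
permutation module; this subgroup acts trivially on the permutation modules too. -/
theorem exists_permModule_isogeny_of_fixingFGal [Module.Finite K A] [FiniteDimensional K E]
    {M : Type w} [AddCommGroup M] [Module.Free ℤ M] [Module.Finite ℤ M]
    [DistribMulAction (FGal K A) M] (hM : ∀ g ∈ fixingFGal K A E, ∀ m : M, g • m = m) :
    ∃ r : ℕ, 1 ≤ r ∧ ∃ (X₀ X₁ : Type u) (_ : MulAction (FGal K A) X₀) (_ : MulAction (FGal K A) X₁)
      (_ : Finite X₀) (_ : Finite X₁)
      (j : PermModule X₁ →+[FGal K A] (Fin r → M) × PermModule X₀),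
      (∀ g ∈ fixingFGal K A E, ∀ x : X₀, g • x = x) ∧
      (∀ g ∈ fixingFGal K A E, ∀ x : X₁, g • x = x) ∧
      Function.Injective j ∧
        (j : PermModule X₁ →+ (Fin r → M) × PermModule X₀).range.FiniteIndex := by
  have hle : fixingFGal K A E ≤ (smulEnd (FGal K A) M).ker := fun g hg => LinearMap.ext (hM g hg)
  have := finiteIndex_fixingFGal (K := K) (A := A) (E := E)
  obtain ⟨r, hr, X₀, X₁, _, _, _, _, j, hX, hj, hj'⟩ :=
    exists_permModule_isogeny_of_finiteIndex (Subgroup.finiteIndex_of_le hle)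
  exact ⟨r, hr, X₀, X₁, inferInstance, inferInstance, inferInstance, inferInstance, j,
    fun g hg => (hX g (hM g hg)).1, fun g hg => (hX g (hM g hg)).2, hj, hj'⟩

lemma isInduced_permModule_of_fixingFGal [FiniteDimensional K E] (X : Type v) [Finite X]
    [MulAction (FGal K A) X] (hX : ∀ g ∈ fixingFGal K A E, ∀ x : X, g • x = x) :
    IsInduced (FGal K A) (PermModule X) :=
  isInduced_permModule X fun x => isOpen_of_fixingFGal_le (E := E) fun g hg => hX g hg x

end Topology

/-! ### Galois descent -/

section Descent

variable {K : Type*} [Field K] {E : Type*} [Field E] [Algebra K E]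
variable {V W : Type*} [AddCommGroup V] [Module K V] [AddCommGroup W] [Module K W] [Module E W]
  [IsScalarTower K E W]

lemma isBaseChange_injective {i : V →ₗ[K] W} (hi : IsBaseChange E i) : Function.Injective i := by
  have h : (i : V → W) = hi.equiv ∘ TensorProduct.mk K E V 1 := by
    ext v
    simp [hi.equiv_tmul]
  rw [h]
  exact hi.equiv.injective.comp (Module.Flat.tensorProduct_mk_injective K V E)

/-- If `W` is the base change of `V` to a Galois extension `E`, then a vector of `W` which is
invariant under semilinear maps fixing `V`, one for each element of the Galois group, comes
from `V`. -/
lemma mem_range_of_semilinear_fixed [FiniteDimensional K E] [IsGalois K E] {i : V →ₗ[K] W}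
    (hi : IsBaseChange E i) (ρ : (E ≃ₐ[K] E) → W →+ W)
    (hρ : ∀ σ (e : E) w, ρ σ (e • w) = σ e • ρ σ w)
    (hfix : ∀ σ v, ρ σ (i v) = i v) {w : W} (hw : ∀ σ, ρ σ w = w) : w ∈ LinearMap.range i := by
  let b := Module.Free.chooseBasis K V
  let c := hi.basis b
  have hcb (j) : c j = i (b j) := hi.basis_apply b j
  have hrepr (σ : E ≃ₐ[K] E) (j) : σ (c.repr w j) = c.repr w j := by
    have h1 : ρ σ w = ∑ j ∈ (c.repr w).support, σ (c.repr w j) • c j := by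
      conv_lhs => rw [← c.linearCombination_repr w]
      rw [Finsupp.linearCombination_apply, Finsupp.sum, map_sum]
      refine Finset.sum_congr rfl fun j _ => ?_
      rw [hρ, hcb, hfix]
    rw [hw] at h1
    have h2 := congr(c.repr $h1 j)
    rw [map_sum, Finsupp.finsetSum_apply] at h2
    simp only [map_smul, Module.Basis.repr_self, Finsupp.smul_apply, Finsupp.single_apply,
      smul_eq_mul, mul_ite, mul_one, mul_zero, Finset.sum_ite_eq'] at h2
    by_cases h0 : c.repr w j = 0
    · rw [h0, map_zero]
    · rw [if_pos (Finsupp.mem_support_iff.2 h0)] at h2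
      exact h2.symm
  rw [← c.linearCombination_repr w, Finsupp.linearCombination_apply]
  refine Submodule.sum_mem _ fun j _ => ?_
  obtain ⟨k, hk⟩ := (IsGalois.mem_range_algebraMap_iff_fixed (F := K) (c.repr w j)).2
    (fun σ => hrepr σ j)
  refine ⟨k • b j, ?_⟩
  change i (k • b j) = c.repr w j • c j
  rw [← hk, hcb, algebraMap_smul, map_smul]

/-- **Speiser's lemma**: a vector space with a semilinear action of the group of a finite Galois
extension is the base change of its subspace of invariants. -/
theorem isBaseChange_of_range_eq_fixed [FiniteDimensional K E] [IsGalois K E] {i : V →ₗ[K] W}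
    (hinj : Function.Injective i) (ρ : (E ≃ₐ[K] E) →* AddMonoid.End W)
    (hρ : ∀ σ (e : E) w, ρ σ (e • w) = σ e • ρ σ w)
    (hrange : ∀ w, w ∈ LinearMap.range i ↔ ∀ σ, ρ σ w = w) : IsBaseChange E i := by
  let f : E ⊗[K] V →ₗ[E] W :=
    TensorProduct.AlgebraTensorModule.lift
      ((LinearMap.toSpanSingleton E (V →ₗ[K] W) i))
  have hf (e : E) (v : V) : f (e ⊗ₜ v) = e • i v := rfl
  have hfix (σ) (v : V) : ρ σ (i v) = i v := (hrange _).1 ⟨v, rfl⟩ σ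
  have hsum (w : W) : ∑ σ, ρ σ w ∈ LinearMap.range i := by
    rw [hrange]
    intro τ
    rw [map_sum]
    refine Fintype.sum_equiv (Equiv.mulLeft τ) _ _ fun σ => ?_
    rw [Equiv.coe_mulLeft, map_mul]
    rfl
  refine IsBaseChange.of_equiv (LinearEquiv.ofBijective f ⟨?_, ?_⟩) fun v => ?_
  · -- injectivity follows from the nondegeneracy of the trace form
    rw [injective_iff_map_eq_zero]
    intro x hx
    classical
    let b := Module.finBasis K E
    obtain ⟨v, rfl⟩ : ∃ v : Fin (Module.finrank K E) → V, x = ∑ j, b j ⊗ₜ v j := by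
      obtain ⟨y, rfl⟩ := (TensorProduct.equivFinsuppOfBasisLeft b).symm.surjective x
      exact ⟨y, by
        rw [TensorProduct.equivFinsuppOfBasisLeft_symm_apply, Finsupp.sum_fintype]
        simp⟩
    rw [map_sum] at hx
    simp only [hf] at hx
    have h1 (e : E) : ∑ j, Algebra.trace K E (e * b j) • v j = 0 := by
      apply hinj
      have h2 : ∑ σ : E ≃ₐ[K] E, σ e • ρ σ (∑ j, b j • i (v j)) = 0 := by
        rw [hx]
        simp
      rw [map_zero, ← h2, map_sum]
      simp only [map_sum, Finset.smul_sum, hρ, hfix, smul_smul]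
      rw [Finset.sum_comm]
      refine Finset.sum_congr rfl fun j _ => ?_
      rw [map_smul, ← algebraMap_smul E, trace_eq_sum_automorphisms, Finset.sum_smul]
      simp
    refine Finset.sum_eq_zero fun k _ => ?_
    have h3 := h1 (b.traceDual k)
    have : v k = 0 := by
      rw [← h3, Finset.sum_eq_single k]
      · rw [Module.Basis.trace_traceDual_mul]
        simp
      · intro j _ hj
        rw [Module.Basis.trace_traceDual_mul, if_neg, zero_smul]
        exact hj
      · simp
    rw [this, TensorProduct.tmul_zero]
  · -- surjectivity follows from the linear independence of the elements of the Galois group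
    intro w
    change w ∈ LinearMap.range f
    rw [← Submodule.Quotient.mk_eq_zero]
    have hmem (e : E) : ∑ σ : E ≃ₐ[K] E, σ e • ρ σ w ∈ LinearMap.range f := by
      obtain ⟨v, hv⟩ := hsum (e • w)
      refine ⟨1 ⊗ₜ v, ?_⟩
      rw [hf, one_smul, hv]
      simp only [hρ]
    have hzero (ℓ : Module.Dual E (W ⧸ LinearMap.range f)) :
        ℓ (Submodule.Quotient.mk (ρ 1 w)) = 0 := by
      have hlin := linearIndependent_monoidHom E E
      have hli := hlin.comp (fun σ : E ≃ₐ[K] E => (σ : E →* E)) (fun σ τ h =>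
        AlgEquiv.ext fun e => congr($h e))
      rw [Fintype.linearIndependent_iff] at hli
      refine hli (fun σ => ℓ (Submodule.Quotient.mk (ρ σ w))) (funext fun e => ?_) 1
      have h2 := (Submodule.Quotient.mk_eq_zero _).2 (hmem e)
      have h3 := congr(ℓ $h2)
      rw [map_zero, ← Submodule.mkQ_apply, map_sum, map_sum] at h3
      rw [Finset.sum_apply, Pi.zero_apply, ← h3]
      refine Finset.sum_congr rfl fun σ _ => ?_
      rw [map_smul, map_smul]
      exact mul_comm _ _
    rw [map_one] at hzero
    exact (Module.forall_dual_apply_eq_zero_iff E _).1 hzero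
  · exact (hf 1 v).trans (one_smul _ _)

end Descent

section Tensor

variable {K : Type*} [Field K] {E : Type*} [Field E] [Algebra K E]
variable {B B' C C' : Type*} [CommRing B] [Algebra K B] [CommRing B'] [Algebra K B']
  [CommRing C] [Algebra K C] [Algebra E C] [IsScalarTower K E C]
  [CommRing C'] [Algebra K C'] [Algebra E C'] [IsScalarTower K E C']

/-- The map `B ⊗_K B' → C ⊗_E C'` induced by `B → C` and `B' → C'`. -/
def tensorMap (E : Type*) [Field E] [Algebra K E] [Algebra E C] [IsScalarTower K E C]
    [Algebra E C'] [IsScalarTower K E C'] (i : B →ₐ[K] C) (j : B' →ₐ[K] C') :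
    B ⊗[K] B' →ₐ[K] C ⊗[E] C' :=
  Algebra.TensorProduct.lift
    ((Algebra.TensorProduct.includeLeft : C →ₐ[K] C ⊗[E] C').comp i)
    (((Algebra.TensorProduct.includeRight : C' →ₐ[E] C ⊗[E] C').restrictScalars K).comp j)
    (fun _ _ => Commute.all _ _)

@[simp]
lemma tensorMap_tmul (i : B →ₐ[K] C) (j : B' →ₐ[K] C') (b : B) (b' : B') :
    tensorMap E i j (b ⊗ₜ b') = i b ⊗ₜ j b' := by
  simp [tensorMap]

lemma isBaseChange_tensorMap {i : B →ₐ[K] C} {j : B' →ₐ[K] C'}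
    (hi : IsBaseChange E i.toLinearMap) (hj : IsBaseChange E j.toLinearMap) :
    IsBaseChange E (tensorMap E i j).toLinearMap := by
  refine IsBaseChange.of_equiv ((TensorProduct.AlgebraTensorModule.distribBaseChange K E B B').trans
    (TensorProduct.congr hi.equiv hj.equiv)) fun x => ?_
  induction x with
  | zero => simp
  | tmul b b' => simp [IsBaseChange.equiv_tmul]
  | add x y hx hy => simp only [TensorProduct.tmul_add, map_add, hx, hy]

end Tensor

/-! ### Descent of Hopf algebras -/

section Lift

variable {K B C D : Type*} [CommSemiring K] [Semiring B] [Algebra K B] [Semiring C] [Algebra K C]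
  [Semiring D] [Algebra K D]

/-- The factorization of `ψ` through the injective map `i`. -/
def liftThrough (i : B →ₐ[K] C) (hi : Function.Injective i) (ψ : D →ₐ[K] C)
    (h : ∀ x, ψ x ∈ i.range) : D →ₐ[K] B :=
  (AlgEquiv.ofInjective i hi).symm.toAlgHom.comp (ψ.codRestrict i.range h)

@[simp]
lemma apply_liftThrough (i : B →ₐ[K] C) (hi : Function.Injective i) (ψ : D →ₐ[K] C)
    (h : ∀ x, ψ x ∈ i.range) (x : D) : i (liftThrough i hi ψ h x) = ψ x :=
  congr_arg Subtype.val
    ((AlgEquiv.ofInjective i hi).apply_symm_apply (ψ.codRestrict i.range h x))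

end Lift

section TensorMapComp

variable {K : Type*} [Field K] {E : Type*} [Field E] [Algebra K E]
variable {B B' B₁ B₁' C C' C₁ C₁' : Type*} [CommRing B] [Algebra K B] [CommRing B'] [Algebra K B']
  [CommRing C] [Algebra K C] [Algebra E C] [IsScalarTower K E C]
  [CommRing C'] [Algebra K C'] [Algebra E C'] [IsScalarTower K E C']
  [CommRing B₁] [Algebra K B₁] [CommRing B₁'] [Algebra K B₁']
  [CommRing C₁] [Algebra K C₁] [Algebra E C₁] [IsScalarTower K E C₁]
  [CommRing C₁'] [Algebra K C₁'] [Algebra E C₁'] [IsScalarTower K E C₁']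

lemma tensorMap_map (i : B →ₐ[K] C) (j : B' →ₐ[K] C') (i₁ : B₁ →ₐ[K] C₁) (j₁ : B₁' →ₐ[K] C₁')
    (p : B →ₐ[K] B₁) (q : B' →ₐ[K] B₁') (P : C →ₐ[E] C₁) (Q : C' →ₐ[E] C₁')
    (hp : ∀ b, i₁ (p b) = P (i b)) (hq : ∀ b, j₁ (q b) = Q (j b)) (z : B ⊗[K] B') :
    tensorMap E i₁ j₁ (Algebra.TensorProduct.map p q z) =
      Algebra.TensorProduct.map P Q (tensorMap E i j z) := by
  induction z with
  | zero => simp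
  | tmul b b' => simp [hp, hq]
  | add x y hx hy => simp only [map_add, hx, hy]

end TensorMapComp

section HopfForm

lemma isBaseChange_ofId (K E : Type*) [Field K] [Field E] [Algebra K E] :
    IsBaseChange E (Algebra.ofId K E).toLinearMap :=
  IsBaseChange.linearMap K E

variable {K : Type*} [Field K] {E : Type*} [Field E] [Algebra K E]
  {B : Type*} [CommRing B] [Algebra K B]
  {H : Type*} [CommRing H] [Algebra K H]

/-- `i` presents the `K`-algebra `B` as a form of the Hopf algebra `H` over the extension `E`,
stable under the Hopf algebra operations of `H`. -/
structure IsHopfForm (E : Type*) [Field E] [Algebra K E] [HopfAlgebra E H] [IsScalarTower K E H]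
    (i : B →ₐ[K] H) : Prop where
  isBaseChange : IsBaseChange E i.toLinearMap
  comul_mem : ∀ b, Coalgebra.comul (R := E) (i b) ∈ (tensorMap E i i).range
  counit_mem : ∀ b, Coalgebra.counit (R := E) (i b) ∈ (Algebra.ofId K E).range
  antipode_mem : ∀ b, HopfAlgebra.antipodeAlgHom E H (i b) ∈ i.range

namespace IsHopfForm

variable [HopfAlgebra E H] [IsScalarTower K E H] {i : B →ₐ[K] H} (h : IsHopfForm E i)

lemma injective (h : IsHopfForm E i) : Function.Injective i := isBaseChange_injective h.isBaseChange

lemma injective₂ (h : IsHopfForm E i) : Function.Injective (tensorMap E i i) :=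
  isBaseChange_injective (isBaseChange_tensorMap h.isBaseChange h.isBaseChange)

lemma injective₃ (h : IsHopfForm E i) : Function.Injective (tensorMap E i (tensorMap E i i)) :=
  isBaseChange_injective (isBaseChange_tensorMap h.isBaseChange
    (isBaseChange_tensorMap h.isBaseChange h.isBaseChange))

/-- The comultiplication of a Hopf form. -/
def comul : B →ₐ[K] B ⊗[K] B :=
  liftThrough _ h.injective₂ (((Bialgebra.comulAlgHom E H).restrictScalars K).comp i) h.comul_mem

/-- The counit of a Hopf form. -/
def counit : B →ₐ[K] K :=
  liftThrough (Algebra.ofId K E) (algebraMap K E).injective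
    (((Bialgebra.counitAlgHom E H).restrictScalars K).comp i) h.counit_mem

/-- The antipode of a Hopf form. -/
def antipode : B →ₐ[K] B :=
  liftThrough i h.injective (((HopfAlgebra.antipodeAlgHom E H).restrictScalars K).comp i)
    h.antipode_mem

lemma tensorMap_comul (b : B) :
    tensorMap E i i (h.comul b) = Bialgebra.comulAlgHom E H (i b) :=
  apply_liftThrough _ _ _ h.comul_mem b

lemma algebraMap_counit (b : B) :
    Algebra.ofId K E (h.counit b) = Bialgebra.counitAlgHom E H (i b) :=
  apply_liftThrough _ _ _ h.counit_mem b

lemma apply_antipode (b : B) : i (h.antipode b) = HopfAlgebra.antipodeAlgHom E H (i b) :=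
  apply_liftThrough _ _ _ h.antipode_mem b

/-- The bialgebra structure of a Hopf form. -/
abbrev bialgebra : Bialgebra K B :=
  Bialgebra.ofAlgHom h.comul h.counit
    (by
      ext b
      apply h.injective₃
      have hassoc (z : (B ⊗[K] B) ⊗[K] B) : tensorMap E i (tensorMap E i i)
          (Algebra.TensorProduct.assoc K K K B B B z) =
          Algebra.TensorProduct.assoc E E E H H H (tensorMap E (tensorMap E i i) i z) := by
        have : ((tensorMap E i (tensorMap E i i)).comp
            (Algebra.TensorProduct.assoc K K K B B B).toAlgHom) =
            ((Algebra.TensorProduct.assoc E E E H H H).toAlgHom.restrictScalars K).comp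
              (tensorMap E (tensorMap E i i) i) := by
          ext b <;> simp [Algebra.TensorProduct.one_def]
        exact congr($this z)
      change tensorMap E i (tensorMap E i i) (Algebra.TensorProduct.assoc K K K B B B
        (Algebra.TensorProduct.map h.comul (AlgHom.id K B) (h.comul b))) =
        tensorMap E i (tensorMap E i i)
          (Algebra.TensorProduct.map (AlgHom.id K B) h.comul (h.comul b))
      rw [hassoc, tensorMap_map i i (tensorMap E i i) i h.comul (AlgHom.id K B)
        (Bialgebra.comulAlgHom E H) (AlgHom.id E H) h.tensorMap_comul (fun _ => rfl),
        tensorMap_map i i i (tensorMap E i i) (AlgHom.id K B) h.comul (AlgHom.id E H)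
        (Bialgebra.comulAlgHom E H) (fun _ => rfl) h.tensorMap_comul, h.tensorMap_comul]
      exact Coalgebra.coassoc_apply (R := E) (i b))
    (by
      ext b
      apply isBaseChange_injective (isBaseChange_tensorMap (isBaseChange_ofId K E) h.isBaseChange)
      change tensorMap E (Algebra.ofId K E) i
        (Algebra.TensorProduct.map h.counit (AlgHom.id K B) (h.comul b)) =
        tensorMap E (Algebra.ofId K E) i ((1 : K) ⊗ₜ b)
      rw [tensorMap_map i i (Algebra.ofId K E) i h.counit (AlgHom.id K B)
        (Bialgebra.counitAlgHom E H) (AlgHom.id E H) h.algebraMap_counit (fun _ => rfl),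
        h.tensorMap_comul, tensorMap_tmul, map_one]
      exact Coalgebra.rTensor_counit_comul (R := E) (i b))
    (by
      ext b
      apply isBaseChange_injective (isBaseChange_tensorMap h.isBaseChange (isBaseChange_ofId K E))
      change tensorMap E i (Algebra.ofId K E)
        (Algebra.TensorProduct.map (AlgHom.id K B) h.counit (h.comul b)) =
        tensorMap E i (Algebra.ofId K E) (b ⊗ₜ (1 : K))
      rw [tensorMap_map i i i (Algebra.ofId K E) (AlgHom.id K B) h.counit (AlgHom.id E H)
        (Bialgebra.counitAlgHom E H) (fun _ => rfl) h.algebraMap_counit,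
        h.tensorMap_comul, tensorMap_tmul, map_one]
      exact Coalgebra.lTensor_counit_comul (R := E) (i b))

/-- The Hopf algebra structure of a Hopf form. -/
abbrev hopfAlgebra : HopfAlgebra K B :=
  letI := h.bialgebra
  HopfAlgebra.ofAlgHom h.antipode
    (by
      ext b
      apply h.injective
      have hlift (z : B ⊗[K] B) : i (Algebra.TensorProduct.lift h.antipode (AlgHom.id K B)
          (fun _ _ => .all _ _) z) = Algebra.TensorProduct.lift (HopfAlgebra.antipodeAlgHom E H)
            (AlgHom.id E H) (fun _ _ => .all _ _) (tensorMap E i i z) := by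
        induction z with
        | zero => simp
        | tmul b c => simp [h.apply_antipode]
        | add x y hx hy => simp only [map_add, hx, hy]
      refine (hlift (h.comul b)).trans ?_
      rw [h.tensorMap_comul, ← Algebra.TensorProduct.lmul'_comp_map]
      refine (HopfAlgebra.mul_antipode_rTensor_comul_apply (R := E) (i b)).trans ?_
      refine (congr_arg (algebraMap E H) (h.algebraMap_counit b)).symm.trans ?_
      rw [Algebra.ofId_apply, ← IsScalarTower.algebraMap_apply]
      exact (i.commutes _).symm)
    (by
      ext b
      apply h.injective
      have hlift (z : B ⊗[K] B) : i (Algebra.TensorProduct.lift (AlgHom.id K B) h.antipode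
          (fun _ _ => .all _ _) z) = Algebra.TensorProduct.lift (AlgHom.id E H)
            (HopfAlgebra.antipodeAlgHom E H) (fun _ _ => .all _ _) (tensorMap E i i z) := by
        induction z with
        | zero => simp
        | tmul b c => simp [h.apply_antipode]
        | add x y hx hy => simp only [map_add, hx, hy]
      refine (hlift (h.comul b)).trans ?_
      rw [h.tensorMap_comul, ← Algebra.TensorProduct.lmul'_comp_map]
      refine (HopfAlgebra.mul_antipode_lTensor_comul_apply (R := E) (i b)).trans ?_
      refine (congr_arg (algebraMap E H) (h.algebraMap_counit b)).symm.trans ?_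
      rw [Algebra.ofId_apply, ← IsScalarTower.algebraMap_apply]
      exact (i.commutes _).symm)

end IsHopfForm

end HopfForm

/-! ### Points over a splitting field -/

section Points

variable {K : Type u} [Field K] {A : Type u} [CommRing A] [HopfAlgebra K A]

/-- The subfield `E` of `K̄` splits the finite group scheme `Spec A`: its geometric points are
defined over `E`, and there are as many of them as the dimension of `A` allows. -/
class SplitsPoints (K : Type u) [Field K] (A : Type u) [CommRing A] [HopfAlgebra K A] (E : Type u)
    [Field E] [Algebra K E] [Algebra E (AlgebraicClosure K)] : Prop where
  exists_point : ∀ f : Points K A, ∃ g : A →ₐ[K] E,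
    ∀ a, algebraMap E (AlgebraicClosure K) (g a) = f.ofConv a
  card_eq : Nat.card (Points K A) = Module.finrank K A

variable (E : Type u) [Field E] [Algebra K E] [Algebra E (AlgebraicClosure K)] [SplitsPoints K A E]

/-- A geometric point of `Spec A`, as a point over the splitting field `E`. -/
def pointOver (f : Points K A) : A →ₐ[K] E :=
  (SplitsPoints.exists_point f).choose

lemma algebraMap_pointOver (f : Points K A) (a : A) :
    algebraMap E (AlgebraicClosure K) (pointOver E f a) = f.ofConv a :=
  (SplitsPoints.exists_point f).choose_spec a

lemma pointOver_injective : Function.Injective (pointOver E : Points K A → A →ₐ[K] E) := by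
  intro f g h
  apply WithConv.ofConv_injective
  ext a
  rw [← algebraMap_pointOver E, h, algebraMap_pointOver]

/-- Evaluation at all geometric points. -/
def evalPoints : A →ₐ[K] (Points K A → E) := AlgHom.pi (pointOver E)

/-- Over `E`, the finite group `F` is constant. -/
lemma isBaseChange_evalPoints [Module.Finite K A] :
    IsBaseChange E (evalPoints E : A →ₐ[K] Points K A → E).toLinearMap := by
  have := Fintype.ofFinite (Points K A)
  let f : E ⊗[K] A →ₗ[E] (Points K A → E) :=
    TensorProduct.AlgebraTensorModule.lift
      (LinearMap.toSpanSingleton E (A →ₗ[K] (Points K A → E)) (evalPoints E).toLinearMap)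
  have hf (e : E) (a : A) : f (e ⊗ₜ a) = e • evalPoints E a := rfl
  have hsurj : LinearMap.range f = ⊤ := by
    by_contra hne
    obtain ⟨ℓ, hℓ, hle⟩ := Submodule.exists_le_ker_of_lt_top _ (lt_top_iff_ne_top.2 hne)
    refine hℓ ?_
    classical
    have hli := (linearIndependent_toLinearMap K A E).comp (pointOver E) (pointOver_injective E)
    rw [Fintype.linearIndependent_iff] at hli
    have hcoef := hli (fun g => ℓ (Pi.single g 1)) (by
      ext a
      have h0 : ℓ (evalPoints E a) = 0 := hle ⟨1 ⊗ₜ a, by rw [hf, one_smul]⟩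
      have h1 : evalPoints E a = ∑ g, pointOver E g a • (Pi.single g 1 : Points K A → E) := by
        ext g
        simp [evalPoints, Finset.sum_apply, Pi.single_apply]
      rw [h1, map_sum] at h0
      simp only [map_smul, smul_eq_mul] at h0
      simpa [mul_comm] using h0)
    refine LinearMap.pi_ext' fun g => LinearMap.ext_ring ?_
    simpa using hcoef g
  have hdim : Module.finrank E (E ⊗[K] A) = Module.finrank E (Points K A → E) := by
    rw [Module.finrank_baseChange, Module.finrank_pi, ← Nat.card_eq_fintype_card,
      SplitsPoints.card_eq E]
  have hinj : Function.Injective f :=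
    (LinearMap.injective_iff_surjective_of_finrank_eq_finrank hdim).2
      (LinearMap.range_eq_top.1 hsurj)
  exact IsBaseChange.of_equiv (LinearEquiv.ofBijective f ⟨hinj, LinearMap.range_eq_top.1 hsurj⟩)
    fun a => by
      change f (1 ⊗ₜ a) = _
      rw [hf, one_smul]
      rfl

section EvalAt

variable {E' : Type*} [Field E'] [Algebra K E'] {B C : Type*} [CommRing B] [Algebra K B]
  [CommRing C] [Algebra K C] [Algebra E' C] [IsScalarTower K E' C]

/-- The map `a ⊗ b ↦ f(a) i(b)`, i.e. evaluation of the first factor at a point `f`. -/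
def evalAt (f : A →ₐ[K] E') (i : B →ₐ[K] C) : A ⊗[K] B →ₐ[K] C :=
  Algebra.TensorProduct.lift (((Algebra.ofId E' C).restrictScalars K).comp f) i
    (fun _ _ => Commute.all _ _)

@[simp]
lemma evalAt_tmul (f : A →ₐ[K] E') (i : B →ₐ[K] C) (a : A) (b : B) :
    evalAt f i (a ⊗ₜ b) = f a • i b := by
  simp [evalAt, Algebra.ofId_apply, Algebra.smul_def]

lemma evalAt_map {B₁ C₁ : Type*} [CommRing B₁] [Algebra K B₁] [CommRing C₁]
    [Algebra K C₁] [Algebra E' C₁] [IsScalarTower K E' C₁] (f : A →ₐ[K] E') (i : B →ₐ[K] C)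
    (i₁ : B₁ →ₐ[K] C₁) (p : B →ₐ[K] B₁) (P : C →ₐ[E'] C₁) (h : ∀ b, i₁ (p b) = P (i b))
    (z : A ⊗[K] B) :
    evalAt f i₁ (Algebra.TensorProduct.map (AlgHom.id K A) p z) = P (evalAt f i z) := by
  induction z with
  | zero => simp
  | tmul a b => simp [h]
  | add x y hx hy => simp only [map_add, hx, hy]

end EvalAt

variable {B C : Type*} [CommRing B] [Algebra K B] [CommRing C]
  [Algebra K C] [Algebra E C] [IsScalarTower K E C]

/-- Evaluation of the first factor of `A ⊗ B` at all geometric points. -/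
def evalAll (i : B →ₐ[K] C) : A ⊗[K] B →ₐ[K] (Points K A → C) :=
  AlgHom.pi fun f => evalAt (pointOver E f) i

/-- Over `E`, where `F` is constant, `A ⊗ B` becomes the algebra of functions on `F(K̄)` with values
in `E ⊗ B`. -/
lemma isBaseChange_evalAll [Module.Finite K A] {i : B →ₐ[K] C} (hi : IsBaseChange E i.toLinearMap) :
    IsBaseChange E (evalAll E i : A ⊗[K] B →ₐ[K] Points K A → C).toLinearMap := by
  classical
  have := Fintype.ofFinite (Points K A)
  have h := isBaseChange_tensorMap (isBaseChange_evalPoints (K := K) (A := A) E) hi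
  let e : (Points K A → E) ⊗[E] C ≃ₗ[E] (Points K A → C) :=
    (TensorProduct.comm E _ _).trans (TensorProduct.piScalarRight E E C (Points K A))
  refine IsBaseChange.of_equiv (h.equiv.trans e) fun z => ?_
  rw [LinearEquiv.trans_apply, IsBaseChange.equiv_tmul, one_smul]
  induction z with
  | zero => simp
  | tmul a b =>
    ext f
    simp [e, evalAll, evalPoints]
  | add x y hx hy => simp only [map_add, hx, hy]

/-- An element of `A ⊗ B` is determined by its evaluations at the geometric points of `F`. -/
lemma evalAll_injective [Module.Finite K A] {i : B →ₐ[K] C} (hi : IsBaseChange E i.toLinearMap)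
    {y z : A ⊗[K] B}
    (h : ∀ f : Points K A, evalAt (pointOver E f) i y = evalAt (pointOver E f) i z) :
    y = z := by
  have hinj : Function.Injective (evalAll E i : A ⊗[K] B →ₐ[K] Points K A → C).toLinearMap :=
    isBaseChange_injective (E := E) (isBaseChange_evalAll (A := A) E hi)
  exact hinj (funext h)

lemma evalAt_evalAll (f : A →ₐ[K] E) (i : B →ₐ[K] C) (z : A ⊗[K] (A ⊗[K] B)) (g : Points K A) :
    evalAt f (evalAll E i) z g = evalAt f (evalAt (pointOver E g) i) z := by
  induction z with
  | zero => simp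
  | tmul a y => simp [evalAll]
  | add x y hx hy => simp only [map_add, Pi.add_apply, hx, hy]

end Points

/-! ### Constructing an action by evaluation at points -/

section OfForm

lemma evalAt_diagCoaction {K A : Type u} {E B C : Type*} [Field K] [CommRing A] [HopfAlgebra K A]
    [Field E] [Algebra K E] [CommRing B] [Algebra K B] [CommRing C]
    [Algebra K C] [Algebra E C] [IsScalarTower K E C] (i : B →ₐ[K] C) (ρ : B →ₐ[K] A ⊗[K] B)
    (f : A →ₐ[K] E) (P : C →ₐ[E] C) (h : ∀ b, evalAt f i (ρ b) = P (i b)) (z : B ⊗[K] B) :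
    evalAt f (tensorMap E i i) (diagCoaction ρ ρ z) =
      Algebra.TensorProduct.map P P (tensorMap E i i z) := by
  have hl (y : A ⊗[K] B) : evalAt f (tensorMap E i i) (Algebra.TensorProduct.map (AlgHom.id K A)
      Algebra.TensorProduct.includeLeft y) = evalAt f i y ⊗ₜ 1 :=
    evalAt_map f i (tensorMap E i i) _ (Algebra.TensorProduct.includeLeft : C →ₐ[E] C ⊗[E] C)
      (fun b => by simp) y
  have hr (y : A ⊗[K] B) : evalAt f (tensorMap E i i) (Algebra.TensorProduct.map (AlgHom.id K A)
      Algebra.TensorProduct.includeRight y) = 1 ⊗ₜ evalAt f i y :=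
    evalAt_map f i (tensorMap E i i) _ (Algebra.TensorProduct.includeRight : C →ₐ[E] C ⊗[E] C)
      (fun b => by simp) y
  induction z with
  | zero => simp
  | tmul b c => simp [diagCoaction, hl, hr, h]
  | add x y hx hy => simp only [map_add, hx, hy]

variable {K : Type u} [Field K] {A : Type u} [CommRing A] [HopfAlgebra K A]
  (E : Type u) [Field E] [Algebra K E] [Algebra E (AlgebraicClosure K)]
  [SplitsPoints K A E]

/-- Through evaluation at points, the counit of `A` corresponds to the neutral element of `F`. -/
lemma evalAt_one [IsScalarTower K E (AlgebraicClosure K)] {B C : Type*} [CommRing B]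
    [Algebra K B] [CommRing C] [Algebra K C] [Algebra E C] [IsScalarTower K E C] (i : B →ₐ[K] C)
    (z : A ⊗[K] B) :
    i (Algebra.TensorProduct.lid K B
      (Algebra.TensorProduct.map (Bialgebra.counitAlgHom K A) (AlgHom.id K B) z)) =
    evalAt (pointOver E 1) i z := by
  induction z with
  | zero => simp
  | tmul a b =>
    have h : pointOver E (1 : Points K A) a = algebraMap K E (Coalgebra.counit a) := by
      apply (algebraMap E (AlgebraicClosure K)).injective
      rw [algebraMap_pointOver, ← IsScalarTower.algebraMap_apply]
      simp [AlgHom.convOne_def, Algebra.ofId_apply]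
    simp [h]
  | add x y hx hy => simp only [map_add, hx, hy]

/-- Through evaluation at points, the comultiplication of `A` corresponds to the multiplication
of `F`. -/
lemma evalAt_mul {B C : Type*} [CommRing B] [Algebra K B] [CommRing C]
    [Algebra K C] [Algebra E C] [IsScalarTower K E C] (i : B →ₐ[K] C) (f g : Points K A)
    (z : A ⊗[K] B) :
    evalAt (pointOver E f) (evalAt (pointOver E g) i) (Algebra.TensorProduct.assoc K K K A A B
      (Algebra.TensorProduct.map (Bialgebra.comulAlgHom K A) (AlgHom.id K B) z)) =
    evalAt (pointOver E (f * g)) i z := by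
  induction z with
  | zero => simp
  | tmul a b =>
    have h1 (y : A ⊗[K] A) : evalAt (pointOver E f) (evalAt (pointOver E g) i)
        (Algebra.TensorProduct.assoc K K K A A B (y ⊗ₜ b)) =
        Algebra.TensorProduct.lift (pointOver E f) (pointOver E g)
          (fun _ _ => .all _ _) y • i b := by
      induction y with
      | zero => simp
      | tmul c d => simp [mul_smul]
      | add x y hx hy => simp only [TensorProduct.add_tmul, map_add, hx, hy, add_smul]
    have h2 : pointOver E (f * g) a = Algebra.TensorProduct.lift (pointOver E f) (pointOver E g)
        (fun _ _ => .all _ _) (Coalgebra.comul (R := K) a) := by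
      apply (algebraMap E (AlgebraicClosure K)).injective
      rw [algebraMap_pointOver]
      have h3 (y : A ⊗[K] A) : algebraMap E (AlgebraicClosure K)
          (Algebra.TensorProduct.lift (pointOver E f) (pointOver E g) (fun _ _ => .all _ _) y) =
          Algebra.TensorProduct.lmul' K (Algebra.TensorProduct.map f.ofConv g.ofConv y) := by
        induction y with
        | zero => simp
        | tmul c d => simp [algebraMap_pointOver]
        | add x y hx hy => simp only [map_add, hx, hy]
      rw [h3]
      simp [AlgHom.convMul_def]
    rw [Algebra.TensorProduct.map_tmul, AlgHom.id_apply, Bialgebra.comulAlgHom_apply, h1, ← h2,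
      evalAt_tmul]
  | add x y hx hy => simp only [map_add, hx, hy]

/-- The action of `Spec A` on a form `B` of a bialgebra `C` over `E`, obtained from an action of the
group of points on `C` which is compatible with `ρ`. -/
def FGroup.ofForm [Module.Finite K A] [IsScalarTower K E (AlgebraicClosure K)]
    {B : Type u} [CommRing B] [HopfAlgebra K B] {C : Type*} [CommRing C]
    [Bialgebra E C] [Algebra K C] [IsScalarTower K E C] (i : B →ₐ[K] C)
    (hi : IsBaseChange E i.toLinearMap)
    (hcomul : ∀ b, tensorMap E i i (Coalgebra.comul (R := K) b) = Coalgebra.comul (R := E) (i b))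
    (P : Points K A → C →ₐ[E] C) (P_one : P 1 = AlgHom.id E C)
    (P_mul : ∀ f g, P (f * g) = (P g).comp (P f))
    (P_comul : ∀ f x, Coalgebra.comul (R := E) (P f x) =
      Algebra.TensorProduct.map (P f) (P f) (Coalgebra.comul (R := E) x))
    (ρ : B →ₐ[K] A ⊗[K] B) (hρ : ∀ f b, evalAt (pointOver E f) i (ρ b) = P f (i b)) :
    FGroup K A where
  Fun := B
  coaction := ρ
  one_act := by
    ext b
    apply isBaseChange_injective hi
    refine (evalAt_one E i (ρ b)).trans ?_
    rw [hρ, P_one]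
    rfl
  mul_act := by
    ext b
    refine evalAll_injective E (i := evalAll E i) (isBaseChange_evalAll E hi) fun f => ?_
    ext g
    rw [evalAt_evalAll, evalAt_evalAll]
    refine (evalAt_mul E i f g (ρ b)).trans ?_
    have h1 := evalAt_map (pointOver E f) i (evalAt (pointOver E g) i) ρ (P g) (hρ g) (ρ b)
    refine Eq.trans ?_ h1.symm
    rw [hρ, hρ, P_mul]
    rfl
  act_mul := by
    ext b
    refine evalAll_injective E (i := tensorMap E i i) (isBaseChange_tensorMap hi hi) fun f => ?_
    have h1 := evalAt_map (pointOver E f) i (tensorMap E i i) (Bialgebra.comulAlgHom K B)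
      (Bialgebra.comulAlgHom E C) hcomul (ρ b)
    refine h1.trans ?_
    rw [hρ]
    refine Eq.trans ?_ (evalAt_diagCoaction i ρ (pointOver E f) (P f) (hρ f) _).symm
    refine (P_comul f (i b)).trans ?_
    exact congr_arg _ (hcomul b).symm

end OfForm

/-! ### Twisted actions on group algebras -/

section Twist

variable {K : Type u} [Field K] {A : Type u} [CommRing A] [HopfAlgebra K A]
  (E : Type u) [Field E] (M : Type*) [AddCommGroup M] [DistribMulAction (FGal K A) M]

/-- The action of `f ∈ F(K̄)` on the functions on the diagonalizable group with character group
`M`. -/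
def pointTwist (f : Points K A) : AddMonoidAlgebra E M →ₐ[E] AddMonoidAlgebra E M :=
  (AddMonoidAlgebra.mapDomainBialgHom E
    (DistribSMul.toAddMonoidHom M (SemidirectProduct.inl f⁻¹ : FGal K A)) :
      AddMonoidAlgebra E M →ₐ[E] AddMonoidAlgebra E M)

variable {M} in
@[simp]
lemma pointTwist_single (f : Points K A) (m : M) (c : E) :
    pointTwist E M f (.single m c) = .single ((SemidirectProduct.inl f⁻¹ : FGal K A) • m) c := by
  simp [pointTwist]

lemma pointTwist_one : pointTwist E M (1 : Points K A) = AlgHom.id E _ := by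
  ext m
  simp

lemma pointTwist_mul (f g : Points K A) :
    pointTwist E M (f * g) = (pointTwist E M g).comp (pointTwist E M f) := by
  ext m
  simp [mul_smul]

lemma comul_pointTwist (f : Points K A) (x : AddMonoidAlgebra E M) :
    Coalgebra.comul (R := E) (pointTwist E M f x) =
      Algebra.TensorProduct.map (pointTwist E M f) (pointTwist E M f)
        (Coalgebra.comul (R := E) x) := by
  induction x using AddMonoidAlgebra.induction_linear with
  | zero => simp
  | add x y hx hy => simp only [map_add, hx, hy]
  | single m c => simp

variable [Algebra K E] [Algebra E (AlgebraicClosure K)]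
  [IsScalarTower K E (AlgebraicClosure K)] [Normal K E]

/-- The semilinear action of `Γ` on the functions, over a normal extension `E` of `K`, on the
diagonalizable group with character group `M`: it acts simultaneously on coefficients and on
characters. -/
def galTwist (σ : AbsGal K) : AddMonoidAlgebra E M →ₐ[K] AddMonoidAlgebra E M where
  __ := (AddMonoidAlgebra.mapRingHom M (AlgEquiv.restrictNormalHom E σ : E →+* E)).comp
    (AddMonoidAlgebra.mapDomainRingHom E
      (DistribSMul.toAddMonoidHom M (SemidirectProduct.inr σ : FGal K A)))
  commutes' k := by
    simp [AddMonoidAlgebra.coe_algebraMap]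

variable {M} in
@[simp]
lemma galTwist_single (σ : AbsGal K) (m : M) (c : E) :
    galTwist (A := A) E M σ (.single m c) =
      .single ((SemidirectProduct.inr σ : FGal K A) • m) (AlgEquiv.restrictNormalHom E σ c) := by
  change AddMonoidAlgebra.mapRingHom M (AlgEquiv.restrictNormalHom E σ : E →+* E)
    (AddMonoidAlgebra.mapDomainRingHom E
      (DistribSMul.toAddMonoidHom M (SemidirectProduct.inr σ : FGal K A)) (.single m c)) = _
  simp

variable {M} in
lemma galTwist_smul (σ : AbsGal K) (c : E) (x : AddMonoidAlgebra E M) :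
    galTwist (A := A) E M σ (c • x) =
      AlgEquiv.restrictNormalHom E σ c • galTwist (A := A) E M σ x := by
  induction x using AddMonoidAlgebra.induction_linear with
  | zero => simp
  | add x y hx hy => simp only [map_add, smul_add, hx, hy]
  | single m d => simp

variable {M} in
lemma galTwist_mul (σ τ : AbsGal K) (x : AddMonoidAlgebra E M) :
    galTwist (A := A) E M (σ * τ) x =
      galTwist (A := A) E M σ (galTwist (A := A) E M τ x) := by
  induction x using AddMonoidAlgebra.induction_linear with
  | zero => simp
  | add x y hx hy => simp only [map_add, hx, hy]
  | single m d => simp [mul_smul]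

variable {M} in
lemma galTwist_pointTwist (σ : AbsGal K) (f : Points K A) (x : AddMonoidAlgebra E M) :
    galTwist (A := A) E M σ (pointTwist E M f x) =
      pointTwist E M (galPoints K A σ f) (galTwist (A := A) E M σ x) := by
  induction x using AddMonoidAlgebra.induction_linear with
  | zero => simp
  | add x y hx hy => simp only [map_add, hx, hy]
  | single m d =>
    simp only [pointTwist_single, galTwist_single, ← mul_smul, ← map_inv,
      SemidirectProduct.inl_aut, mul_assoc]
    simp

/-- The semilinear action of `Γ` on the tensor square of `E[M]`. -/
def galTwist₂ (σ : AbsGal K) : AddMonoidAlgebra E M ⊗[E] AddMonoidAlgebra E M →+*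
    AddMonoidAlgebra E M ⊗[E] AddMonoidAlgebra E M :=
  Algebra.TensorProduct.mapRingHom (AlgEquiv.restrictNormalHom E σ : E →+* E)
    (galTwist (A := A) E M σ : AddMonoidAlgebra E M →+* AddMonoidAlgebra E M)
    (galTwist (A := A) E M σ : AddMonoidAlgebra E M →+* AddMonoidAlgebra E M)
    (by ext e; simp [AddMonoidAlgebra.coe_algebraMap])
    (by ext e; simp [AddMonoidAlgebra.coe_algebraMap])

variable {M} in
@[simp]
lemma galTwist₂_tmul (σ : AbsGal K) (x y : AddMonoidAlgebra E M) :
    galTwist₂ (A := A) E M σ (x ⊗ₜ y) =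
      galTwist (A := A) E M σ x ⊗ₜ galTwist (A := A) E M σ y :=
  Algebra.TensorProduct.mapRingHom_tmul ..

variable {M} in
lemma galTwist₂_smul (σ : AbsGal K) (c : E) (z : AddMonoidAlgebra E M ⊗[E] AddMonoidAlgebra E M) :
    galTwist₂ (A := A) E M σ (c • z) =
      AlgEquiv.restrictNormalHom E σ c • galTwist₂ (A := A) E M σ z := by
  induction z with
  | zero => simp
  | add x y hx hy => simp only [map_add, smul_add, hx, hy]
  | tmul x y =>
    rw [TensorProduct.smul_tmul', galTwist₂_tmul, galTwist_smul, galTwist₂_tmul,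
      TensorProduct.smul_tmul']

variable {M} in
lemma comul_galTwist (σ : AbsGal K) (x : AddMonoidAlgebra E M) :
    Coalgebra.comul (R := E) (galTwist (A := A) E M σ x) =
      galTwist₂ (A := A) E M σ (Coalgebra.comul (R := E) x) := by
  induction x using AddMonoidAlgebra.induction_linear with
  | zero => simp
  | add x y hx hy => simp only [map_add, hx, hy]
  | single m c => simp

variable {M} in
lemma counit_galTwist (σ : AbsGal K) (x : AddMonoidAlgebra E M) :
    Coalgebra.counit (R := E) (galTwist (A := A) E M σ x) =
      AlgEquiv.restrictNormalHom E σ (Coalgebra.counit (R := E) x) := by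
  induction x using AddMonoidAlgebra.induction_linear with
  | zero => simp
  | add x y hx hy => simp only [map_add, hx, hy]
  | single m c => simp

variable {M} in
lemma antipode_galTwist (σ : AbsGal K) (x : AddMonoidAlgebra E M) :
    HopfAlgebra.antipode E (galTwist (A := A) E M σ x) =
      galTwist (A := A) E M σ (HopfAlgebra.antipode E x) := by
  induction x using AddMonoidAlgebra.induction_linear with
  | zero => simp
  | add x y hx hy => simp only [map_add, hx, hy]
  | single m c => simp

/-- The `K`-algebra of functions on the `K`-group with character module `M`: the invariants of `Γ`
in `E[M]`. -/
def fixedFun : Subalgebra K (AddMonoidAlgebra E M) :=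
  ⨅ σ : AbsGal K, AlgHom.equalizer (galTwist (A := A) E M σ) (AlgHom.id K _)

variable {M} in
lemma mem_fixedFun {x : AddMonoidAlgebra E M} :
    x ∈ fixedFun (K := K) (A := A) E M ↔ ∀ σ : AbsGal K, galTwist (A := A) E M σ x = x := by
  simp [fixedFun, Algebra.mem_iInf, AlgHom.mem_equalizer]

end Twist

/-! ### The group of multiplicative type with given character module -/

section Twist

variable {K : Type u} [Field K] {A : Type u} [CommRing A] [HopfAlgebra K A]
  {E : Type u} [Field E] [Algebra K E] [Algebra E (AlgebraicClosure K)]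
  [IsScalarTower K E (AlgebraicClosure K)] [Normal K E]
  {M : Type*} [AddCommGroup M] [DistribMulAction (FGal K A) M]

/-- The subgroup `Gal(K̄/E)` of `F_Γ` acts trivially on `M`; this subgroup is described as the
kernel of the restriction to `E`. -/
def TrivialOver (K : Type u) [Field K] (A : Type u) [CommRing A] [HopfAlgebra K A]
    (E : Type u) [Field E] [Algebra K E] [Algebra E (AlgebraicClosure K)]
    [IsScalarTower K E (AlgebraicClosure K)] [Normal K E]
    (M : Type*) [AddCommGroup M] [DistribMulAction (FGal K A) M] : Prop :=
  ∀ σ : AbsGal K, AlgEquiv.restrictNormalHom E σ = 1 →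
    ∀ m : M, (SemidirectProduct.inr σ : FGal K A) • m = m

lemma TrivialOver.galTwist_eq (hM : TrivialOver K A E M) {σ : AbsGal K}
    (hσ : AlgEquiv.restrictNormalHom E σ = 1) (x : AddMonoidAlgebra E M) :
    galTwist (A := A) E M σ x = x := by
  induction x using AddMonoidAlgebra.induction_linear with
  | zero => simp
  | add x y hx hy => simp only [map_add, hx, hy]
  | single m c => simp [hM σ hσ, hσ]

lemma restrictNormalHom_surjective :
    Function.Surjective (AlgEquiv.restrictNormalHom E : AbsGal K →* (E ≃ₐ[K] E)) :=
  AlgEquiv.restrictNormalHom_surjective (AlgebraicClosure K)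

lemma TrivialOver.galTwist_congr (hM : TrivialOver K A E M) {σ τ : AbsGal K}
    (h : AlgEquiv.restrictNormalHom E σ = AlgEquiv.restrictNormalHom E τ)
    (x : AddMonoidAlgebra E M) : galTwist (A := A) E M σ x = galTwist (A := A) E M τ x := by
  have h1 : galTwist (A := A) E M σ x =
      galTwist (A := A) E M τ (galTwist (A := A) E M (τ⁻¹ * σ) x) := by
    rw [← galTwist_mul, mul_inv_cancel_left]
  rw [h1]
  congr 1
  exact hM.galTwist_eq (by rw [map_mul, map_inv, h, inv_mul_cancel]) x

/-- A lift to `Γ` of an element of `Gal(E/K)`. -/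
def galLift (s : E ≃ₐ[K] E) : AbsGal K := Function.surjInv restrictNormalHom_surjective s

@[simp]
lemma restrictNormalHom_galLift (s : E ≃ₐ[K] E) : AlgEquiv.restrictNormalHom E (galLift s) = s :=
  Function.surjInv_eq _ s

/-- The semilinear action of `Gal(E/K)` on `E[M]`. -/
def TrivialOver.galAction (hM : TrivialOver K A E M) :
    (E ≃ₐ[K] E) →* AddMonoid.End (AddMonoidAlgebra E M) where
  toFun s := (galTwist (A := A) E M (galLift s)).toRingHom.toAddMonoidHom
  map_one' := AddMonoidHom.ext fun x =>
    hM.galTwist_eq (by rw [restrictNormalHom_galLift]) x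
  map_mul' s t := AddMonoidHom.ext fun x =>
    (hM.galTwist_congr (by simp) x).trans (galTwist_mul E (galLift s) (galLift t) x)

lemma TrivialOver.galAction_apply (hM : TrivialOver K A E M) (s : E ≃ₐ[K] E)
    (x : AddMonoidAlgebra E M) : hM.galAction s x = galTwist (A := A) E M (galLift s) x :=
  rfl

variable [SplitsPoints K A E]

lemma restrictNormalHom_pointOver (σ : AbsGal K) (f : Points K A) (a : A) :
    AlgEquiv.restrictNormalHom E σ (pointOver E f a) = pointOver E (galPoints K A σ f) a := by
  apply (algebraMap E (AlgebraicClosure K)).injective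
  rw [algebraMap_pointOver]
  refine (AlgEquiv.restrictNormal_commutes σ E _).trans ?_
  rw [algebraMap_pointOver]
  rfl

end Twist

section Pi

variable {K : Type u} [Field K] {A : Type u} [CommRing A] [HopfAlgebra K A] [Module.Finite K A]
  {E : Type u} [Field E] [Algebra K E] [Algebra E (AlgebraicClosure K)]
  [IsScalarTower K E (AlgebraicClosure K)] [FiniteDimensional K E] [IsGalois K E]
  [SplitsPoints K A E]
  {B C : Type*} [CommRing B] [Algebra K B] [CommRing C]
  [Algebra K C] [Algebra E C] [IsScalarTower K E C] {i : B →ₐ[K] C}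

/-- A function on `F(K̄)` with values in `E ⊗ B` which is equivariant for `Γ` comes from
`A ⊗ B`. -/
lemma mem_range_evalAll (hi : IsBaseChange E i.toLinearMap) (ρ : (E ≃ₐ[K] E) → C →+ C)
    (hρ : ∀ s (e : E) x, ρ s (e • x) = s e • ρ s x) (hfix : ∀ s b, ρ s (i b) = i b)
    {u : Points K A → C} (hu : ∀ s f, ρ s (u ((galPoints K A (galLift s))⁻¹ f)) = u f) :
    u ∈ (evalAll E i : A ⊗[K] B →ₐ[K] (Points K A → C)).range := by
  have hbc : IsBaseChange E (evalAll E i : A ⊗[K] B →ₐ[K] (Points K A → C)).toLinearMap :=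
    isBaseChange_evalAll (A := A) E hi
  have key := mem_range_of_semilinear_fixed (E := E) hbc
    (fun s => AddMonoidHom.mk' (fun u f => ρ s (u ((galPoints K A (galLift s))⁻¹ f)))
      fun u v => funext fun f => map_add _ _ _)
    (fun s e w => funext fun f => hρ s e _)
    (fun s v => ?_) (fun s => funext fun f => hu s f)
  · exact key
  · ext1 f
    change ρ s (evalAt (pointOver E _) i v) = evalAt (pointOver E _) i v
    induction v with
    | zero => simp
    | add x y hx hy => simp only [map_add, hx, hy]
    | tmul a b =>
      rw [evalAt_tmul, evalAt_tmul, hρ, hfix]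
      nth_rw 1 [← restrictNormalHom_galLift s]
      rw [restrictNormalHom_pointOver, MulAut.apply_inv_self]

end Pi

section Descent

variable {K : Type u} [Field K] {A : Type u} [CommRing A] [HopfAlgebra K A]
  {E : Type u} [Field E] [Algebra K E] [Algebra E (AlgebraicClosure K)]
  [IsScalarTower K E (AlgebraicClosure K)] [IsGalois K E]
  {M : Type*} [AddCommGroup M] [DistribMulAction (FGal K A) M]
  {B : Type*} [CommRing B] [Algebra K B] {i : B →ₐ[K] AddMonoidAlgebra E M}

/-- The injective homomorphism `i` identifies `B` with the invariants of `Γ` in `E[M]`. -/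
structure IsFixedForm (A : Type u) [CommRing A] [HopfAlgebra K A]
    [DistribMulAction (FGal K A) M] (i : B →ₐ[K] AddMonoidAlgebra E M) : Prop where
  injective : Function.Injective i
  mem_range_iff : ∀ x, x ∈ i.range ↔ ∀ σ : AbsGal K, galTwist (A := A) E M σ x = x

namespace IsFixedForm

lemma galTwist_apply (h : IsFixedForm A i) (σ : AbsGal K) (b : B) :
    galTwist (A := A) E M σ (i b) = i b :=
  (h.mem_range_iff _).1 ⟨b, rfl⟩ σ

variable [FiniteDimensional K E]

lemma isBaseChange (h : IsFixedForm A i) (hM : TrivialOver K A E M) :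
    IsBaseChange E i.toLinearMap := by
  refine isBaseChange_of_range_eq_fixed h.injective hM.galAction ?_ ?_
  · intro s c x
    rw [hM.galAction_apply, hM.galAction_apply, galTwist_smul, restrictNormalHom_galLift]
  · intro x
    refine (h.mem_range_iff x).trans ⟨fun hx s => hx _, fun hx σ => ?_⟩
    rw [hM.galTwist_congr (τ := galLift (AlgEquiv.restrictNormalHom E σ)) (by simp)]
    exact hx _

lemma isHopfForm (h : IsFixedForm A i) (hM : TrivialOver K A E M) :
    IsHopfForm E i where
  isBaseChange := h.isBaseChange hM
  comul_mem b := by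
    have hi := h.isBaseChange hM
    refine mem_range_of_semilinear_fixed (isBaseChange_tensorMap hi hi)
      (fun s => (galTwist₂ (A := A) E M (galLift s)).toAddMonoidHom)
      (fun s e w => ?_) (fun s v => ?_) fun s => ?_
    · refine (galTwist₂_smul E _ e w).trans ?_
      rw [restrictNormalHom_galLift]
      rfl
    · change galTwist₂ (A := A) E M _ (tensorMap E i i v) = tensorMap E i i v
      induction v with
      | zero => simp
      | add x y hx hy => simp only [map_add, hx, hy]
      | tmul x y => rw [tensorMap_tmul, galTwist₂_tmul, h.galTwist_apply, h.galTwist_apply]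
    · change galTwist₂ (A := A) E M _ _ = _
      rw [← comul_galTwist, h.galTwist_apply]
  counit_mem b := by
    refine (IsGalois.mem_range_algebraMap_iff_fixed (F := K) _).2 fun s => ?_
    rw [← restrictNormalHom_galLift s, ← counit_galTwist (A := A), h.galTwist_apply]
  antipode_mem b := by
    refine (h.mem_range_iff _).2 fun σ => ?_
    rw [HopfAlgebra.antipodeAlgHom_apply, ← antipode_galTwist, h.galTwist_apply]

end IsFixedForm

/-- The coaction of `F` on the functions of the `K`-group with character module `M`, as functions
on `F(K̄)`. -/
def orbitMap (A : Type u) [CommRing A] [HopfAlgebra K A]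
    [DistribMulAction (FGal K A) M] (i : B →ₐ[K] AddMonoidAlgebra E M) :
    B →ₐ[K] (Points K A → AddMonoidAlgebra E M) :=
  AlgHom.pi fun f : Points K A => ((pointTwist E M f).restrictScalars K).comp i

namespace IsFixedForm

variable [FiniteDimensional K E] [Module.Finite K A] [SplitsPoints K A E]

lemma orbitMap_mem (h : IsFixedForm A i) (hM : TrivialOver K A E M) (b : B) :
    orbitMap A i b ∈ (evalAll E i : A ⊗[K] B →ₐ[K] (Points K A → AddMonoidAlgebra E M)).range := by
  refine mem_range_evalAll (h.isBaseChange hM)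
    (fun s => (galTwist (A := A) E M (galLift s)).toRingHom.toAddMonoidHom)
    (fun s e x => (galTwist_smul E _ e x).trans (by rw [restrictNormalHom_galLift]; rfl))
    (fun s b => h.galTwist_apply _ b) fun s f => ?_
  change galTwist (A := A) E M _ (pointTwist E M ((galPoints K A (galLift s))⁻¹ f) (i b)) =
    pointTwist E M f (i b)
  rw [galTwist_pointTwist, h.galTwist_apply, MulAut.apply_inv_self]

end IsFixedForm

end Descent

/-! ### Forms of bialgebras -/

section BialgForm

variable {K : Type*} [Field K] {E : Type*} [Field E] [Algebra K E]
  {B : Type*} [CommRing B] [Bialgebra K B] {C : Type*} [CommRing C] [Bialgebra E C] [Algebra K C]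
  [IsScalarTower K E C]

/-- The homomorphism `i` induces an isomorphism of bialgebras from `E ⊗ B` to `C`. -/
structure IsBialgForm (E : Type*) [Field E] [Algebra K E] [Bialgebra E C] [IsScalarTower K E C]
    (i : B →ₐ[K] C) : Prop where
  isBaseChange : IsBaseChange E i.toLinearMap
  tensorMap_comul : ∀ b, tensorMap E i i (Coalgebra.comul (R := K) b) =
    Coalgebra.comul (R := E) (i b)
  algebraMap_counit : ∀ b, algebraMap K E (Coalgebra.counit (R := K) b) =
    Coalgebra.counit (R := E) (i b)

namespace IsBialgForm

variable {i : B →ₐ[K] C}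

lemma injective (h : IsBialgForm E i) : Function.Injective i :=
  isBaseChange_injective h.isBaseChange

/-- The isomorphism `E ⊗ B ≃ C` of algebras induced by a form. -/
def algEquiv (h : IsBialgForm E i) : E ⊗[K] B ≃ₐ[E] C :=
  AlgEquiv.ofBijective
    (Algebra.TensorProduct.lift (Algebra.ofId E C) i (fun _ _ => Commute.all _ _)) <| by
    have : (Algebra.TensorProduct.lift (Algebra.ofId E C) i (fun _ _ => Commute.all _ _) :
        E ⊗[K] B → C) = h.isBaseChange.equiv := by
      ext z
      induction z with
      | zero => simp
      | tmul c b => simp [IsBaseChange.equiv_tmul, Algebra.ofId_apply, Algebra.smul_def]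
      | add x y hx hy => simp only [map_add, hx, hy]
    rw [this]
    exact h.isBaseChange.equiv.bijective

lemma algEquiv_tmul (h : IsBialgForm E i) (c : E) (b : B) : h.algEquiv (c ⊗ₜ b) = c • i b := by
  simp [algEquiv, Algebra.ofId_apply, Algebra.smul_def]

lemma map_comul_one_tmul (φ : E ⊗[K] B →ₐ[E] C) (b : B) :
    Algebra.TensorProduct.map φ φ
      (Coalgebra.comul (R := E) ((1 : E) ⊗ₜ[K] b)) =
      tensorMap E ((φ.restrictScalars K).comp Algebra.TensorProduct.includeRight)
        ((φ.restrictScalars K).comp Algebra.TensorProduct.includeRight)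
        (Coalgebra.comul (R := K) b) := by
  rw [TensorProduct.comul_tmul]
  generalize Coalgebra.comul (R := K) b = z
  induction z with
  | zero => simp
  | tmul b c => simp
  | add y z hy hz => simp only [TensorProduct.tmul_add, map_add, hy, hz]

/-- The isomorphism `E ⊗ B ≃ C` of bialgebras induced by a form. -/
def bialgEquiv (h : IsBialgForm E i) : E ⊗[K] B ≃ₐc[E] C :=
  BialgEquiv.ofAlgEquiv h.algEquiv
    (by
      ext b
      simpa [algEquiv_tmul, Algebra.smul_def] using (h.algebraMap_counit b).symm)
    (by
      have hi : (((h.algEquiv : E ⊗[K] B →ₐ[E] C).restrictScalars K).comp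
          Algebra.TensorProduct.includeRight) = i := by
        ext b
        simp [algEquiv_tmul]
      ext b
      have h1 := map_comul_one_tmul (h.algEquiv : E ⊗[K] B →ₐ[E] C) b
      rw [hi, h.tensorMap_comul] at h1
      simpa [algEquiv_tmul] using h1)

@[simp]
lemma bialgEquiv_tmul (h : IsBialgForm E i) (c : E) (b : B) : h.bialgEquiv (c ⊗ₜ b) = c • i b :=
  h.algEquiv_tmul c b

lemma comp {F : Type*} [Field F] [Algebra K F] [Algebra E F] [IsScalarTower K E F]
    {D : Type*} [CommRing D] [Bialgebra F D] [Algebra E D] [IsScalarTower E F D] [Algebra K D]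
    [IsScalarTower K F D] [IsScalarTower K E D]
    (h : IsBialgForm E i) {j : C →ₐ[E] D} (hj : IsBialgForm F j) :
    IsBialgForm F ((j.restrictScalars K).comp i) where
  isBaseChange := by
    have hc := h.isBaseChange.comp hj.isBaseChange
    exact hc
  tensorMap_comul b := by
    have key (z : B ⊗[K] B) : tensorMap F ((j.restrictScalars K).comp i)
        ((j.restrictScalars K).comp i) z = tensorMap F j j (tensorMap E i i z) := by
      induction z with
      | zero => simp only [map_zero]
      | tmul b c => simp only [tensorMap_tmul, AlgHom.comp_apply, AlgHom.restrictScalars_apply]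
      | add y z hy hz => simp only [map_add, hy, hz]
    refine (key _).trans ?_
    rw [h.tensorMap_comul]
    exact hj.tensorMap_comul (i b)
  algebraMap_counit b := by
    rw [IsScalarTower.algebraMap_apply K E F, h.algebraMap_counit]
    exact hj.algebraMap_counit (i b)

end IsBialgForm

variable (E B) in
lemma isBialgForm_includeRight :
    IsBialgForm E (Algebra.TensorProduct.includeRight : B →ₐ[K] E ⊗[K] B) where
  isBaseChange := TensorProduct.isBaseChange K B E
  tensorMap_comul b := by
    have h := IsBialgForm.map_comul_one_tmul (AlgHom.id E (E ⊗[K] B)) b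
    rw [Algebra.TensorProduct.map_id] at h
    exact h.symm
  algebraMap_counit b := by simp [Algebra.smul_def]

lemma BialgEquiv.isBialgForm {D : Type*} [CommRing D] [Bialgebra E D] (e : C ≃ₐc[E] D) :
    IsBialgForm E (e : C →ₐ[E] D) where
  isBaseChange := IsBaseChange.ofEquiv (e : C ≃ₗ[E] D)
  tensorMap_comul b := by
    have h := congr($(CoalgHomClass.map_comp_comul (e : C →ₐc[E] D)) b)
    refine Eq.trans ?_ h
    simp only [LinearMap.comp_apply]
    generalize Coalgebra.comul (R := E) b = z
    induction z with
    | zero => simp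
    | tmul b c => simp
    | add y z hy hz => simp only [map_add, hy, hz]
  algebraMap_counit b := (CoalgHomClass.counit_comp_apply (e : C →ₐc[E] D) b).symm

/-- Extension of the ring of coefficients of the group algebra of `M`. -/
abbrev extendScalars (E F M : Type*) [Field E] [Field F] [Algebra E F] [AddCommGroup M] :
    AddMonoidAlgebra E M →ₐ[E] AddMonoidAlgebra F M :=
  AddMonoidAlgebra.mapAlgHom M (Algebra.ofId E F)

lemma isBialgForm_extendScalars (E F M : Type*) [Field E] [Field F] [Algebra E F]
    [AddCommGroup M] : IsBialgForm F (extendScalars E F M) where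
  isBaseChange := IsBaseChange.of_equiv
    (AddMonoidAlgebra.scalarTensorEquiv (M := M) E F).toLinearEquiv fun x => by
      simp [AddMonoidAlgebra.scalarTensorEquiv_tmul]
  tensorMap_comul b := by
    induction b using AddMonoidAlgebra.induction_linear with
    | zero => simp
    | add x y hx hy => simp only [map_add, hx, hy]
    | single m c => simp [Algebra.ofId_apply]
  algebraMap_counit b := by
    induction b using AddMonoidAlgebra.induction_linear with
    | zero => simp
    | add x y hx hy => simp only [map_add, hx, hy]
    | single m c => simp [Algebra.ofId_apply]

end BialgForm

/-! ### Models -/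

section Model

variable {K : Type u} [Field K] {A : Type u} [CommRing A] [HopfAlgebra K A]
  {E : Type u} [Field E] [Algebra K E] [Algebra E (AlgebraicClosure K)]
  [IsScalarTower K E (AlgebraicClosure K)] [Normal K E] [SplitsPoints K A E]
  {M : Type*} [AddCommGroup M] [DistribMulAction (FGal K A) M]

/-- `i` presents the `K`-group `X` with action of `F` as the one which, over `E`, becomes the
diagonalizable group with character group `M`, the actions of `Γ` and of `F(K̄)` being those
deduced from the actions on `M`. -/
structure IsModel (X : FGroup K A) (i : X.Fun →ₐ[K] AddMonoidAlgebra E M) : Prop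
    extends IsBialgForm E i where
  evalAt_coaction : ∀ f b, evalAt (pointOver E f) i (X.coaction b) = pointTwist E M f (i b)
  galTwist_apply : ∀ (σ : AbsGal K) b, galTwist (A := A) E M σ (i b) = i b

end Model

section Construction

variable {K : Type u} [Field K] {A : Type u} [CommRing A] [HopfAlgebra K A] [Module.Finite K A]
  {E : Type u} [Field E] [Algebra K E] [Algebra E (AlgebraicClosure K)]
  [IsScalarTower K E (AlgebraicClosure K)] [FiniteDimensional K E] [IsGalois K E]
  [SplitsPoints K A E]
  {M : Type*} [AddCommGroup M] [DistribMulAction (FGal K A) M]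

/-- The coaction of `F` on the invariants of `Γ` in `E[M]`. -/
def IsFixedForm.coaction {B : Type*} [CommRing B] [Algebra K B] {i : B →ₐ[K] AddMonoidAlgebra E M}
    (h : IsFixedForm A i) (hM : TrivialOver K A E M) : B →ₐ[K] A ⊗[K] B :=
  liftThrough (evalAll E i) (fun _ _ hxy => evalAll_injective E (h.isBaseChange hM)
    fun f => congr_fun hxy f) (orbitMap A i) (h.orbitMap_mem hM)

lemma IsFixedForm.evalAt_coaction {B : Type*} [CommRing B] [Algebra K B]
    {i : B →ₐ[K] AddMonoidAlgebra E M} (h : IsFixedForm A i) (hM : TrivialOver K A E M)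
    (f : Points K A) (b : B) :
    evalAt (pointOver E f) i (h.coaction hM b) = pointTwist E M f (i b) :=
  congr_fun (apply_liftThrough _ _ _ (h.orbitMap_mem hM) b) f

/-- Every module on which `Gal(K̄/E)` acts trivially has a model, given by the invariants of `Γ` in
`E[M]`. -/
theorem exists_isModel {M : Type u} [AddCommGroup M] [DistribMulAction (FGal K A) M]
    (hM : TrivialOver K A E M) :
    ∃ (X : FGroup K A) (i : X.Fun →ₐ[K] AddMonoidAlgebra E M), IsModel X i := by
  obtain ⟨B, _, _, i, h⟩ : ∃ (B : Type u) (_ : CommRing B) (_ : Algebra K B)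
      (i : B →ₐ[K] AddMonoidAlgebra E M), IsFixedForm A i :=
    ⟨fixedFun (K := K) (A := A) E M, inferInstance, inferInstance, (fixedFun E M).val,
      Subtype.val_injective, fun x => by rw [Subalgebra.range_val, mem_fixedFun]⟩
  let H := h.isHopfForm hM
  let := H.hopfAlgebra
  exact ⟨FGroup.ofForm E i H.isBaseChange H.tensorMap_comul (pointTwist E M) (pointTwist_one E M)
    (pointTwist_mul E M) (comul_pointTwist E M) (h.coaction hM) (h.evalAt_coaction hM), i,
    ⟨H.isBaseChange, H.tensorMap_comul, H.algebraMap_counit⟩, h.evalAt_coaction hM,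
    h.galTwist_apply⟩

end Construction

/-! ### Characters -/

/-- Over a field which contains the splitting field `E`, a form of a group algebra remains one. -/
lemma IsBialgForm.extend {K E : Type*} [Field K] [Field E] [Algebra K E] {B : Type*} [CommRing B]
    [Bialgebra K B] {M : Type*} [AddCommGroup M] {i : B →ₐ[K] AddMonoidAlgebra E M}
    (h : IsBialgForm E i) (F : Type*) [Field F] [Algebra K F] [Algebra E F]
    [IsScalarTower K E F] :
    IsBialgForm F (((extendScalars E F M).restrictScalars K).comp i) :=
  h.comp (isBialgForm_extendScalars E F M)

section Characters

variable {K : Type u} [Field K] {A : Type u} [CommRing A] [HopfAlgebra K A]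
  {M : Type*} [AddCommGroup M] {X : FGroup K A}

/-- The characters of a group which becomes diagonalizable over `K̄`. -/
def charEquiv (e : AlgebraicClosure K ⊗[K] X.Fun ≃ₐc[AlgebraicClosure K]
    AddMonoidAlgebra (AlgebraicClosure K) M) : M ≃+ X.Char :=
  AddEquiv.ofBijective
    (AddMonoidHom.mk' (fun m => Additive.ofMul ⟨e.symm (.single m 1),
        (isGroupLikeElem_map_equiv e.symm).2 (AddMonoidAlgebra.isGroupLikeElem_of m)⟩ : M → X.Char)
      fun m n => by
        apply FGroup.Char.val_injective
        change e.symm (.single (m + n) 1) = e.symm (.single m 1) * e.symm (.single n 1)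
        rw [← map_mul, AddMonoidAlgebra.single_mul_single, mul_one])
    ⟨fun m n h => by
      have h1 := e.symm.injective (congr_arg FGroup.Char.val h)
      exact AddMonoidAlgebra.of_injective h1, fun χ => by
      obtain ⟨m, hm⟩ := AddMonoidAlgebra.isGroupLikeElem_iff_mem_range_of.1
        ((isGroupLikeElem_map_equiv e).2 (Additive.toMul χ).2)
      refine ⟨m.toAdd, FGroup.Char.val_injective _ ?_⟩
      exact e.symm_apply_eq.2 hm⟩

lemma charEquiv_val (e : AlgebraicClosure K ⊗[K] X.Fun ≃ₐc[AlgebraicClosure K]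
    AddMonoidAlgebra (AlgebraicClosure K) M) (m : M) :
    (charEquiv e m).val = e.symm (.single m 1) := rfl

end Characters

lemma IsBialgForm.isSplitBy {K A : Type u} [Field K] [CommRing A] [HopfAlgebra K A] {E : Type*}
    [Field E] [Algebra K E] {M : Type*} [AddCommGroup M] {X : FGroup K A}
    {i : X.Fun →ₐ[K] AddMonoidAlgebra E M} (h : IsBialgForm E i) [Module.Free ℤ M]
    [Module.Finite ℤ M] (F : Type*) [Field F] [Algebra K F] [Algebra E F] [IsScalarTower K E F] :
    X.IsSplitBy F :=
  ⟨_, ⟨(h.extend F).bialgEquiv.trans (AddMonoidAlgebra.domCongrBialgEquiv F F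
    (Module.finBasis ℤ M).equivFun.toAddEquiv)⟩⟩

section Extend

variable {K : Type u} [Field K] {A : Type u} [CommRing A] [HopfAlgebra K A]
  {E : Type u} [Field E] {M : Type*} [AddCommGroup M] [DistribMulAction (FGal K A) M]

lemma extendScalars_pointTwist (F : Type u) [Field F] [Algebra E F] (f : Points K A)
    (x : AddMonoidAlgebra E M) :
    extendScalars E F M (pointTwist E M f x) = pointTwist F M f (extendScalars E F M x) := by
  induction x using AddMonoidAlgebra.induction_linear with
  | zero => simp
  | add x y hx hy => simp only [map_add, hx, hy]
  | single m c => simp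

variable [Algebra K E] [Algebra E (AlgebraicClosure K)]
  [IsScalarTower K E (AlgebraicClosure K)] [Normal K E]

lemma extendScalars_galTwist (σ : AbsGal K) (x : AddMonoidAlgebra E M) :
    extendScalars E (AlgebraicClosure K) M (galTwist (A := A) E M σ x) =
      galTwist (A := A) (AlgebraicClosure K) M σ (extendScalars E (AlgebraicClosure K) M x) := by
  induction x using AddMonoidAlgebra.induction_linear with
  | zero => simp
  | add x y hx hy => simp only [map_add, hx, hy]
  | single m c =>
    have h1 := AlgEquiv.restrictNormal_commutes σ E c
    have h2 := AlgEquiv.restrictNormal_commutes σ (AlgebraicClosure K)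
      (algebraMap E (AlgebraicClosure K) c)
    simp only [galTwist_single, AddMonoidAlgebra.mapAlgHom_single, Algebra.ofId_apply]
    congr 1
    exact h1.trans h2.symm

end Extend

section ModelChar

variable {K : Type u} [Field K] {A : Type u} [CommRing A] [HopfAlgebra K A]
  {E : Type u} [Field E] [Algebra K E] [Algebra E (AlgebraicClosure K)]
  [IsScalarTower K E (AlgebraicClosure K)] [Normal K E] [SplitsPoints K A E]
  {M : Type*} [AddCommGroup M] [DistribMulAction (FGal K A) M]

namespace IsModel

variable {X : FGroup K A} {i : X.Fun →ₐ[K] AddMonoidAlgebra E M}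

lemma bialgEquiv_pull (h : IsModel X i) (f : Points K A)
    (x : AlgebraicClosure K ⊗[K] X.Fun) :
    (h.extend (AlgebraicClosure K)).bialgEquiv (X.pull f x) =
      pointTwist (AlgebraicClosure K) M f
        ((h.extend (AlgebraicClosure K)).bialgEquiv x) := by
  induction x with
  | zero => simp
  | add x y hx hy => simp only [map_add, hx, hy]
  | tmul c b =>
    have key (z : A ⊗[K] X.Fun) : (h.extend (AlgebraicClosure K)).bialgEquiv
        (Algebra.TensorProduct.map f.ofConv (AlgHom.id K X.Fun) z) =
        extendScalars E (AlgebraicClosure K) M (evalAt (pointOver E f) i z) := by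
      induction z with
      | zero => simp
      | add x y hx hy => simp only [map_add, hx, hy]
      | tmul a b =>
        rw [Algebra.TensorProduct.map_tmul, IsBialgForm.bialgEquiv_tmul, evalAt_tmul, map_smul,
          ← algebraMap_pointOver E, algebraMap_smul]
        rfl
    have h1 : c ⊗ₜ[K] b = c • ((1 : AlgebraicClosure K) ⊗ₜ[K] b) := by
      rw [TensorProduct.smul_tmul', smul_eq_mul, mul_one]
    rw [h1, map_smul, map_smul, map_smul, map_smul, X.pull_one_tmul, key, h.evalAt_coaction,
      IsBialgForm.bialgEquiv_tmul, one_smul, extendScalars_pointTwist]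
    rfl

lemma bialgEquiv_gal (h : IsModel X i) (σ : AbsGal K)
    (x : AlgebraicClosure K ⊗[K] X.Fun) :
    (h.extend (AlgebraicClosure K)).bialgEquiv (X.gal σ x) =
      galTwist (A := A) (AlgebraicClosure K) M σ
        ((h.extend (AlgebraicClosure K)).bialgEquiv x) := by
  induction x with
  | zero => simp
  | add x y hx hy => simp only [map_add, hx, hy]
  | tmul c b =>
    have h1 : X.gal σ (c ⊗ₜ[K] b) = σ c ⊗ₜ b := by simp [FGroup.gal]
    have h2 : AlgEquiv.restrictNormalHom (AlgebraicClosure K) σ c = σ c :=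
      AlgEquiv.restrictNormal_commutes σ (AlgebraicClosure K) c
    rw [h1, IsBialgForm.bialgEquiv_tmul, IsBialgForm.bialgEquiv_tmul, galTwist_smul, h2]
    congr 1
    rw [AlgHom.comp_apply, AlgHom.restrictScalars_apply, ← extendScalars_galTwist,
      h.galTwist_apply]

/-- The module of characters of a model of `M` is `M`. -/
theorem exists_charEquiv (h : IsModel X i) :
    ∃ e : M ≃+ X.Char, ∀ (g : FGal K A) m, e (g • m) = g • e m := by
  let e := (h.extend (AlgebraicClosure K)).bialgEquiv
  refine ⟨charEquiv e, fun g m => FGroup.Char.val_injective _ ?_⟩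
  rw [charEquiv_val, FGroup.Char.val_smul, charEquiv_val]
  refine e.injective ((e.apply_symm_apply _).trans ?_)
  change _ = (h.extend (AlgebraicClosure K)).bialgEquiv _
  rw [bialgEquiv_pull h, bialgEquiv_gal h]
  change _ = pointTwist (AlgebraicClosure K) M _ (galTwist (AlgebraicClosure K) M _ (e (e.symm _)))
  rw [BialgEquiv.apply_symm_apply, galTwist_single, pointTwist_single, map_one, inv_inv, ← mul_smul,
    SemidirectProduct.inl_left_mul_inr_right]

lemma isQuasiSplitTorus (h : IsModel X i) [Module.Free ℤ M] [Module.Finite ℤ M]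
    (hM : IsInduced (FGal K A) M) : X.IsQuasiSplitTorus := by
  obtain ⟨e, he⟩ := h.exists_charEquiv
  exact ⟨h.isSplitBy _, hM.of_equiv e.symm fun g χ => by
    rw [AddEquiv.symm_apply_eq, he, AddEquiv.apply_symm_apply]⟩

end IsModel

end ModelChar

/-! ### Tori as models of their character modules -/

section Descent

/-- A linear map which becomes bijective after an extension of scalars is bijective. -/
lemma bijective_of_isBaseChange {E F : Type*} [Field E] [Field F] [Algebra E F]
    {V W V' W' : Type*} [AddCommGroup V] [Module E V] [AddCommGroup W] [Module E W]
    [AddCommGroup V'] [Module E V'] [Module F V'] [IsScalarTower E F V']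
    [AddCommGroup W'] [Module E W'] [Module F W'] [IsScalarTower E F W']
    {i : V →ₗ[E] V'} (hi : IsBaseChange F i) {j : W →ₗ[E] W'} (hj : IsBaseChange F j)
    (g : V →ₗ[E] W) (g' : V' →ₗ[F] W') (hg' : Function.Bijective g')
    (hg : ∀ v, j (g v) = g' (i v)) : Function.Bijective g := by
  refine ⟨fun v w h => isBaseChange_injective hi (hg'.1 ?_), fun w => ?_⟩
  · rw [← hg, ← hg, h]
  · by_contra hw
    obtain ⟨ℓ, hℓ, hle⟩ := Submodule.exists_le_ker_of_notMem (p := LinearMap.range g) hw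
    -- the extension of `ℓ` to `W'` vanishes since it vanishes on the image of `V`
    let ℓ' : W' →ₗ[F] F := hj.lift ((Algebra.linearMap E F).comp ℓ)
    have h0 : ℓ'.comp g' = 0 := by
      refine hi.algHom_ext _ _ fun v => ?_
      rw [LinearMap.comp_apply, ← hg, hj.lift_eq, LinearMap.zero_apply, LinearMap.comp_apply,
        LinearMap.mem_ker.1 (hle ⟨v, rfl⟩), map_zero]
    obtain ⟨x, hx⟩ := hg'.2 (j w)
    have h1 : ℓ' (j w) = 0 := by rw [← hx]; exact congr($h0 x)
    rw [hj.lift_eq] at h1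
    exact hℓ ((algebraMap E F).injective (h1.trans (map_zero _).symm))

lemma IsBialgForm.of_comp {K : Type*} [Field K] {E : Type*} [Field E] [Algebra K E]
    {B : Type*} [CommRing B] [Bialgebra K B] {C : Type*} [CommRing C] [Bialgebra E C] [Algebra K C]
    [IsScalarTower K E C] {i : B →ₐ[K] C}
    {F : Type*} [Field F] [Algebra K F] [Algebra E F] [IsScalarTower K E F]
    {D : Type*} [CommRing D] [Bialgebra F D] [Algebra E D] [IsScalarTower E F D] [Algebra K D]
    [IsScalarTower K F D] [IsScalarTower K E D] {j : C →ₐ[E] D} (hj : IsBialgForm F j)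
    (h : IsBialgForm F ((j.restrictScalars K).comp i)) (hi : IsBaseChange E i.toLinearMap) :
    IsBialgForm E i where
  isBaseChange := hi
  tensorMap_comul b := by
    have key (z : B ⊗[K] B) : tensorMap F ((j.restrictScalars K).comp i)
        ((j.restrictScalars K).comp i) z = tensorMap F j j (tensorMap E i i z) := by
      induction z with
      | zero => simp only [map_zero]
      | tmul b c => simp only [tensorMap_tmul, AlgHom.comp_apply, AlgHom.restrictScalars_apply]
      | add y z hy hz => simp only [map_add, hy, hz]
    refine isBaseChange_injective (isBaseChange_tensorMap hj.isBaseChange hj.isBaseChange) ?_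
    refine (key _).symm.trans ((h.tensorMap_comul b).trans ?_)
    exact (hj.tensorMap_comul (i b)).symm
  algebraMap_counit b := by
    apply (algebraMap E F).injective
    rw [← IsScalarTower.algebraMap_apply, h.algebraMap_counit]
    exact (hj.algebraMap_counit (i b)).symm

end Descent

section Torus

variable {K : Type u} [Field K] {A : Type u} [CommRing A] [HopfAlgebra K A] {X : FGroup K A}

/-- Over `K̄`, a torus is the diagonalizable group with character group `T̂`. -/
lemma exists_bialgEquiv_char (h : X.IsTorus) :
    ∃ e : AlgebraicClosure K ⊗[K] X.Fun ≃ₐc[AlgebraicClosure K]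
      AddMonoidAlgebra (AlgebraicClosure K) X.Char, ∀ χ : X.Char, e χ.val = .single χ 1 := by
  obtain ⟨n, ⟨e₀⟩⟩ := h
  refine ⟨e₀.trans (AddMonoidAlgebra.domCongrBialgEquiv _ _ (charEquiv e₀)), fun χ => ?_⟩
  obtain ⟨m, rfl⟩ := (charEquiv e₀).surjective χ
  rw [charEquiv_val]
  refine (congr_arg (AddMonoidAlgebra.domCongrBialgEquiv (AlgebraicClosure K) (AlgebraicClosure K)
    (charEquiv e₀)) (e₀.apply_symm_apply _)).trans ?_
  exact AddMonoidAlgebra.domCongr_single (R := AlgebraicClosure K) ..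

lemma free_finite_char (h : X.IsTorus) : Module.Free ℤ X.Char ∧ Module.Finite ℤ X.Char := by
  obtain ⟨n, ⟨e₀⟩⟩ := h
  exact ⟨Module.Free.of_equiv (charEquiv e₀).toIntLinearEquiv,
    Module.Finite.equiv (charEquiv e₀).toIntLinearEquiv⟩

section Equivariance

variable {e : AlgebraicClosure K ⊗[K] X.Fun ≃ₐc[AlgebraicClosure K]
      AddMonoidAlgebra (AlgebraicClosure K) X.Char}

lemma symm_single (he : ∀ χ : X.Char, e χ.val = .single χ 1) (χ : X.Char)
    (c : AlgebraicClosure K) : e.symm (.single χ c) = c • χ.val := by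
  have h : AddMonoidAlgebra.single χ c = e (c • χ.val) := by
    rw [map_smul, he]
    simp
  rw [h]
  exact e.symm_apply_apply _

lemma char_pull (he : ∀ χ : X.Char, e χ.val = .single χ 1) (f : Points K A)
    (x : AlgebraicClosure K ⊗[K] X.Fun) :
    e (X.pull f x) = pointTwist (AlgebraicClosure K) X.Char f (e x) := by
  obtain ⟨y, rfl⟩ : ∃ y, e.symm y = x := ⟨e x, e.symm_apply_apply x⟩
  rw [BialgEquiv.apply_symm_apply]
  induction y using AddMonoidAlgebra.induction_linear with
  | zero => simp
  | add x y hx hy => simp only [map_add, hx, hy]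
  | single χ c =>
    have h2 : X.pull f χ.val = ((SemidirectProduct.inl f⁻¹ : FGal K A) • χ).val := by
      rw [FGroup.Char.val_smul]
      simp [FGroup.gal_one]
    rw [symm_single he, map_smul, map_smul, h2, he]
    simp

lemma char_gal (he : ∀ χ : X.Char, e χ.val = .single χ 1) (σ : AbsGal K)
    (x : AlgebraicClosure K ⊗[K] X.Fun) :
    e (X.gal σ x) = galTwist (A := A) (AlgebraicClosure K) X.Char σ (e x) := by
  obtain ⟨y, rfl⟩ : ∃ y, e.symm y = x := ⟨e x, e.symm_apply_apply x⟩
  rw [BialgEquiv.apply_symm_apply]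
  induction y using AddMonoidAlgebra.induction_linear with
  | zero => simp
  | add x y hx hy => simp only [map_add, hx, hy]
  | single χ c =>
    have h2 : X.gal σ χ.val = ((SemidirectProduct.inr σ : FGal K A) • χ).val := by
      rw [FGroup.Char.val_smul]
      simp [FGroup.pull_one]
    have h3 : X.gal σ (c • χ.val) = σ c • X.gal σ χ.val := by
      rw [Algebra.smul_def, map_mul, Algebra.smul_def]
      simp [FGroup.gal]
    have h4 : AlgEquiv.restrictNormalHom (AlgebraicClosure K) σ c = σ c :=
      AlgEquiv.restrictNormal_commutes σ (AlgebraicClosure K) c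
    rw [symm_single he, h3, map_smul, h2, he, galTwist_single, h4]
    simp

end Equivariance

variable {E : Type u} [Field E] [Algebra K E] [Algebra E (AlgebraicClosure K)]
  [IsScalarTower K E (AlgebraicClosure K)]

/-- The extension of scalars from `E ⊗ B` to `K̄ ⊗ B`. -/
def toClosure (E : Type u) [Field E] [Algebra K E] [Algebra E (AlgebraicClosure K)]
    [IsScalarTower K E (AlgebraicClosure K)] (X : FGroup K A) :
    E ⊗[K] X.Fun →ₐ[E] AlgebraicClosure K ⊗[K] X.Fun :=
  Algebra.TensorProduct.map (Algebra.ofId E (AlgebraicClosure K)) (AlgHom.id K X.Fun)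

lemma isBaseChange_toClosure :
    IsBaseChange (AlgebraicClosure K) (toClosure E X).toLinearMap := by
  refine IsBaseChange.of_comp (TensorProduct.isBaseChange K X.Fun E) ?_
  have h : ((toClosure E X).toLinearMap.restrictScalars K) ∘ₗ TensorProduct.mk K E X.Fun 1 =
      TensorProduct.mk K (AlgebraicClosure K) X.Fun 1 :=
    LinearMap.ext fun b => by
      change toClosure E X (1 ⊗ₜ b) = 1 ⊗ₜ b
      simp [toClosure]
  rw [h]
  exact TensorProduct.isBaseChange K X.Fun (AlgebraicClosure K)

lemma toClosure_injective : Function.Injective (toClosure E X) := by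
  have h : IsBaseChange (AlgebraicClosure K) (toClosure E X).toLinearMap := isBaseChange_toClosure
  have h1 : Function.Injective (toClosure E X).toLinearMap := isBaseChange_injective h
  exact h1

/-- All the characters of `X` are defined over `E`. -/
def CharsDefinedOver (E : Type u) [Field E] [Algebra K E] [Algebra E (AlgebraicClosure K)]
    [IsScalarTower K E (AlgebraicClosure K)] (X : FGroup K A) : Prop :=
  ∀ χ : X.Char, ∃ y, toClosure E X y = χ.val

/-- The homomorphism `E[T̂] → E ⊗ B` when the characters are defined over `E`. -/
def CharsDefinedOver.hom (h : CharsDefinedOver E X) :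
    AddMonoidAlgebra E X.Char →ₐ[E] E ⊗[K] X.Fun :=
  AddMonoidAlgebra.lift E _ X.Char
    { toFun := fun χ => (h χ.toAdd).choose
      map_one' := toClosure_injective
        (((h 0).choose_spec).trans (map_one (toClosure E X)).symm)
      map_mul' := fun χ ψ => toClosure_injective <| by
        refine ((h (χ.toAdd + ψ.toAdd)).choose_spec).trans ?_
        refine Eq.trans ?_ (map_mul (toClosure E X) _ _).symm
        rw [(h χ.toAdd).choose_spec, (h ψ.toAdd).choose_spec]
        rfl }

variable {e : AlgebraicClosure K ⊗[K] X.Fun ≃ₐc[AlgebraicClosure K]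
      AddMonoidAlgebra (AlgebraicClosure K) X.Char}

lemma CharsDefinedOver.toClosure_hom (h : CharsDefinedOver E X)
    (he : ∀ χ : X.Char, e χ.val = .single χ 1) (x : AddMonoidAlgebra E X.Char) :
    e (toClosure E X (h.hom x)) = extendScalars E (AlgebraicClosure K) X.Char x := by
  induction x using AddMonoidAlgebra.induction_linear with
  | zero => simp
  | add x y hx hy => simp only [map_add, hx, hy]
  | single χ c =>
    have h1 : toClosure E X (h.hom (.single χ c)) =
        algebraMap E (AlgebraicClosure K) c • χ.val := by
      rw [hom, AddMonoidAlgebra.lift_single, map_smul, ← algebraMap_smul (AlgebraicClosure K)]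
      exact congr_arg _ (h χ).choose_spec
    rw [h1, map_smul, he]
    simp [Algebra.ofId_apply, Algebra.algebraMap_eq_smul_one]

lemma CharsDefinedOver.bijective_hom (h : CharsDefinedOver E X)
    (he : ∀ χ : X.Char, e χ.val = .single χ 1) : Function.Bijective h.hom := by
  have hcomp (x : AddMonoidAlgebra E X.Char) : toClosure E X (h.hom x) =
      e.symm (extendScalars E (AlgebraicClosure K) X.Char x) := by
    rw [← h.toClosure_hom he]
    exact (e.symm_apply_apply _).symm
  let e' : AddMonoidAlgebra (AlgebraicClosure K) X.Char →ₗ[AlgebraicClosure K]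
    AlgebraicClosure K ⊗[K] X.Fun := e.symm.toAlgEquiv.toLinearMap
  exact bijective_of_isBaseChange
    (isBialgForm_extendScalars E (AlgebraicClosure K) X.Char).isBaseChange
    isBaseChange_toClosure h.hom.toLinearMap e' e.symm.bijective hcomp

/-- A torus whose characters are defined over `E` is a model of its character module. -/
theorem exists_isModel_char [Normal K E] [SplitsPoints K A E] (hT : X.IsTorus)
    (h : CharsDefinedOver E X) :
    ∃ i : X.Fun →ₐ[K] AddMonoidAlgebra E X.Char, IsModel X i := by
  obtain ⟨e, he⟩ := exists_bialgEquiv_char hT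
  let g := AlgEquiv.ofBijective h.hom (h.bijective_hom he)
  let i : X.Fun →ₐ[K] AddMonoidAlgebra E X.Char :=
    ((g.symm : E ⊗[K] X.Fun →ₐ[E] _).restrictScalars K).comp Algebra.TensorProduct.includeRight
  have hi (b : X.Fun) : extendScalars E (AlgebraicClosure K) X.Char (i b) = e (1 ⊗ₜ b) := by
    rw [← h.toClosure_hom he]
    have h1 : h.hom (i b) = 1 ⊗ₜ b := g.apply_symm_apply _
    rw [h1]
    simp [toClosure]
  have hbc : IsBaseChange E i.toLinearMap :=
    IsBaseChange.of_equiv g.symm.toLinearEquiv fun b => rfl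
  have hinj : Function.Injective (extendScalars E (AlgebraicClosure K) X.Char) :=
    (isBialgForm_extendScalars E (AlgebraicClosure K) X.Char).injective
  have hform : IsBialgForm E i := by
    refine (isBialgForm_extendScalars E (AlgebraicClosure K) X.Char).of_comp ?_ hbc
    have h1 := (isBialgForm_includeRight (AlgebraicClosure K) X.Fun).comp
      (BialgEquiv.isBialgForm e)
    convert h1
    exact AlgHom.ext hi
  refine ⟨i, hform, fun f b => hinj ?_, fun σ b => hinj ?_⟩
  · have key (z : A ⊗[K] X.Fun) :
        extendScalars E (AlgebraicClosure K) X.Char (evalAt (pointOver E f) i z) =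
        e (Algebra.TensorProduct.map f.ofConv (AlgHom.id K X.Fun) z) := by
      induction z with
      | zero => simp
      | add x y hx hy => simp only [map_add, hx, hy]
      | tmul a b =>
        have h1 : f.ofConv a ⊗ₜ[K] b = f.ofConv a • ((1 : AlgebraicClosure K) ⊗ₜ[K] b) := by
          rw [TensorProduct.smul_tmul', smul_eq_mul, mul_one]
        rw [evalAt_tmul, map_smul, hi, Algebra.TensorProduct.map_tmul, AlgHom.id_apply, h1,
          map_smul, ← algebraMap_pointOver E, algebraMap_smul]
    rw [key, ← X.pull_one_tmul, char_pull he, extendScalars_pointTwist, hi]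
  · rw [extendScalars_galTwist, hi, ← char_gal he]
    simp [FGroup.gal]

end Torus

/-! ### Products of models -/

section CharMap

variable {K : Type u} [Field K] {A : Type u} [CommRing A] [HopfAlgebra K A] {E : Type u} [Field E]
  {M N : Type*} [AddCommGroup M] [DistribMulAction (FGal K A) M]
  [AddCommGroup N] [DistribMulAction (FGal K A) N]

/-- The homomorphism `E[M] → E[N]` induced by a homomorphism of `F_Γ`-modules. -/
def charMap (E : Type u) [Field E] (j : M →+[FGal K A] N) :
    AddMonoidAlgebra E M →ₐ[E] AddMonoidAlgebra E N :=
  (AddMonoidAlgebra.mapDomainBialgHom E (j : M →+ N) :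
    AddMonoidAlgebra E M →ₐ[E] AddMonoidAlgebra E N)

@[simp]
lemma charMap_single (j : M →+[FGal K A] N) (m : M) (c : E) :
    charMap E j (.single m c) = .single (j m) c := by
  simp [charMap]

lemma comul_charMap (j : M →+[FGal K A] N) (x : AddMonoidAlgebra E M) :
    Coalgebra.comul (R := E) (charMap E j x) =
      Algebra.TensorProduct.map (charMap E j) (charMap E j) (Coalgebra.comul (R := E) x) := by
  induction x using AddMonoidAlgebra.induction_linear with
  | zero => simp
  | add x y hx hy => simp only [map_add, hx, hy]
  | single m c => simp

lemma counit_charMap (j : M →+[FGal K A] N) (x : AddMonoidAlgebra E M) :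
    Coalgebra.counit (R := E) (charMap E j x) = Coalgebra.counit (R := E) x := by
  induction x using AddMonoidAlgebra.induction_linear with
  | zero => simp
  | add x y hx hy => simp only [map_add, hx, hy]
  | single m c => simp

lemma charMap_pointTwist (j : M →+[FGal K A] N) (f : Points K A) (x : AddMonoidAlgebra E M) :
    charMap E j (pointTwist E M f x) = pointTwist E N f (charMap E j x) := by
  induction x using AddMonoidAlgebra.induction_linear with
  | zero => simp
  | add x y hx hy => simp only [map_add, hx, hy]
  | single m c => simp

lemma charMap_galTwist [Algebra K E] [Algebra E (AlgebraicClosure K)]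
    [IsScalarTower K E (AlgebraicClosure K)] [Normal K E]
    (j : M →+[FGal K A] N) (σ : AbsGal K) (x : AddMonoidAlgebra E M) :
    charMap E j (galTwist (A := A) E M σ x) = galTwist (A := A) E N σ (charMap E j x) := by
  induction x using AddMonoidAlgebra.induction_linear with
  | zero => simp
  | add x y hx hy => simp only [map_add, hx, hy]
  | single m c => simp

end CharMap

section TensorGroupAlgebra

variable (E : Type*) [Field E] (M N : Type*)

/-- The isomorphism `E[M] ⊗ E[N] ≃ E[M × N]` of vector spaces. -/
def tensorGroupAlgebra :
    AddMonoidAlgebra E M ⊗[E] AddMonoidAlgebra E N ≃ₗ[E] AddMonoidAlgebra E (M × N) :=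
  (TensorProduct.congr (AddMonoidAlgebra.coeffLinearEquiv E)
    (AddMonoidAlgebra.coeffLinearEquiv E)).trans
    ((finsuppTensorFinsupp' E M N).trans (AddMonoidAlgebra.coeffLinearEquiv E).symm)

variable {M N} in
@[simp]
lemma tensorGroupAlgebra_single (m : M) (n : N) (c d : E) :
    tensorGroupAlgebra E M N (.single m c ⊗ₜ .single n d) = .single (m, n) (c * d) := by
  change AddMonoidAlgebra.ofCoeff (finsuppTensorFinsupp' E M N
    (Finsupp.single m c ⊗ₜ Finsupp.single n d)) = _
  rw [finsuppTensorFinsupp'_single_tmul_single]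
  rfl

end TensorGroupAlgebra

section Prod

variable {K : Type u} [Field K] {A : Type u} [CommRing A] [HopfAlgebra K A]
  {E : Type u} [Field E] [Algebra K E] [Algebra E (AlgebraicClosure K)]
  [IsScalarTower K E (AlgebraicClosure K)] [Normal K E] [SplitsPoints K A E]
  {M N : Type*} [AddCommGroup M] [DistribMulAction (FGal K A) M]
  [AddCommGroup N] [DistribMulAction (FGal K A) N]

/-- A model of a module is a model of every isomorphic module. -/
lemma IsModel.congr {X : FGroup K A} {i : X.Fun →ₐ[K] AddMonoidAlgebra E M} (h : IsModel X i)
    (e : M ≃+ N) (he : ∀ (g : FGal K A) m, e (g • m) = g • e m) :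
    ∃ i' : X.Fun →ₐ[K] AddMonoidAlgebra E N, IsModel X i' := by
  let j : M →+[FGal K A] N := { e.toAddMonoidHom with map_smul' := he }
  let i' := ((charMap E j).restrictScalars K).comp i
  have hi' (b) : i' b = charMap E j (i b) := rfl
  have hj : IsBialgForm E (charMap E j) :=
    BialgEquiv.isBialgForm (AddMonoidAlgebra.domCongrBialgEquiv E E e)
  refine ⟨i', h.toIsBialgForm.comp hj, fun f b => ?_, fun σ b => ?_⟩
  · have h1 := evalAt_map (pointOver E f) i i' (AlgHom.id K X.Fun) (charMap E j) (fun b => rfl)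
      (X.coaction b)
    rw [Algebra.TensorProduct.map_id, AlgHom.id_apply, h.evalAt_coaction] at h1
    rw [h1, charMap_pointTwist, hi']
  · rw [hi', ← charMap_galTwist, h.galTwist_apply]

lemma isModel_trivial :
    ∃ i : (FGroup.trivial : FGroup K A).Fun →ₐ[K] AddMonoidAlgebra E (Fin 0 → M),
      IsModel (FGroup.trivial : FGroup K A) i := by
  let i : K →ₐ[K] AddMonoidAlgebra E (Fin 0 → M) := Algebra.ofId K _
  have hi : IsBialgForm E i := by
    refine ⟨IsBaseChange.of_equiv ((TensorProduct.AlgebraTensorModule.rid K E E).trans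
      (AddMonoidAlgebra.bialgEquivOfSubsingleton (Fin 0 → M)).toAlgEquiv.symm.toLinearEquiv)
      fun k => ?_, fun k => ?_, fun k => ?_⟩
    · change (AddMonoidAlgebra.bialgEquivOfSubsingleton (R := E) (Fin 0 → M)).symm
        (TensorProduct.AlgebraTensorModule.rid K E E (1 ⊗ₜ k)) = i k
      rw [TensorProduct.AlgebraTensorModule.rid_tmul, ← Algebra.algebraMap_eq_smul_one]
      exact (IsScalarTower.algebraMap_apply K E (AddMonoidAlgebra E (Fin 0 → M)) k).symm
    · exact congr($(Subsingleton.elim ((tensorMap E i i).comp (Bialgebra.comulAlgHom K K))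
        (((Bialgebra.comulAlgHom E _).restrictScalars K).comp i)) k)
    · exact congr($(Subsingleton.elim ((Algebra.ofId K E).comp (Bialgebra.counitAlgHom K K))
        (((Bialgebra.counitAlgHom E _).restrictScalars K).comp i)) k)
  have h2 (f : Points K A) (k : K) : evalAt (pointOver E f) i (Algebra.ofId K (A ⊗[K] K) k) =
      pointTwist E (Fin 0 → M) f (i k) :=
    congr($(Subsingleton.elim ((evalAt (pointOver E f) i).comp (Algebra.ofId K (A ⊗[K] K)))
      (((pointTwist E (Fin 0 → M) f).restrictScalars K).comp i)) k)
  have h3 (σ : AbsGal K) (k : K) : galTwist (A := A) E (Fin 0 → M) σ (i k) = i k :=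
    congr($(Subsingleton.elim ((galTwist (A := A) E (Fin 0 → M) σ).comp i) i) k)
  exact ⟨i, hi, h2, h3⟩

variable {X Y : FGroup K A} {i : X.Fun →ₐ[K] AddMonoidAlgebra E M}
  {i' : Y.Fun →ₐ[K] AddMonoidAlgebra E N}

lemma IsModel.prod (h : IsModel X i) (h' : IsModel Y i') :
    ∃ k : (X.prod Y).Fun →ₐ[K] AddMonoidAlgebra E (M × N), IsModel (X.prod Y) k := by
  let j₁ : M →+[FGal K A] M × N := { AddMonoidHom.inl M N with map_smul' := fun g m => by simp }
  let j₂ : N →+[FGal K A] M × N := { AddMonoidHom.inr M N with map_smul' := fun g m => by simp }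
  let k : X.Fun ⊗[K] Y.Fun →ₐ[K] AddMonoidAlgebra E (M × N) :=
    Algebra.TensorProduct.lift (((charMap E j₁).restrictScalars K).comp i)
      (((charMap E j₂).restrictScalars K).comp i') (fun _ _ => .all _ _)
  have hk (b c) : k (b ⊗ₜ c) = charMap E j₁ (i b) * charMap E j₂ (i' c) := by simp [k]
  have hkl (b) : k (b ⊗ₜ 1) = charMap E j₁ (i b) := by simp [k]
  have hkr (c) : k (1 ⊗ₜ c) = charMap E j₂ (i' c) := by simp [k]
  have hbc : IsBaseChange E k.toLinearMap := by
    refine IsBaseChange.of_equiv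
      ((isBaseChange_tensorMap h.isBaseChange h'.isBaseChange).equiv.trans
        (tensorGroupAlgebra E M N)) fun z => ?_
    have key (x : AddMonoidAlgebra E M) (y : AddMonoidAlgebra E N) :
        tensorGroupAlgebra E M N (x ⊗ₜ y) = charMap E j₁ x * charMap E j₂ y := by
      induction x using AddMonoidAlgebra.induction_linear with
      | zero => simp
      | add x x' hx hy => simp only [TensorProduct.add_tmul, map_add, hx, hy, add_mul]
      | single m c =>
        induction y using AddMonoidAlgebra.induction_linear with
        | zero => simp
        | add x x' hx hy => simp only [TensorProduct.tmul_add, map_add, hx, hy, mul_add]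
        | single n d =>
          have h₁ : j₁ m = (m, 0) := rfl
          have h₂ : j₂ n = (0, n) := rfl
          simp [h₁, h₂, AddMonoidAlgebra.single_mul_single]
    rw [LinearEquiv.trans_apply, IsBaseChange.equiv_tmul, one_smul]
    induction z with
    | zero => simp
    | add x y hx hy => simp only [map_add, hx, hy]
    | tmul b c =>
      exact (congr_arg _ (tensorMap_tmul i i' b c)).trans ((key _ _).trans (hk b c).symm)
  have hcomul : (tensorMap E k k).comp (Bialgebra.comulAlgHom K (X.Fun ⊗[K] Y.Fun)) =
      ((Bialgebra.comulAlgHom E (AddMonoidAlgebra E (M × N))).restrictScalars K).comp k := by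
    refine Algebra.TensorProduct.ext (AlgHom.ext fun b => ?_) (AlgHom.ext fun c => ?_)
    · have h1 : Coalgebra.comul (R := K) (b ⊗ₜ[K] (1 : Y.Fun)) =
          Algebra.TensorProduct.map
            (Algebra.TensorProduct.includeLeft : X.Fun →ₐ[K] X.Fun ⊗[K] Y.Fun)
            (Algebra.TensorProduct.includeLeft : X.Fun →ₐ[K] X.Fun ⊗[K] Y.Fun)
            (Coalgebra.comul (R := K) b) := by
        rw [TensorProduct.comul_tmul, Bialgebra.comul_one]
        generalize Coalgebra.comul (R := K) b = z
        induction z with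
        | zero => simp
        | tmul b c => simp [Algebra.TensorProduct.one_def]
        | add y z hy hz => simp only [TensorProduct.add_tmul, map_add, hy, hz]
      change tensorMap E k k (Coalgebra.comul (R := K) (b ⊗ₜ[K] (1 : Y.Fun))) =
        Coalgebra.comul (R := E) (k (b ⊗ₜ 1))
      rw [h1, tensorMap_map i i k k _ _ (charMap E j₁) (charMap E j₁) hkl hkl, h.tensorMap_comul,
        hkl, comul_charMap]
    · have h1 : Coalgebra.comul (R := K) ((1 : X.Fun) ⊗ₜ[K] c) =
          Algebra.TensorProduct.map
            (Algebra.TensorProduct.includeRight : Y.Fun →ₐ[K] X.Fun ⊗[K] Y.Fun)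
            (Algebra.TensorProduct.includeRight : Y.Fun →ₐ[K] X.Fun ⊗[K] Y.Fun)
            (Coalgebra.comul (R := K) c) := by
        rw [TensorProduct.comul_tmul, Bialgebra.comul_one]
        generalize Coalgebra.comul (R := K) c = z
        induction z with
        | zero => simp
        | tmul b c => simp [Algebra.TensorProduct.one_def]
        | add y z hy hz => simp only [TensorProduct.tmul_add, map_add, hy, hz]
      change tensorMap E k k (Coalgebra.comul (R := K) ((1 : X.Fun) ⊗ₜ[K] c)) =
        Coalgebra.comul (R := E) (k (1 ⊗ₜ c))
      rw [h1, tensorMap_map i' i' k k _ _ (charMap E j₂) (charMap E j₂) hkr hkr,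
        h'.tensorMap_comul, hkr, comul_charMap]
  have hcounit (z : X.Fun ⊗[K] Y.Fun) : algebraMap K E (Coalgebra.counit (R := K) z) =
      Coalgebra.counit (R := E) (k z) := by
    induction z with
    | zero => simp
    | add x y hx hy => simp only [map_add, hx, hy]
    | tmul b c =>
      rw [hk, Bialgebra.counit_mul, counit_charMap, counit_charMap, ← h.algebraMap_counit,
        ← h'.algebraMap_counit]
      simp [mul_comm]
  have hcoact (f : Points K A) : (evalAt (pointOver E f) k).comp (X.prod Y).coaction =
      ((pointTwist E (M × N) f).restrictScalars K).comp k := by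
    refine Algebra.TensorProduct.ext (AlgHom.ext fun b => ?_) (AlgHom.ext fun c => ?_)
    · have h1 := congr($(FGroup.diagCoaction_comp_left X.coaction Y.coaction) b)
      have h2 := evalAt_map (pointOver E f) i k Algebra.TensorProduct.includeLeft (charMap E j₁) hkl
        (X.coaction b)
      change evalAt (pointOver E f) k (diagCoaction X.coaction Y.coaction (b ⊗ₜ 1)) =
        pointTwist E (M × N) f (k (b ⊗ₜ 1))
      refine (congr_arg _ h1).trans (h2.trans ?_)
      rw [h.evalAt_coaction, hkl, charMap_pointTwist]
    · have h1 := congr($(FGroup.diagCoaction_comp_right X.coaction Y.coaction) c)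
      have h2 := evalAt_map (pointOver E f) i' k Algebra.TensorProduct.includeRight (charMap E j₂)
        hkr (Y.coaction c)
      change evalAt (pointOver E f) k (diagCoaction X.coaction Y.coaction (1 ⊗ₜ c)) =
        pointTwist E (M × N) f (k (1 ⊗ₜ c))
      refine (congr_arg _ h1).trans (h2.trans ?_)
      rw [h'.evalAt_coaction, hkr, charMap_pointTwist]
  have hgal (σ : AbsGal K) (z : X.Fun ⊗[K] Y.Fun) : galTwist (A := A) E (M × N) σ (k z) = k z := by
    induction z with
    | zero => simp
    | add x y hx hy => simp only [map_add, hx, hy]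
    | tmul b c =>
      rw [hk, map_mul, ← charMap_galTwist, ← charMap_galTwist, h.galTwist_apply, h'.galTwist_apply]
  exact ⟨k, ⟨hbc, fun z => congr($hcomul z), hcounit⟩, fun f z => congr($(hcoact f) z), hgal⟩

lemma IsModel.pow (h : IsModel X i) (r : ℕ) :
    ∃ k : (X.pow r).Fun →ₐ[K] AddMonoidAlgebra E (Fin r → M), IsModel (X.pow r) k := by
  induction r with
  | zero => exact isModel_trivial
  | succ r ih =>
    obtain ⟨k, hk⟩ := ih
    obtain ⟨k', hk'⟩ := hk.prod h
    exact hk'.congr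
      { toFun := fun p => Fin.cons p.2 p.1
        invFun := fun v => (Fin.tail v, v 0)
        left_inv := fun p => by simp
        right_inv := fun v => by simp
        map_add' := fun p q => by
          ext l
          refine Fin.cases ?_ (fun l => ?_) l <;> simp }
      fun g p => by
        ext l
        refine Fin.cases ?_ (fun l => ?_) l <;> simp

end Prod

/-! ### Isogenies -/

section Isogeny

variable {K : Type u} [Field K] {A : Type u} [CommRing A] [HopfAlgebra K A]
  {E : Type u} [Field E] [Algebra K E] [Algebra E (AlgebraicClosure K)]
  [IsScalarTower K E (AlgebraicClosure K)] [FiniteDimensional K E] [IsGalois K E]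
  [SplitsPoints K A E]
  {M N : Type*} [AddCommGroup M] [DistribMulAction (FGal K A) M]
  [AddCommGroup N] [DistribMulAction (FGal K A) N]
  {X Y : FGroup K A} {i : X.Fun →ₐ[K] AddMonoidAlgebra E M} {i' : Y.Fun →ₐ[K] AddMonoidAlgebra E N}

lemma IsModel.charMap_mem_range (h : IsModel X i) (h' : IsModel Y i') (j : N →+[FGal K A] M)
    (b : Y.Fun) : charMap E j (i' b) ∈ i.range := by
  refine mem_range_of_semilinear_fixed h.isBaseChange
    (fun s => (galTwist (A := A) E M (galLift s)).toRingHom.toAddMonoidHom)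
    (fun s e x => (galTwist_smul E _ e x).trans (by rw [restrictNormalHom_galLift]; rfl))
    (fun s b => h.galTwist_apply _ b) fun s => ?_
  change galTwist (A := A) E M _ _ = _
  rw [← charMap_galTwist, h'.galTwist_apply]

/-- The homomorphism of algebras between models induced by a homomorphism of modules. -/
def IsModel.dualHom (h : IsModel X i) (h' : IsModel Y i') (j : N →+[FGal K A] M) :
    Y.Fun →ₐ[K] X.Fun :=
  liftThrough i h.injective (((charMap E j).restrictScalars K).comp i') (h.charMap_mem_range h' j)

lemma IsModel.apply_dualHom (h : IsModel X i) (h' : IsModel Y i') (j : N →+[FGal K A] M)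
    (b : Y.Fun) : i (h.dualHom h' j b) = charMap E j (i' b) :=
  apply_liftThrough _ _ _ (h.charMap_mem_range h' j) b

lemma IsModel.map_dualHom_coaction [Module.Finite K A] (h : IsModel X i) (h' : IsModel Y i')
    (j : N →+[FGal K A] M) (b : Y.Fun) :
    Algebra.TensorProduct.map (AlgHom.id K A) (h.dualHom h' j) (Y.coaction b) =
      X.coaction (h.dualHom h' j b) := by
  refine evalAll_injective E h.isBaseChange fun f => ?_
  rw [evalAt_map (pointOver E f) i' i (h.dualHom h' j) (charMap E j) (h.apply_dualHom h' j),
    h'.evalAt_coaction, h.evalAt_coaction, h.apply_dualHom, charMap_pointTwist]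

/-- The homomorphism of bialgebras between models induced by a homomorphism of modules. -/
def IsModel.dualBialgHom (h : IsModel X i) (h' : IsModel Y i') (j : N →+[FGal K A] M) :
    Y.Fun →ₐc[K] X.Fun :=
  BialgHom.ofAlgHom (h.dualHom h' j)
    (by
      ext b
      apply (algebraMap K E).injective
      change algebraMap K E (Coalgebra.counit (R := K) (h.dualHom h' j b)) =
        algebraMap K E (Coalgebra.counit (R := K) b)
      rw [h.algebraMap_counit, h.apply_dualHom, counit_charMap, h'.algebraMap_counit])
    (by
      ext b
      apply isBaseChange_injective (isBaseChange_tensorMap h.isBaseChange h.isBaseChange)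
      change tensorMap E i i (Algebra.TensorProduct.map (h.dualHom h' j) (h.dualHom h' j)
        (Coalgebra.comul (R := K) b)) =
        tensorMap E i i (Coalgebra.comul (R := K) (h.dualHom h' j b))
      rw [tensorMap_map i' i' i i _ _ (charMap E j) (charMap E j) (h.apply_dualHom h' j)
        (h.apply_dualHom h' j), h.tensorMap_comul, h'.tensorMap_comul, h.apply_dualHom,
        comul_charMap])

variable {j : N →+[FGal K A] M}

lemma IsModel.dualHom_injective (h : IsModel X i) (h' : IsModel Y i')
    (hj : Function.Injective j) : Function.Injective (h.dualHom h' j) := by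
  refine Function.Injective.of_comp (f := i) ?_
  have : i ∘ h.dualHom h' j = charMap E j ∘ i' := funext (h.apply_dualHom h' j)
  rw [this]
  exact (AddMonoidAlgebra.mapDomain_injective hj).comp h'.injective

/-- The surjectivity on spectra comes from integrality: over `E`, some power of a monomial of `E[M]`
lies in `E[N]`. -/
lemma IsModel.isIntegral_dualHom (h : IsModel X i) (h' : IsModel Y i')
    (hj : (j : N →+ M).range.FiniteIndex) : (h.dualHom h' j).toRingHom.IsIntegral := by
  let ψ : Y.Fun →+* AddMonoidAlgebra E M := (charMap E j).toRingHom.comp i'.toRingHom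
  let := ψ.toAlgebra
  have hψ (b : Y.Fun) : algebraMap Y.Fun (AddMonoidAlgebra E M) b = charMap E j (i' b) := rfl
  have : IsScalarTower K Y.Fun (AddMonoidAlgebra E M) := .of_algebraMap_eq fun k => by
    rw [hψ, AlgHom.commutes, IsScalarTower.algebraMap_apply K E (AddMonoidAlgebra E M),
      IsScalarTower.algebraMap_apply K E (AddMonoidAlgebra E N), AlgHom.commutes]
  have hE (c : E) (x : AddMonoidAlgebra E M) (hx : IsIntegral Y.Fun x) :
      IsIntegral Y.Fun (c • x) := by
    rw [Algebra.smul_def]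
    refine IsIntegral.mul ?_ hx
    have hc : IsIntegral K (algebraMap E (AddMonoidAlgebra E M) c) :=
      (Algebra.IsIntegral.isIntegral (R := K) c).algebraMap
    exact hc.tower_top
  have hN (y : AddMonoidAlgebra E N) : IsIntegral Y.Fun (charMap E j y) := by
    induction y using h'.isBaseChange.inductionOn with
    | zero => rw [map_zero]; exact isIntegral_zero
    | tmul b => exact (isIntegral_algebraMap (R := Y.Fun) (A := AddMonoidAlgebra E M) (x := b))
    | smul c y hy => rw [map_smul]; exact hE c _ hy
    | add x y hx hy => rw [map_add]; exact hx.add hy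
  have hM (y : AddMonoidAlgebra E M) : IsIntegral Y.Fun y := by
    induction y using AddMonoidAlgebra.induction_linear with
    | zero => exact isIntegral_zero
    | add x y hx hy => exact hx.add hy
    | single m c =>
      have h1 : AddMonoidAlgebra.single m c =
          c • (AddMonoidAlgebra.single m 1 : AddMonoidAlgebra E M) := by
        simp
      rw [h1]
      refine hE c _ (IsIntegral.of_pow (Nat.pos_of_ne_zero hj.index_ne_zero) ?_)
      obtain ⟨n, hn⟩ := AddSubgroup.nsmul_index_mem (j : N →+ M).range m
      rw [AddMonoidAlgebra.single_pow, one_pow, ← hn]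
      have := hN (.single n 1)
      rwa [charMap_single] at this
  intro x
  obtain ⟨p, hp, hp'⟩ := hM (i x)
  refine ⟨p, hp, h.injective ?_⟩
  rw [map_zero, ← hp']
  have hcomp : algebraMap Y.Fun (AddMonoidAlgebra E M) =
      i.toRingHom.comp (h.dualHom h' j).toRingHom :=
    RingHom.ext fun b => (h.apply_dualHom h' j b).symm
  rw [hcomp]
  exact Polynomial.hom_eval₂ p (h.dualHom h' j).toRingHom i.toRingHom x

lemma finite_of_finite_baseChange {K E V : Type*} [Field K] [Field E] [Algebra K E] [AddCommGroup V]
    [Module K V] [Module.Finite E (E ⊗[K] V)] : Module.Finite K V := by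
  rw [← Module.rank_lt_aleph0_iff]
  have h := Module.rank_lt_aleph0 E (E ⊗[K] V)
  rw [Module.rank_baseChange] at h
  simpa using h

/-- The finiteness of the kernel: over `E`, its functions are spanned by the monomials attached to
representatives of `M / N`. -/
lemma IsModel.finite_quotient (h : IsModel X i) (h' : IsModel Y i')
    (hj : (j : N →+ M).range.FiniteIndex) {J : Ideal X.Fun}
    (hJ : ∀ b, Coalgebra.counit (R := K) b = 0 → h.dualHom h' j b ∈ J) :
    Module.Finite K (X.Fun ⧸ J) := by
  let q : AddMonoidAlgebra E M →ₐ[E] E ⊗[K] (X.Fun ⧸ J) :=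
    (Algebra.TensorProduct.map (AlgHom.id E E) (Ideal.Quotient.mkₐ K J)).comp
      (h.toIsBialgForm.algEquiv.symm : AddMonoidAlgebra E M →ₐ[E] E ⊗[K] X.Fun)
  have hq (x : X.Fun) : q (i x) = 1 ⊗ₜ Ideal.Quotient.mk J x := by
    have h1 : h.toIsBialgForm.algEquiv.symm (i x) = 1 ⊗ₜ x := by
      rw [AlgEquiv.symm_apply_eq, IsBialgForm.algEquiv_tmul, one_smul]
    change Algebra.TensorProduct.map _ _ (h.toIsBialgForm.algEquiv.symm (i x)) = _
    rw [h1]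
    simp
  have hqsurj : Function.Surjective q := by
    have h1 : Function.Surjective
        (Algebra.TensorProduct.map (AlgHom.id E E) (Ideal.Quotient.mkₐ K J)) :=
      TensorProduct.map_surjective (g := LinearMap.id) (g' := (Ideal.Quotient.mkₐ K J).toLinearMap)
        Function.surjective_id (Ideal.Quotient.mkₐ_surjective K J)
    exact h1.comp (AlgEquiv.surjective h.toIsBialgForm.algEquiv.symm)
  have hN (y : AddMonoidAlgebra E N) : q (charMap E j y) =
      Coalgebra.counit (R := E) y • 1 := by
    induction y using h'.isBaseChange.inductionOn with
    | zero => simp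
    | tmul b =>
      change q (charMap E j (i' b)) = Coalgebra.counit (R := E) (i' b) • 1
      rw [← h.apply_dualHom h', hq, ← h'.algebraMap_counit, algebraMap_smul]
      have h1 : Ideal.Quotient.mk J (h.dualHom h' j b) =
          algebraMap K _ (Coalgebra.counit (R := K) b) := by
        rw [← sub_eq_zero]
        have h2 := hJ (b - algebraMap K _ (Coalgebra.counit (R := K) b)) (by simp)
        rw [map_sub, AlgHom.commutes] at h2
        exact Ideal.Quotient.eq_zero_iff_mem.2 h2
      rw [h1]
      simp [Algebra.TensorProduct.one_def, Algebra.algebraMap_eq_smul_one]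
    | smul c y hy => rw [map_smul, map_smul, hy, map_smul, smul_eq_mul, mul_smul]
    | add x y hx hy => simp only [map_add, hx, hy, add_smul]
  have hspan : Submodule.span E (Set.range fun s : M ⧸ (j : N →+ M).range =>
      q (.single s.out 1)) = ⊤ := by
    rw [eq_top_iff]
    rintro z -
    obtain ⟨y, rfl⟩ := hqsurj z
    induction y using AddMonoidAlgebra.induction_linear with
    | zero => simp
    | add x y hx hy => rw [map_add]; exact Submodule.add_mem _ hx hy
    | single m c =>
      obtain ⟨⟨_, n, rfl⟩, hn⟩ := QuotientAddGroup.mk_out_eq_add (j : N →+ M).range m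
      have h1 : (AddMonoidAlgebra.single m c : AddMonoidAlgebra E M) =
          c • (.single (m : M ⧸ (j : N →+ M).range).out 1 * charMap E j (.single (-n) 1)) := by
        rw [hn, charMap_single, AddMonoidAlgebra.single_mul_single]
        simp
      rw [h1, map_smul, map_mul, hN]
      refine Submodule.smul_mem _ _ ?_
      simp only [AddMonoidAlgebra.counit_single, CommSemiring.counit_apply, one_smul, mul_one]
      exact Submodule.subset_span ⟨_, rfl⟩
  have : Module.Finite E (E ⊗[K] (X.Fun ⧸ J)) :=
    Module.Finite.of_fg_top ⟨(Set.finite_range _).toFinset, by simpa using hspan⟩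
  exact finite_of_finite_baseChange (E := E)

/-- An injective homomorphism of modules with a finite cokernel defines an isogeny. -/
theorem IsModel.isIsogenousTo [Module.Finite K A] (h : IsModel X i) (h' : IsModel Y i')
    (j : N →+[FGal K A] M) (hj : Function.Injective j) (hj' : (j : N →+ M).range.FiniteIndex) :
    X.IsIsogenousTo Y := by
  refine ⟨h.dualBialgHom h' j, AlgHom.ext fun b => h.map_dualHom_coaction h' j b, ?_, ?_⟩
  · exact (h.isIntegral_dualHom h' hj').comap_surjective (h.dualHom_injective h' hj)
  · exact h.finite_quotient h' hj' fun b hb => Ideal.mem_map_of_mem _ hb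

end Isogeny

/-! ### Finite splitting fields -/

section Points

variable {K : Type u} [Field K] {A : Type u} [CommRing A] [HopfAlgebra K A] [Module.Finite K A]
  {K' : Type v} [Field K'] [Algebra K K']

/-- If `F` is constant over `K'`, its geometric points are the evaluations at the elements of the
corresponding finite group. -/
lemma exists_points_eq {G : Type} [Finite G] (e : K' ⊗[K] A ≃ₐ[K'] (G → K'))
    (ι : K' →ₐ[K] AlgebraicClosure K) :
    Nat.card (Points K A) = Module.finrank K A ∧
      ∀ f : Points K A, ∃ g : G, ∀ a, f.ofConv a = ι (e (1 ⊗ₜ a) g) := by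
  have := Fintype.ofFinite G
  let p (g : G) : Points K A := WithConv.toConv ((ι.comp
    (((Pi.evalAlgHom K' (fun _ : G => K') g).restrictScalars K).comp
      ((e : K' ⊗[K] A →ₐ[K'] (G → K')).restrictScalars K))).comp
        Algebra.TensorProduct.includeRight)
  have hp (g : G) (a : A) : (p g).ofConv a = ι (e (1 ⊗ₜ a) g) := rfl
  have hinj : Function.Injective p := by
    intro g h hgh
    have h1 (z : K' ⊗[K] A) : e z g = e z h := by
      induction z with
      | zero => simp
      | add x y hx hy => simp only [map_add, Pi.add_apply, hx, hy]
      | tmul c a =>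
        have h2 : c ⊗ₜ[K] a = c • ((1 : K') ⊗ₜ[K] a) := by
          rw [TensorProduct.smul_tmul', smul_eq_mul, mul_one]
        have h3 : e (1 ⊗ₜ a) g = e (1 ⊗ₜ a) h := by
          refine ι.injective ((hp g a).symm.trans (Eq.trans ?_ (hp h a)))
          rw [hgh]
        rw [h2, map_smul, Pi.smul_apply, Pi.smul_apply, h3]
    classical
    by_contra hne
    have h4 := h1 (e.symm (Pi.single g 1))
    rw [AlgEquiv.apply_symm_apply, Pi.single_eq_same, Pi.single_eq_of_ne (Ne.symm hne)] at h4
    exact one_ne_zero h4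
  have hG : Nat.card G = Module.finrank K A := by
    rw [← Module.finrank_baseChange (R := K'), e.toLinearEquiv.finrank_eq, Module.finrank_pi,
      Nat.card_eq_fintype_card]
  have hle : Nat.card (Points K A) ≤ Module.finrank K A := by
    have := Fintype.ofFinite (Points K A)
    have h1 := ((linearIndependent_toLinearMap K A (AlgebraicClosure K)).comp
      (WithConv.ofConv : Points K A → _) WithConv.ofConv_injective).fintype_card_le_finrank
    rwa [Module.finrank_linearMap_self, ← Nat.card_eq_fintype_card] at h1
  have hbij := hinj.bijective_of_nat_card_le (hle.trans hG.ge)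
  refine ⟨hle.antisymm (hG.symm.le.trans (Nat.card_le_card_of_injective p hinj)), fun f => ?_⟩
  obtain ⟨g, rfl⟩ := hbij.2 f
  exact ⟨g, hp g⟩

end Points

section Coefficients

variable {K : Type*} [Field K] {K' : Type*} [Field K'] [Algebra K K'] {B : Type*} [CommRing B]
  [Algebra K B]

/-- An element of `K' ⊗ B` is defined over a subextension generated by finitely many elements. -/
lemma exists_finite_coefficients (z : K' ⊗[K] B) : ∃ s : Set K', s.Finite ∧
    ∀ E : IntermediateField K K', s ⊆ E →
      ∃ y : E ⊗[K] B, Algebra.TensorProduct.map E.val (AlgHom.id K B) y = z := by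
  induction z with
  | zero => exact ⟨∅, Set.finite_empty, fun E _ => ⟨0, map_zero _⟩⟩
  | add x y hx hy =>
    obtain ⟨s, hs, hs'⟩ := hx
    obtain ⟨t, ht, ht'⟩ := hy
    refine ⟨s ∪ t, hs.union ht, fun E hE => ?_⟩
    obtain ⟨x', rfl⟩ := hs' E (Set.subset_union_left.trans hE)
    obtain ⟨y', rfl⟩ := ht' E (Set.subset_union_right.trans hE)
    exact ⟨x' + y', map_add _ _ _⟩
  | tmul c b =>
    refine ⟨{c}, Set.finite_singleton c, fun E hE => ⟨⟨c, hE rfl⟩ ⊗ₜ b, ?_⟩⟩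
    simp

end Coefficients

section SplittingField

variable {K : Type u} [Field K] {A : Type u} [CommRing A] [HopfAlgebra K A]
  {K' : Type v} [Field K'] [Algebra K K']

/-- Over a field `K'` embedded in `K̄` which splits `T`, the characters of `T` are the images of the
monomials. -/
lemma exists_char_val_eq {T : FGroup K A} {n : ℕ}
    (θ : K' ⊗[K] T.Fun ≃ₐc[K'] AddMonoidAlgebra K' (Fin n → ℤ)) (ι : K' →ₐ[K] AlgebraicClosure K)
    (χ : T.Char) : ∃ m : Fin n → ℤ, χ.val =
      Algebra.TensorProduct.map ι (AlgHom.id K T.Fun) (θ.symm (.single m 1)) := by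
  let := ι.toRingHom.toAlgebra
  have hι (c : K') : algebraMap K' (AlgebraicClosure K) c = ι c := rfl
  have : IsScalarTower K K' (AlgebraicClosure K) := .of_algebraMap_eq fun k => (ι.commutes k).symm
  have h := (isBialgForm_includeRight K' T.Fun).comp (BialgEquiv.isBialgForm θ)
  have hL := h.extend (AlgebraicClosure K)
  have key (z : K' ⊗[K] T.Fun) : hL.bialgEquiv (Algebra.TensorProduct.map ι (AlgHom.id K T.Fun) z) =
      extendScalars K' (AlgebraicClosure K) (Fin n → ℤ) (θ z) := by
    induction z with
    | zero => simp
    | add x y hx hy => simp only [map_add, hx, hy]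
    | tmul c b =>
      have h2 : c ⊗ₜ[K] b = c • ((1 : K') ⊗ₜ[K] b) := by
        rw [TensorProduct.smul_tmul', smul_eq_mul, mul_one]
      rw [Algebra.TensorProduct.map_tmul, IsBialgForm.bialgEquiv_tmul, h2, map_smul, map_smul,
        ← hι, algebraMap_smul]
      rfl
  obtain ⟨m, rfl⟩ := (charEquiv hL.bialgEquiv).surjective χ
  refine ⟨m, ?_⟩
  rw [charEquiv_val]
  refine hL.bialgEquiv.injective ((hL.bialgEquiv.apply_symm_apply _).trans ?_)
  refine Eq.trans ?_ (key _).symm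
  refine Eq.trans ?_ (congr_arg _ (θ.apply_symm_apply _).symm)
  simp

/-- A Galois extension which splits `F` and `T` contains a finite Galois extension which splits
`F` and over which the characters of `T` are defined. -/
theorem exists_finite_splitting [Module.Finite K A] [IsGalois K K']
    (hF : IsConstantOver K A K') {T : FGroup K A}
    (hT : T.IsSplitBy K') :
    ∃ E : IntermediateField K (AlgebraicClosure K), FiniteDimensional K E ∧ IsGalois K E ∧
      SplitsPoints K A E ∧ CharsDefinedOver E T ∧ Nonempty (E →ₐ[K] K') := by
  obtain ⟨G, _, _, e, -⟩ := hF
  obtain ⟨n, ⟨θ⟩⟩ := hT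
  let ι : K' →ₐ[K] AlgebraicClosure K := IsAlgClosed.lift
  obtain ⟨hcard, hpoints⟩ := exists_points_eq e ι
  -- finitely many monomials generate all of them
  obtain ⟨S, hS⟩ : AddMonoid.FG (Fin n → ℤ) := AddGroup.fg_iff_addMonoid_fg.1 inferInstance
  choose s hs hs' using fun m : Fin n → ℤ => exists_finite_coefficients (θ.symm (.single m 1))
  let b := Module.finBasis K A
  let C : Set K' := (⋃ m ∈ S, s m) ∪ Set.range fun p : G × Fin _ => e (1 ⊗ₜ b p.2) p.1
  have hC : C.Finite := (S.finite_toSet.biUnion fun m _ => hs m).union (Set.finite_range _)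
  have := hC.to_subtype
  let E' := FiniteGaloisIntermediateField.adjoin K C
  have hE' : C ⊆ E'.toIntermediateField := FiniteGaloisIntermediateField.subset_adjoin K C
  let E := E'.toIntermediateField.map ι
  let φ : E'.toIntermediateField ≃ₐ[K] E := E'.toIntermediateField.equivMap ι
  refine ⟨E, φ.toLinearEquiv.finiteDimensional, IsGalois.of_algEquiv φ, ⟨fun f => ?_, hcard⟩,
    fun χ => ?_, ⟨E'.toIntermediateField.val.comp φ.symm⟩⟩
  · obtain ⟨g, hg⟩ := hpoints f
    have hmem (a : A) : f.ofConv a ∈ E := by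
      rw [← b.sum_repr a, map_sum]
      refine sum_mem fun j _ => ?_
      rw [map_smul]
      refine E.smul_mem ?_
      rw [hg]
      exact ⟨_, hE' (Or.inr ⟨(g, j), rfl⟩), rfl⟩
    exact ⟨f.ofConv.codRestrict E.toSubalgebra hmem, fun a => rfl⟩
  · obtain ⟨m, hm⟩ := exists_char_val_eq θ ι χ
    have hφ (y : E'.toIntermediateField ⊗[K] T.Fun) :
        toClosure E T (Algebra.TensorProduct.map (φ : E'.toIntermediateField →ₐ[K] E)
          (AlgHom.id K T.Fun) y) = Algebra.TensorProduct.map ι (AlgHom.id K T.Fun)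
            (Algebra.TensorProduct.map E'.toIntermediateField.val (AlgHom.id K T.Fun) y) := by
      induction y with
      | zero => simp
      | add x y hx hy => simp only [map_add, hx, hy]
      | tmul c b =>
        simp only [toClosure, Algebra.TensorProduct.map_tmul, AlgHom.id_apply]
        rfl
    rw [hm]
    clear hm
    have hmS : m ∈ AddSubmonoid.closure (S : Set (Fin n → ℤ)) := by rw [hS]; trivial
    induction hmS using AddSubmonoid.closure_induction with
    | mem m hm =>
      obtain ⟨y, hy⟩ := hs' m E'.toIntermediateField fun x hx =>
        hE' (Or.inl (Set.mem_biUnion hm hx))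
      exact ⟨_, (hφ y).trans (congr_arg _ hy)⟩
    | zero =>
      refine ⟨1, ?_⟩
      rw [← AddMonoidAlgebra.one_def, map_one, map_one, map_one]
    | add m m' _ _ h h' =>
      obtain ⟨y, hy⟩ := h
      obtain ⟨y', hy'⟩ := h'
      refine ⟨y * y', ?_⟩
      have h1 : (AddMonoidAlgebra.single (m + m') 1 : AddMonoidAlgebra K' (Fin n → ℤ)) =
          .single m 1 * .single m' 1 := by
        rw [AddMonoidAlgebra.single_mul_single, mul_one]
      rw [h1, map_mul, map_mul, map_mul, hy, hy']

end SplittingField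

section Trivial

variable {K : Type u} [Field K] {A : Type u} [CommRing A] [HopfAlgebra K A]
  {E : IntermediateField K (AlgebraicClosure K)}

lemma trivialOver_of_fixingFGal [Normal K E] {M : Type*} [AddCommGroup M]
    [DistribMulAction (FGal K A) M] (h : ∀ g ∈ fixingFGal K A E, ∀ m : M, g • m = m) :
    TrivialOver K A E M := by
  intro σ hσ m
  refine h _ (mem_fixingFGal.2 ⟨rfl, fun x => ?_⟩) m
  have h1 := AlgEquiv.restrictNormal_commutes σ E x
  have h2 : σ.restrictNormal E = 1 := hσ
  rw [h2] at h1
  exact h1.symm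

lemma CharsDefinedOver.fixingFGal_smul {X : FGroup K A} (h : CharsDefinedOver E X)
    {g : FGal K A} (hg : g ∈ fixingFGal K A E) (χ : X.Char) : g • χ = χ := by
  obtain ⟨h1, h2⟩ := mem_fixingFGal.1 hg
  apply FGroup.Char.val_injective
  obtain ⟨y, hy⟩ := h χ
  have key (z : E ⊗[K] X.Fun) : X.gal g.right (toClosure E X z) = toClosure E X z := by
    induction z with
    | zero => simp
    | add x y hx hy => simp only [map_add, hx, hy]
    | tmul c b =>
      have h3 : g.right (c : AlgebraicClosure K) = c := h2 c
      simp [toClosure, FGroup.gal, h3]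
  rw [FGroup.Char.val_smul, h1, inv_one, X.pull_one, AlgHom.id_apply, ← hy, key]

end Trivial

end FTori

end

theorem corollary3p6 {K : Type u} [Field K] {A : Type u} [CommRing A] [HopfAlgebra K A]
    [Module.Finite K A] [Algebra.Smooth K A] :
    (∀ (K' : Type v) [Field K'] [Algebra K K'] [IsGalois K K'],
      FTori.IsConstantOver K A K' →
      ∀ T : FTori.FGroup K A, T.IsTorus → T.IsSplitBy K' →
        ∃ r : ℕ, 1 ≤ r ∧ ∃ T₀ : FTori.FGroup K A, T₀.IsQuasiSplitTorus ∧ T₀.IsSplitBy K' ∧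
          ∃ Q : FTori.FGroup K A, Q.IsQuasiSplitTorus ∧ ((T.pow r).prod T₀).IsIsogenousTo Q) ∧
    (∀ (M : Type w) [AddCommGroup M] [Module.Free ℤ M] [Module.Finite ℤ M]
      [DistribMulAction (FTori.FGal K A) M],
      (∀ m : M, IsOpen (MulAction.stabilizer (FTori.FGal K A) m : Set (FTori.FGal K A))) →
        ∃ r : ℕ, 1 ≤ r ∧
          ∃ (M₀ : Type u) (_ : AddCommGroup M₀) (_ : DistribMulAction (FTori.FGal K A) M₀)
            (M₁ : Type u) (_ : AddCommGroup M₁) (_ : DistribMulAction (FTori.FGal K A) M₁),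
            FTori.IsInduced (FTori.FGal K A) M₀ ∧ FTori.IsInduced (FTori.FGal K A) M₁ ∧
            ∃ j : M₁ →+[FTori.FGal K A] (Fin r → M) × M₀,
              Function.Injective j ∧ (j : M₁ →+ (Fin r → M) × M₀).range.FiniteIndex) := by
  constructor
  · intro K' _ _ _ hF T hT hS
    obtain ⟨E, _, _, _, hE, ⟨ψ⟩⟩ := FTori.exists_finite_splitting hF hS
    obtain ⟨_, _⟩ := FTori.free_finite_char hT
    obtain ⟨r, hr, X₀, X₁, _, _, _, _, j, h₀, h₁, hj, hj'⟩ :=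
      FTori.exists_permModule_isogeny_of_fixingFGal (E := E) (M := T.Char)
        fun g hg χ => hE.fixingFGal_smul hg χ
    obtain ⟨i, hi⟩ := FTori.exists_isModel_char hT hE
    obtain ⟨T₀, i₀, hi₀⟩ := FTori.exists_isModel (K := K) (A := A) (E := E)
      (M := FTori.PermModule X₀) (FTori.trivialOver_of_fixingFGal fun g hg =>
        FTori.PermModule.smul_eq_self_of_forall g (h₀ g hg))
    obtain ⟨Q, i₁, hi₁⟩ := FTori.exists_isModel (K := K) (A := A) (E := E)
      (M := FTori.PermModule X₁) (FTori.trivialOver_of_fixingFGal fun g hg =>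
        FTori.PermModule.smul_eq_self_of_forall g (h₁ g hg))
    obtain ⟨ir, hir⟩ := hi.pow r
    obtain ⟨k, hk⟩ := hir.prod hi₀
    let := ψ.toRingHom.toAlgebra
    have : IsScalarTower K E K' := .of_algebraMap_eq fun k => (ψ.commutes k).symm
    exact ⟨r, hr, T₀, hi₀.isQuasiSplitTorus (FTori.isInduced_permModule_of_fixingFGal X₀ h₀),
      hi₀.toIsBialgForm.isSplitBy K', Q,
      hi₁.isQuasiSplitTorus (FTori.isInduced_permModule_of_fixingFGal X₁ h₁),
      hk.isIsogenousTo hi₁ j hj hj'⟩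
  · intro M _ _ _ _ hM
    obtain ⟨E, _, hE⟩ := FTori.exists_fixingFGal_smul_eq hM
    obtain ⟨r, hr, X₀, X₁, _, _, _, _, j, h₀, h₁, hj, hj'⟩ :=
      FTori.exists_permModule_isogeny_of_fixingFGal hE
    exact ⟨r, hr, FTori.PermModule X₀, inferInstance, inferInstance, FTori.PermModule X₁,
      inferInstance, inferInstance, FTori.isInduced_permModule_of_fixingFGal X₀ h₀,
      FTori.isInduced_permModule_of_fixingFGal X₁ h₁, j, hj, hj'⟩
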